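/- Let $H$ be a separable complex Hilbert space (a real one is covered by complexification), $A:D(A)\subset H\to H$ a linear operator, $H_0:=\overline{D(A)}$, and let $A_0$ be the part of $A$ in $H_0$, i.e. $A_0x=Ax$ on $D(A_0)=\{x\in D(A):Ax\in H_0\}$. Write $R(\lambda,A)=(\lambda-A)^{-1}\in\mathcal L(H)$ for $\lambda\in\rho(A)$. Assume: (1) $A_0$ is sectorial: there are $w\in\mathbb R$, $\vartheta\in(\pi/2,\pi)$, $M>0$ such that every $z\neq w$ with $|\arg(z-w)|\le\vartheta$ lies in $\rho(A_0)$ and $\|R(z,A_0)\|\le M/|z-w|$. (2) There are $\omega_A<0$ and $p^*\in[1,\infty)$ with $(\omega_A,\infty)\subset\rho(A)$ and $\limsup_{\lambda\to+\infty}\lambda^{1/p^*}\|R(\lambda,A)\|_{\mathcal L(H)}<\infty$. (3) $R(\lambda,A)$ is a compact operator for every $\lambda\in\rho(A)$. (4) $(W_t)_{t\in\mathbb R}$ is a two-sided $Q$-Wiener process in $H$ ($Q$ a covariance operator of finite trace) on a probability space $(\Omega,\mathcal F,\mathbb P)$, and $(\theta_t)_{t\in\mathbb R}$ is an ergodic measurable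 flow of $\mathbb P$-preserving maps of $\Omega$ with $W_t(\theta_s\omega)=W_{t+s}(\omega)-W_s(\omega)$ for all $s,t\in\mathbb R$, $\omega\in\Omega$. (5) The linear problem $dY=AY\,dt+dW$, $Y(0)=0$, is well posed, in the sense that $p^*<2$, or that for almost every $\omega$ it has an integrated solution $Y\in C([0,\infty),H_0)$ (as defined below with $G=0$, $\xi=0$). (6) $G:H_0\to H$ is globally Lipschitz and of class $C^1$ (over $\mathbb R$). Then $A_0$ generates a strongly continuous semigroup $(T_0(t))_{t\ge0}$ on $H_0$, and for $\mathbb P$-almost every $\omega\in\Omega$ the following holds. For every $\xi\in H_0$ the equation $$dX(t)=AX(t)\,dt+G(X(t))\,dt+dW(t),\qquad X(0)=\xi,$$ has a unique integrated (mild) solution on $[0,\infty)$, i.e. a unique $X\in C([0,\infty),H_0)$ with $\int_0^tX(s)\,ds\in D(A)$ and $X(t)=\xi+A\int_0^tX(s)\,ds+\int_0^tG(X(s))\,ds+W_t(\omega)$ for all $t\ge0$. Put $\tilde\phi^t_\omega(\xi):=X(t)$. For every $t\ge0$ the map $\tilde\phi^t_\omega:H_0\to H_0$ is (real) Fréchet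 differentiable, and for every $t>0$ and $\xi\in H_0$ its derivative $D_\xi\tilde\phi^t_\omega$ satisfies $$D_\xi\tilde\phi^t_\omega[\eta]=T_0(t)\eta+\lim_{\lambda\to+\infty}\int_0^tT_0(t-s)\,\lambda R(\lambda,A)\,DG_{\tilde\phi^s_\omega(\xi)}\big(D_\xi\tilde\phi^s_\omega[\eta]\big)\,ds,\qquad\eta\in H_0,$$ and is a compact operator on $H_0$. -/

import Mathlib

open MeasureTheory ProbabilityTheory Set Filter
open scoped Topology

namespace NonDenseSEE

section Operators

variable {E : Type*} [NormedAddCommGroup E] [NormedSpace ℂ E]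

/-- The bounded operator `R` is a two-sided inverse of `z - A : D(A) → E`. -/
def IsResolvent (A : E →ₗ.[ℂ] E) (z : ℂ) (R : E →L[ℂ] E) : Prop :=
  (∀ x : E, ∃ h : R x ∈ A.domain, z • R x - A ⟨R x, h⟩ = x) ∧
    ∀ y : A.domain, R (z • (y : E) - A y) = (y : E)

/-- The resolvent set `ρ(A)`. -/
def resolventSet (A : E →ₗ.[ℂ] E) : Set ℂ :=
  {z | ∃ R : E →L[ℂ] E, IsResolvent A z R}

open Classical in
/-- The resolvent `R(z, A) = (z - A)⁻¹` for `z ∈ ρ(A)` (and `0` for other `z`). -/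
noncomputable def resolvent (A : E →ₗ.[ℂ] E) (z : ℂ) : E →L[ℂ] E :=
  if h : ∃ R : E →L[ℂ] E, IsResolvent A z R then h.choose else 0

/-- The closed subspace `X₀`, the closure of `D(A)`. -/
abbrev domClosure (A : E →ₗ.[ℂ] E) : Submodule ℂ E := A.domain.topologicalClosure

theorem resolvent_mem_domClosure (A : E →ₗ.[ℂ] E) (z : ℂ) (x : E) :
    resolvent A z x ∈ domClosure A := by
  unfold resolvent
  split_ifs with h
  · obtain ⟨hx, -⟩ := h.choose_spec.1 x
    exact A.domain.le_topologicalClosure hx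
  · simp

/-- The resolvent regarded as an operator from the whole space into the closure of `D(A)`. -/
noncomputable def resolventInto (A : E →ₗ.[ℂ] E) (z : ℂ) : E →L[ℂ] domClosure A :=
  (resolvent A z).codRestrict (domClosure A) (resolvent_mem_domClosure A z)

/-- The part `A₀` of `A` in the closure of `D(A)`: it has domain
`{x ∈ D(A) : A x ∈ closure of D(A)}` and acts as `A` there. -/
noncomputable def part (A : E →ₗ.[ℂ] E) : domClosure A →ₗ.[ℂ] domClosure A where
  domain :=
    { carrier := {x | ∃ h : (x : E) ∈ A.domain, A ⟨(x : E), h⟩ ∈ domClosure A}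
      zero_mem' := by
        refine ⟨A.domain.zero_mem, ?_⟩
        have : A ⟨((0 : domClosure A) : E), A.domain.zero_mem⟩ = 0 := A.map_zero
        rw [this]
        exact (domClosure A).zero_mem
      add_mem' := by
        rintro x y ⟨hx, hx'⟩ ⟨hy, hy'⟩
        refine ⟨A.domain.add_mem hx hy, ?_⟩
        have : A ⟨((x + y : domClosure A) : E), A.domain.add_mem hx hy⟩ =
            A ⟨(x : E), hx⟩ + A ⟨(y : E), hy⟩ := A.map_add ⟨(x : E), hx⟩ ⟨(y : E), hy⟩
        rw [this]
        exact (domClosure A).add_mem hx' hy'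
      smul_mem' := by
        rintro c x ⟨hx, hx'⟩
        refine ⟨A.domain.smul_mem c hx, ?_⟩
        have : A ⟨((c • x : domClosure A) : E), A.domain.smul_mem c hx⟩ =
            c • A ⟨(x : E), hx⟩ := A.map_smul c ⟨(x : E), hx⟩
        rw [this]
        exact (domClosure A).smul_mem c hx' }
  toFun :=
    { toFun := fun x => ⟨A ⟨((x : domClosure A) : E), x.2.choose⟩, x.2.choose_spec⟩
      map_add' := fun x y => Subtype.ext
        (A.map_add ⟨((x : domClosure A) : E), x.2.choose⟩
          ⟨((y : domClosure A) : E), y.2.choose⟩)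
      map_smul' := fun c x => Subtype.ext
        (A.map_smul c ⟨((x : domClosure A) : E), x.2.choose⟩) }

/-- `B` is sectorial: for some real `w`, some `θ ∈ (π/2, π)` and some `M > 0`, every
`z ≠ w` with `|arg (z - w)| ≤ θ` lies in `ρ(B)`, and `‖R(z, B)‖ ≤ M / |z - w|`. -/
def IsSectorial (B : E →ₗ.[ℂ] E) : Prop :=
  ∃ w θ M : ℝ, Real.pi / 2 < θ ∧ θ < Real.pi ∧ 0 < M ∧
    ∀ z : ℂ, z ≠ (w : ℂ) → |Complex.arg (z - (w : ℂ))| ≤ θ →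
      z ∈ resolventSet B ∧ ‖resolvent B z‖ ≤ M / ‖z - (w : ℂ)‖

/-- `(T t)_{t ≥ 0}` is a strongly continuous semigroup of bounded operators whose infinitesimal
generator is `B`. Only the values `T t` with `t ≥ 0` matter. -/
structure IsC0SemigroupGeneratedBy (T : ℝ → E →L[ℂ] E) (B : E →ₗ.[ℂ] E) : Prop where
  zero : T 0 = ContinuousLinearMap.id ℂ E
  add : ∀ s t : ℝ, 0 ≤ s → 0 ≤ t → T (s + t) = (T s).comp (T t)
  continuousOn : ∀ x : E, ContinuousOn (fun t => T t x) (Ici 0)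
  generator : ∀ x y : E, (∃ h : x ∈ B.domain, B ⟨x, h⟩ = y) ↔
    Tendsto (fun h : ℝ => h⁻¹ • (T h x - x)) (𝓝[>] 0) (𝓝 y)

/-- `X` is an integrated (mild) solution on `[0, ∞)` of `dX = A X dt + G(X) dt + dw`,
`X(0) = ξ`, for a given path `w`: `X` is continuous with values in the closure of `D(A)`, and for
all `t ≥ 0` the integral `∫₀ᵗ X` lies in `D(A)` and
`X(t) = ξ + A ∫₀ᵗ X(s) ds + ∫₀ᵗ G(X(s)) ds + w(t)`. -/
def IsIntegratedSolution (A : E →ₗ.[ℂ] E) (G : domClosure A → E) (w : ℝ → E)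
    (ξ : domClosure A) (X : ℝ → domClosure A) : Prop :=
  ContinuousOn X (Ici 0) ∧
    ∀ t : ℝ, 0 ≤ t → ∃ h : (∫ s in (0 : ℝ)..t, (X s : E)) ∈ A.domain,
      (X t : E) = (ξ : E) + A ⟨∫ s in (0 : ℝ)..t, (X s : E), h⟩ +
        (∫ s in (0 : ℝ)..t, G (X s)) + w t

/-- There is exactly one integrated solution on `[0, ∞)`. -/
def ExistsUniqueIntegratedSolution (A : E →ₗ.[ℂ] E) (G : domClosure A → E) (w : ℝ → E)
    (ξ : domClosure A) : Prop :=
  ∃ X : ℝ → domClosure A, IsIntegratedSolution A G w ξ X ∧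
    ∀ X' : ℝ → domClosure A, IsIntegratedSolution A G w ξ X' → EqOn X' X (Ici 0)

/-- The solution map: `solutionMap A G w t ξ` is the value at time `t` of the integrated solution
with initial value `ξ` (an arbitrary value if there is no solution). -/
noncomputable def solutionMap (A : E →ₗ.[ℂ] E) (G : domClosure A → E) (w : ℝ → E)
    (t : ℝ) (ξ : domClosure A) : domClosure A :=
  Classical.epsilon (fun X : ℝ → domClosure A => IsIntegratedSolution A G w ξ X) t

end Operators

/-- An ergodic metric dynamical system with time `ℝ`: a jointly measurable flow of
`P`-preserving maps for which every invariant event has probability `0` or `1`. -/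
structure IsErgodicMetricDS {Ω : Type*} [MeasurableSpace Ω] (P : Measure Ω)
    (θ : ℝ → Ω → Ω) : Prop where
  measurable : Measurable (fun q : ℝ × Ω => θ q.1 q.2)
  zero : ∀ ω, θ 0 ω = ω
  add : ∀ s t ω, θ (t + s) ω = θ t (θ s ω)
  measurePreserving : ∀ t, MeasurePreserving (θ t) P P
  ergodic : ∀ B : Set Ω, MeasurableSet B → (∀ t, θ t ⁻¹' B = B) → P B = 0 ∨ P B = 1

section Wiener

variable {H : Type*} [NormedAddCommGroup H] [InnerProductSpace ℂ H] [CompleteSpace H]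

/-- `Q` is a covariance operator of finite trace on `H`, where `H` is regarded as a real Hilbert
space with inner product `Re ⟪x, y⟫`: it is real-linear, symmetric, nonnegative and of finite
trace; the trace is computed in the real Hilbert basis formed by the `b i` and `I • b i`,
where `b` is a complex Hilbert basis. -/
def IsTraceClassCovariance (Q : H →L[ℝ] H) : Prop :=
  (∀ x y : H, (inner ℂ (Q x) y).re = (inner ℂ x (Q y)).re) ∧
  (∀ x : H, 0 ≤ (inner ℂ x (Q x)).re) ∧
  ∃ (s : Set H) (b : HilbertBasis s ℂ H), Summable fun i : s =>
    (inner ℂ (b i) (Q (b i))).re +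
      (inner ℂ (Complex.I • b i) (Q (Complex.I • b i))).re

/-- `W` is a two-sided `Q`-Wiener process in `H`: it starts at `0`, has continuous paths almost
surely and independent increments, and `W t - W s` is centred Gaussian with covariance
`(t - s) Q` for `s ≤ t`, that is, each real functional `Re ⟪h, W t - W s⟫` has the law
`N(0, (t - s) Re ⟪h, Q h⟫)`. -/
structure IsTwoSidedWiener {Ω : Type*} [MeasurableSpace Ω] [MeasurableSpace H]
    (P : Measure Ω) (Q : H →L[ℝ] H) (W : ℝ → Ω → H) : Prop where
  covariance : IsTraceClassCovariance Q
  measurable : ∀ t, Measurable (W t)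
  zero : ∀ᵐ ω ∂P, W 0 ω = 0
  continuous : ∀ᵐ ω ∂P, Continuous fun t => W t ω
  indep : HasIndepIncrements W P
  gaussian : ∀ s t : ℝ, s ≤ t → ∀ h : H,
    P.map (fun ω => (inner ℂ h (W t ω - W s ω)).re) =
      gaussianReal 0 (Real.toNNReal ((t - s) * (inner ℂ h (Q h)).re))

end Wiener

end NonDenseSEE

/-! The obstacle is that the semigroup `T` acts only on the closure of `D(A)`, while `G` and the
noise take values in all of `H`. The remedy is the kernel `U(t) = (l - A₀) T(t) R(l, A) : H → H₀`,
called `mildKernel`. It does not depend on `l` and satisfies `U(s + t) = T(s) U(t)` and `R(l, A)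
U(t) = T(t) R(l, A)`. Taking `l = c / t` and using the decay of the resolvent gives `‖U(t)‖ ≤ C t ^
(1/p - 1)`, an integrable singularity (`isSingularKernel_mildKernel`).

Fix a path of the noise and a solution `Y` of the linear problem driven by it. Then `X` is an
integrated solution exactly when `X(t) = T(t) ξ + Y(t) + ∫₀ᵗ U(t - s) G(X(s)) ds`
(`isIntegratedSolution_iff_volterra`), and everything else is deterministic Volterra theory. In the
norm `sup e^{-κt}‖·‖` with large `κ`, convolution with `U` is a contraction (`exists_weight`), which
yields existence, uniqueness and a Gronwall bound. The derivative in `ξ` is the flow `V` of the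
linearized Volterra equation (`hasFDerivAt_flow`). Since `l R(l, A₀) U(t) = T(t) l R(l, A)` and `l
R(l, A₀) → 1` strongly, its convolution term is the limit in the variation formula. For compactness,
`T(ε) V(t - ε)` is compact and differs from `V(t)` only by the convolution over `[t - ε, t]`, of
norm `O(ε ^ a)` (`isCompactOperator_flow`). Here `T(ε)` is compact because `A` has compact
resolvent.

Two inputs remain. The semigroup is built as a normalized integral of `e^ζ (ζ - tB)⁻³` over `Re ζ =
1`, the third power making all integrals absolutely convergent
(`IsSectorial.exists_analyticSemigroup`). When `p < 2`, the solution `Y` is constructed pathwise: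
Wiener paths are Hölder continuous of every order below `1/2`, the kernel exponent `a` can be taken
above `1/2`, and convolutions of `U` with difference quotients of the path converge geometrically
(`IsLinearProblem.exists_isMild`). -/

namespace NonDenseSEE

/-! ### The scalar inverse Laplace integral of `z⁻³` -/

section InverseLaplace

/-- The vertical line `Re ζ = 1`. -/
noncomputable def vline (y : ℝ) : ℂ := 1 + y * Complex.I

theorem vline_re (y : ℝ) : (vline y).re = 1 := by simp [vline]

theorem vline_ne_zero (y : ℝ) : vline y ≠ 0 := by
  intro h
  have := vline_re y
  rw [h] at this
  simp at this

theorem continuous_vline : Continuous vline := by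
  unfold vline
  fun_prop

theorem norm_vline_sq (y : ℝ) : ‖vline y‖ ^ 2 = 1 + y ^ 2 := by
  rw [Complex.sq_norm, Complex.normSq_apply]
  simp [vline]
  ring

theorem one_le_norm_vline (y : ℝ) : 1 ≤ ‖vline y‖ := by
  have := Complex.abs_re_le_norm (vline y)
  rwa [vline_re, abs_one] at this

theorem norm_exp_vline (y : ℝ) : ‖Complex.exp (vline y)‖ = Real.exp 1 := by
  rw [Complex.norm_exp, vline_re]

theorem hasDerivAt_vline (y : ℝ) : HasDerivAt vline Complex.I y := by
  have h := ((Complex.ofRealCLM.hasDerivAt (x := y)).mul_const Complex.I).const_add (1 : ℂ)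
  rw [Complex.ofRealCLM_apply, Complex.ofReal_one, one_mul] at h
  exact h

theorem inv_norm_vline_pow_le {n : ℕ} (hn : 2 ≤ n) (y : ℝ) :
    (‖vline y‖ ^ n)⁻¹ ≤ (1 + y ^ 2)⁻¹ := by
  rw [← norm_vline_sq]
  have := one_le_norm_vline y
  gcongr

theorem integrableOn_sq_mul_exp_neg {a : ℂ} (ha : a.re = 1) :
    IntegrableOn (fun x : ℝ => (x : ℂ) ^ 2 * Complex.exp (-(a * x))) (Ioi 0) := by
  have h := Real.GammaIntegral_convergent (s := 3) (by norm_num)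
  refine Integrable.mono' h (by fun_prop) ?_
  filter_upwards [ae_restrict_mem measurableSet_Ioi] with x hx
  have h3 : x ^ ((3 : ℝ) - 1) = x ^ 2 := by norm_num
  rw [h3, norm_mul, Complex.norm_exp, norm_pow, Complex.norm_real, Real.norm_eq_abs, sq_abs]
  simp [ha, mul_comm]

theorem integral_sq_mul_exp_neg {a : ℂ} (ha : a.re = 1) :
    ∫ x in Ioi (0 : ℝ), (x : ℂ) ^ 2 * Complex.exp (-(a * x)) = 2 / a ^ 3 := by
  have ha0 : a ≠ 0 := by
    rintro rfl
    simp at ha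
  have hd : ∀ x : ℝ, HasDerivAt
      (fun x : ℝ => -((x : ℂ) ^ 2 / a + 2 * x / a ^ 2 + 2 / a ^ 3) * Complex.exp (-(a * x)))
      ((x : ℂ) ^ 2 * Complex.exp (-(a * x))) x := by
    intro x
    have hx : HasDerivAt (fun z : ℂ => -(z ^ 2 / a + 2 * z / a ^ 2 + 2 / a ^ 3) *
        Complex.exp (-(a * z))) ((x : ℂ) ^ 2 * Complex.exp (-(a * x))) (x : ℂ) := by
      have h1 := ((((hasDerivAt_id (x : ℂ)).pow 2).div_const a).add
        (((hasDerivAt_id (x : ℂ)).const_mul 2).div_const (a ^ 2))).add_const (2 / a ^ 3)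
      have h2 := ((hasDerivAt_id (x : ℂ)).const_mul a).neg.cexp
      refine (h1.neg.mul h2).congr_deriv ?_
      simp
      field_simp
      ring
    exact hx.comp_ofReal
  have hpow : ∀ n : ℕ, Tendsto (fun x : ℝ => (x : ℂ) ^ n * Complex.exp (-(a * x))) atTop (𝓝 0) := by
    intro n
    rw [tendsto_zero_iff_norm_tendsto_zero]
    refine (Real.tendsto_pow_mul_exp_neg_atTop_nhds_zero n).congr' ?_
    filter_upwards [eventually_ge_atTop 0] with x hx
    rw [norm_mul, Complex.norm_exp, norm_pow, Complex.norm_real, Real.norm_of_nonneg hx]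
    simp [ha]
  have ht : Tendsto
      (fun x : ℝ => -((x : ℂ) ^ 2 / a + 2 * x / a ^ 2 + 2 / a ^ 3) * Complex.exp (-(a * x)))
      atTop (𝓝 0) := by
    have := (((hpow 2).const_mul (-a⁻¹)).add ((hpow 1).const_mul (-(2 / a ^ 2)))).add
      ((hpow 0).const_mul (-(2 / a ^ 3)))
    simp only [mul_zero, add_zero] at this
    refine this.congr fun x => ?_
    ring
  rw [integral_Ioi_of_hasDerivAt_of_tendsto' (fun x _ => hd x) (integrableOn_sq_mul_exp_neg ha) ht]
  simp

theorem integrable_inv_vline_cube : Integrable fun y : ℝ => (vline y ^ 3)⁻¹ := by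
  refine integrable_inv_one_add_sq.mono'
    (Continuous.aestronglyMeasurable ?_) (ae_of_all _ fun y => ?_)
  · exact (continuous_vline.pow 3).inv₀ fun y => pow_ne_zero _ (vline_ne_zero y)
  · rw [norm_inv, norm_pow]
    exact inv_norm_vline_pow_le (by norm_num) y

-- The function `max(x, 0)² e^{-x}` has Fourier transform `2 (1 + 2πiw)⁻³`. Fourier inversion at `x
-- = 1` makes the integral a nonzero multiple of the value `e⁻¹`. Only nonvanishing is needed, since
-- the integral serves as a normalizing constant.
open scoped FourierTransform in
theorem integral_exp_div_vline_cube_ne_zero :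
    ∫ y : ℝ, Complex.exp (vline y) * (vline y ^ 3)⁻¹ ≠ 0 := by
  set f : ℝ → ℂ := fun x => ((max x 0 : ℝ) : ℂ) ^ 2 * Complex.exp (-x) with hf
  have hfi : f = (Ioi (0 : ℝ)).indicator (fun x : ℝ => (x : ℂ) ^ 2 * Complex.exp (-(1 * x))) := by
    funext x
    by_cases hx : x ∈ Ioi (0 : ℝ)
    · rw [indicator_of_mem hx, hf]
      simp [max_eq_left (le_of_lt (mem_Ioi.1 hx))]
    · rw [indicator_of_notMem hx, hf]
      simp [max_eq_right (not_lt.1 (fun h => hx (mem_Ioi.2 h)))]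
  have hfint : Integrable f := by
    rw [hfi]
    exact (integrableOn_sq_mul_exp_neg (a := 1) (by simp)).integrable_indicator measurableSet_Ioi
  have hfc : Continuous f := by
    rw [hf]
    fun_prop
  have hF : 𝓕 f = fun w : ℝ => 2 * (vline (2 * Real.pi * w) ^ 3)⁻¹ := by
    funext w
    rw [Real.fourier_eq', ← div_eq_mul_inv, ← integral_sq_mul_exp_neg (vline_re _),
      ← integral_indicator measurableSet_Ioi]
    congr 1
    funext x
    rw [hfi]
    by_cases hx : x ∈ Ioi (0 : ℝ)
    · rw [indicator_of_mem hx, indicator_of_mem hx, smul_eq_mul, mul_left_comm,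
        ← Complex.exp_add]
      congr 2
      simp [vline]
      ring
    · rw [indicator_of_notMem hx, indicator_of_notMem hx, smul_zero]
  have hFi : Integrable (𝓕 f) := by
    rw [hF]
    exact (integrable_inv_vline_cube.comp_mul_left' (by positivity)).const_mul 2
  have key := congrFun (hfc.fourierInv_fourier_eq hfint hFi) 1
  rw [Real.fourierInv_eq', hF] at key
  have hval : f 1 ≠ 0 := by
    simp [hf]
  intro h0
  apply hval
  rw [← key]
  have h1 : ∀ v : ℝ, Complex.exp (↑(2 * Real.pi * inner ℝ v (1 : ℝ)) * Complex.I) •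
      (2 * (vline (2 * Real.pi * v) ^ 3)⁻¹) = 2 * Complex.exp (-1) *
      (fun y : ℝ => Complex.exp (vline y) * (vline y ^ 3)⁻¹) ((2 * Real.pi) * v) := by
    intro v
    have : Complex.exp (↑(2 * Real.pi * inner ℝ v (1 : ℝ)) * Complex.I) =
        Complex.exp (-1) * Complex.exp (vline (2 * Real.pi * v)) := by
      rw [← Complex.exp_add]
      congr 1
      simp [vline]
    rw [this, smul_eq_mul]
    ring
  simp_rw [h1]
  rw [integral_const_mul, Measure.integral_comp_mul_left
    (fun y : ℝ => Complex.exp (vline y) * (vline y ^ 3)⁻¹), h0]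
  simp

end InverseLaplace

/-! ### Resolvent families on the right half-plane -/

section HalfPlane

variable {E : Type*} [NormedAddCommGroup E] [NormedSpace ℂ E]

/-- `R` is a family of operators on the right half-plane which satisfies the resolvent identity,
the bound `‖R z‖ ≤ M / ‖z‖`, and has dense range. -/
structure IsHalfPlaneResolvent (R : ℂ → E →L[ℂ] E) (M : ℝ) : Prop where
  identity : ∀ z z' : ℂ, 0 < z.re → 0 < z'.re → R z - R z' = (z' - z) • (R z * R z')
  bound : ∀ z : ℂ, 0 < z.re → ‖R z‖ ≤ M / ‖z‖
  dense : DenseRange (R 1)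

namespace IsHalfPlaneResolvent

variable {R : ℂ → E →L[ℂ] E} {M : ℝ}

theorem nonneg (h : IsHalfPlaneResolvent R M) : 0 ≤ M := by
  have := (norm_nonneg _).trans (h.bound 1 (by simp))
  simpa using this

theorem commute (h : IsHalfPlaneResolvent R M) {z z' : ℂ} (hz : 0 < z.re) (hz' : 0 < z'.re) :
    R z * R z' = R z' * R z := by
  rcases eq_or_ne z z' with rfl | hne
  · rfl
  · have h1 := h.identity z z' hz hz'
    have h2 := h.identity z' z hz' hz
    have h3 : (z' - z) • (R z * R z') = (z' - z) • (R z' * R z) := by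
      rw [← h1, ← neg_sub, h2, ← neg_smul, neg_sub]
    exact smul_right_injective _ (sub_ne_zero.2 hne.symm) h3

theorem ne_zero_of_re_pos {z : ℂ} (hz : 0 < z.re) : z ≠ 0 := by
  rintro rfl
  simp at hz

theorem continuousAt (h : IsHalfPlaneResolvent R M) {z : ℂ} (hz : 0 < z.re) :
    ContinuousAt R z := by
  have hnhds : ∀ᶠ z' in 𝓝 z, 0 < z'.re :=
    Complex.continuous_re.continuousAt.eventually (lt_mem_nhds hz)
  rw [ContinuousAt, tendsto_iff_norm_sub_tendsto_zero]
  have hlim : Tendsto (fun z' : ℂ => ‖z - z'‖ * (M / ‖z'‖ * (M / ‖z‖))) (𝓝 z) (𝓝 0) := by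
    have : ContinuousAt (fun z' : ℂ => ‖z - z'‖ * (M / ‖z'‖ * (M / ‖z‖))) z := by
      have hz0 := norm_ne_zero_iff.2 (ne_zero_of_re_pos hz)
      fun_prop (disch := assumption)
    simpa [ContinuousAt] using this
  refine squeeze_zero' (Eventually.of_forall fun _ => norm_nonneg _) ?_ hlim
  filter_upwards [hnhds] with z' hz'
  rw [h.identity z' z hz' hz, norm_smul]
  gcongr
  refine (norm_mul_le _ _).trans ?_
  have := h.nonneg
  gcongr
  · exact h.bound z' hz'
  · exact h.bound z hz

theorem hasDerivAt (h : IsHalfPlaneResolvent R M) {z : ℂ} (hz : 0 < z.re) :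
    HasDerivAt R (-(R z * R z)) z := by
  rw [hasDerivAt_iff_tendsto_slope]
  have hnhds : ∀ᶠ z' in 𝓝 z, 0 < z'.re :=
    Complex.continuous_re.continuousAt.eventually (lt_mem_nhds hz)
  have hc : Tendsto (fun z' => -(R z' * R z)) (𝓝[≠] z) (𝓝 (-(R z * R z))) :=
    (((h.continuousAt hz).mul continuousAt_const).neg).tendsto.mono_left nhdsWithin_le_nhds
  refine hc.congr' ?_
  filter_upwards [nhdsWithin_le_nhds hnhds, self_mem_nhdsWithin] with z' hz' hne
  rw [slope_def_module, h.identity z' z hz' hz, smul_smul, ← neg_sub z' z, mul_neg,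
    inv_mul_cancel₀ (sub_ne_zero.2 hne), neg_smul, one_smul]

/-- `z R(z) x → x` as `|z| → ∞` in the right half-plane. -/
theorem tendsto_smul (h : IsHalfPlaneResolvent R M) {ι : Type*} {l : Filter ι} {f : ι → ℂ}
    (hf : ∀ᶠ i in l, 0 < (f i).re) (hlim : Tendsto (fun i => ‖f i‖) l atTop) (x : E) :
    Tendsto (fun i => f i • R (f i) x) l (𝓝 x) := by
  have hM := h.nonneg
  have hb : ∀ z : ℂ, 0 < z.re → ∀ v : E, ‖z • R z v‖ ≤ M * ‖v‖ := by
    intro z hz v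
    have hz0 := norm_pos_iff.2 (ne_zero_of_re_pos hz)
    rw [norm_smul]
    calc ‖z‖ * ‖R z v‖ ≤ ‖z‖ * (M / ‖z‖ * ‖v‖) := by
          gcongr
          exact (R z).le_of_opNorm_le (h.bound z hz) v
      _ = M * ‖v‖ := by field_simp
  -- On the range of `R 1` the resolvent identity gives the explicit difference `(1 - z)⁻¹ (z R(z) y
  -- - R(1) y)`, which is `O(1/|z|)`. Density of the range and `‖z R(z)‖ ≤ M` then cover every `x`.
  have hrange : ∀ y : E, Tendsto (fun i => f i • R (f i) (R 1 y)) l (𝓝 (R 1 y)) := by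
    intro y
    rw [tendsto_iff_norm_sub_tendsto_zero]
    have hinv : Tendsto (fun i => (M * ‖y‖ + ‖R 1 y‖) * (‖f i‖ - 1)⁻¹) l (𝓝 0) := by
      have := (tendsto_inv_atTop_zero.comp (tendsto_atTop_add_const_right l (-1) hlim)).const_mul
        (M * ‖y‖ + ‖R 1 y‖)
      simpa [sub_eq_add_neg] using this
    refine squeeze_zero' (Eventually.of_forall fun _ => norm_nonneg _) ?_ hinv
    filter_upwards [hf, hlim.eventually_gt_atTop 1] with i hi hi1
    have hne : (1 : ℂ) - f i ≠ 0 := by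
      intro h0
      rw [sub_eq_zero] at h0
      rw [← h0] at hi1
      simp at hi1
    have hid := congrArg (fun L : E →L[ℂ] E => L y) (h.identity (f i) 1 hi (by simp))
    change R (f i) y - R 1 y = (1 - f i) • R (f i) (R 1 y) at hid
    have heq : f i • R (f i) (R 1 y) - R 1 y = (1 - f i)⁻¹ • (f i • R (f i) y - R 1 y) := by
      rw [eq_inv_smul_iff₀ hne, smul_sub, smul_comm, ← hid]
      module
    rw [heq, norm_smul, norm_inv, mul_comm]
    have h1 : ‖f i‖ - 1 ≤ ‖1 - f i‖ := by
      have := norm_sub_norm_le (f i) 1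
      rwa [norm_one, norm_sub_rev] at this
    have h2 : 0 < ‖f i‖ - 1 := by linarith
    gcongr
    exact (norm_sub_le _ _).trans (by gcongr; exact hb _ hi y)
  rw [Metric.tendsto_nhds]
  intro ε hε
  obtain ⟨y, hy⟩ : ∃ y, dist x (R 1 y) < ε / (2 * (M + 2)) := h.dense.exists_dist_lt x (by positivity)
  filter_upwards [hf, (Metric.tendsto_nhds.1 (hrange y)) (ε / 2) (by positivity)] with i hi hi2
  rw [dist_eq_norm] at *
  have : f i • R (f i) x - x = f i • R (f i) (x - R 1 y) + (f i • R (f i) (R 1 y) - R 1 y)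
      - (x - R 1 y) := by
    rw [map_sub, smul_sub]
    abel
  rw [this]
  calc _ ≤ M * ‖x - R 1 y‖ + ‖f i • R (f i) (R 1 y) - R 1 y‖ + ‖x - R 1 y‖ :=
        (norm_sub_le _ _).trans (by gcongr; exact (norm_add_le _ _).trans (by gcongr; exact hb _ hi _))
    _ < ε := by
      have h3 : (M + 2) * ‖x - R 1 y‖ ≤ (M + 2) * (ε / (2 * (M + 2))) := by gcongr
      have h4 : (M + 2) * (ε / (2 * (M + 2))) = ε / 2 := by field_simp
      nlinarith [norm_nonneg (x - R 1 y)]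

/-- By the resolvent identity a vector killed by one `R z` is killed by all of them, whereas `r R(r)
x → x` as `r → ∞`. -/
theorem injective (h : IsHalfPlaneResolvent R M) {z : ℂ} (hz : 0 < z.re) {x : E}
    (hx : R z x = 0) : x = 0 := by
  have hall : ∀ z' : ℂ, 0 < z'.re → R z' x = 0 := by
    intro z' hz'
    have hid := congrArg (fun L : E →L[ℂ] E => L x) (h.identity z' z hz' hz)
    simpa [hx] using hid
  have ht := h.tendsto_smul (l := atTop) (f := fun r : ℝ => (r : ℂ))
    (by filter_upwards [eventually_gt_atTop 0] with r hr; simpa using hr)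
    (by simpa using tendsto_abs_atTop_atTop) x
  refine tendsto_nhds_unique (ht.congr' ?_) tendsto_const_nhds |>.symm ▸ rfl
  filter_upwards [eventually_gt_atTop 0] with r hr
  rw [hall _ (by simpa using hr), smul_zero]

end IsHalfPlaneResolvent

end HalfPlane

/-! ### The exponential as a contour integral: definitions and bounds -/

section HalfPlane

variable {E : Type*} [NormedAddCommGroup E] [NormedSpace ℂ E]

/-- `(ζ - tB)⁻¹` on the line `Re ζ = 1`, where `R z = (z - B)⁻¹`. -/
noncomputable def scaledResolvent (R : ℂ → E →L[ℂ] E) (t y : ℝ) : E →L[ℂ] E :=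
  (t : ℂ)⁻¹ • R (vline y / t)

/-- The constant which normalizes the inverse Laplace transform of `z⁻³`. -/
noncomputable def laplaceConst : ℂ :=
  (∫ y : ℝ, Complex.exp (vline y) * (vline y ^ 3)⁻¹)⁻¹

/-- The operator `exp(tB)`, `t > 0`, as an inverse Laplace transform. -/
noncomputable def expOp (R : ℂ → E →L[ℂ] E) (t : ℝ) : E →L[ℂ] E :=
  laplaceConst • ∫ y : ℝ, Complex.exp (vline y) • scaledResolvent R t y ^ 3

/-- The operator `B exp(tB)`, `t > 0`, as an inverse Laplace transform. -/
noncomputable def expOpDeriv (R : ℂ → E →L[ℂ] E) (t : ℝ) : E →L[ℂ] E :=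
  laplaceConst • ∫ y : ℝ, Complex.exp (vline y) •
    ((3 / t : ℂ) • (vline y • scaledResolvent R t y ^ 4 - scaledResolvent R t y ^ 3))

namespace IsHalfPlaneResolvent

variable {R : ℂ → E →L[ℂ] E} {M : ℝ}

theorem div_re_pos {t : ℝ} (ht : 0 < t) (y : ℝ) : 0 < (vline y / t).re := by
  rw [Complex.div_ofReal_re, vline_re]
  positivity

theorem norm_scaled_le (h : IsHalfPlaneResolvent R M) {t : ℝ} (ht : 0 < t) (y : ℝ) :
    ‖scaledResolvent R t y‖ ≤ M / ‖vline y‖ := by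
  rw [scaledResolvent, norm_smul, norm_inv, Complex.norm_real, Real.norm_of_nonneg ht.le]
  calc t⁻¹ * ‖R (vline y / t)‖ ≤ t⁻¹ * (M / ‖vline y / t‖) := by
        gcongr
        exact h.bound _ (div_re_pos ht y)
    _ = M / ‖vline y‖ := by
      rw [norm_div, Complex.norm_real, Real.norm_of_nonneg ht.le]
      field_simp

theorem norm_scaled_pow_le (h : IsHalfPlaneResolvent R M) {t : ℝ} (ht : 0 < t) (y : ℝ) {n : ℕ}
    (hn : 0 < n) : ‖scaledResolvent R t y ^ n‖ ≤ M ^ n * (‖vline y‖ ^ n)⁻¹ := by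
  refine (norm_pow_le' _ hn).trans ?_
  rw [← div_eq_mul_inv, ← div_pow]
  gcongr
  exact h.norm_scaled_le ht y

theorem continuous_scaled (h : IsHalfPlaneResolvent R M) {t : ℝ} (ht : 0 < t) :
    Continuous fun y => scaledResolvent R t y := by
  unfold scaledResolvent
  have : Continuous fun y : ℝ => R (vline y / t) := ?_
  · exact this.const_smul ((t : ℂ)⁻¹)
  rw [continuous_iff_continuousAt]
  intro y
  exact ContinuousAt.comp (f := fun y => vline y / (t : ℂ)) (g := R)
    (h.continuousAt (div_re_pos ht y)) (continuous_vline.div_const _).continuousAt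

theorem integrable_exp_smul [CompleteSpace E] {F : ℝ → E →L[ℂ] E} (hF : Continuous F) {C : ℝ}
    (hb : ∀ y, ‖F y‖ ≤ C * (1 + y ^ 2)⁻¹) :
    Integrable fun y => Complex.exp (vline y) • F y := by
  refine (integrable_inv_one_add_sq.const_mul (Real.exp 1 * C)).mono'
    (Continuous.aestronglyMeasurable ?_) (ae_of_all _ fun y => ?_)
  · exact (Complex.continuous_exp.comp continuous_vline).smul hF
  · rw [norm_smul, norm_exp_vline, mul_assoc]
    gcongr
    exact hb y

theorem norm_scaled_pow_le' (h : IsHalfPlaneResolvent R M) {t : ℝ} (ht : 0 < t) (y : ℝ) {n : ℕ}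
    (hn : 2 ≤ n) : ‖scaledResolvent R t y ^ n‖ ≤ M ^ n * (1 + y ^ 2)⁻¹ :=
  (h.norm_scaled_pow_le ht y (by omega)).trans (by
    exact mul_le_mul_of_nonneg_left (inv_norm_vline_pow_le hn y) (pow_nonneg h.nonneg n))

theorem integrable_scaled_pow [CompleteSpace E] (h : IsHalfPlaneResolvent R M) {t : ℝ}
    (ht : 0 < t) {n : ℕ} (hn : 2 ≤ n) :
    Integrable fun y => Complex.exp (vline y) • scaledResolvent R t y ^ n :=
  integrable_exp_smul ((h.continuous_scaled ht).pow n) fun y => h.norm_scaled_pow_le' ht y hn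

theorem norm_deriv_integrand_le (h : IsHalfPlaneResolvent R M) {t : ℝ} (ht : 0 < t) (y : ℝ) :
    ‖(3 / t : ℂ) • (vline y • scaledResolvent R t y ^ 4 - scaledResolvent R t y ^ 3)‖ ≤
      3 / t * (M ^ 4 + M ^ 3) * (1 + y ^ 2)⁻¹ := by
  have hM := h.nonneg
  rw [norm_smul, norm_div, Complex.norm_real, Real.norm_of_nonneg ht.le, mul_assoc]
  have h3 : ‖(3 : ℂ)‖ = 3 := by simp
  rw [h3]
  gcongr
  refine (norm_sub_le _ _).trans ?_
  rw [add_mul]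
  refine add_le_add ?_ (h.norm_scaled_pow_le' ht y (by norm_num))
  rw [norm_smul]
  have hv : 0 < ‖vline y‖ := norm_pos_iff.2 (vline_ne_zero y)
  calc ‖vline y‖ * ‖scaledResolvent R t y ^ 4‖ ≤ ‖vline y‖ * (M ^ 4 * (‖vline y‖ ^ 4)⁻¹) := by
        gcongr
        exact h.norm_scaled_pow_le ht y (by norm_num)
    _ = M ^ 4 * (‖vline y‖ ^ 3)⁻¹ := by field_simp
    _ ≤ M ^ 4 * (1 + y ^ 2)⁻¹ := by
      exact mul_le_mul_of_nonneg_left (inv_norm_vline_pow_le (by norm_num) y) (by positivity)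

theorem integrable_deriv [CompleteSpace E] (h : IsHalfPlaneResolvent R M) {t : ℝ} (ht : 0 < t) :
    Integrable fun y => Complex.exp (vline y) •
      ((3 / t : ℂ) • (vline y • scaledResolvent R t y ^ 4 - scaledResolvent R t y ^ 3)) := by
  refine integrable_exp_smul ?_ fun y => h.norm_deriv_integrand_le ht y
  have := h.continuous_scaled ht
  have := continuous_vline
  fun_prop

theorem norm_integral_exp_smul_le {F : ℝ → E →L[ℂ] E} {C : ℝ}
    (hb : ∀ y, ‖F y‖ ≤ C * (1 + y ^ 2)⁻¹) :
    ‖∫ y : ℝ, Complex.exp (vline y) • F y‖ ≤ Real.exp 1 * Real.pi * C := by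
  have := norm_integral_le_of_norm_le (μ := volume) (f := fun y => Complex.exp (vline y) • F y)
    (integrable_inv_one_add_sq.const_mul (Real.exp 1 * C)) (ae_of_all _ fun y => by
      rw [norm_smul, norm_exp_vline, mul_assoc]
      gcongr
      exact hb y)
  rw [integral_const_mul, integral_univ_inv_one_add_sq] at this
  linarith

theorem exists_bound_expOp (h : IsHalfPlaneResolvent R M) :
    ∃ C : ℝ, 0 ≤ C ∧ (∀ t : ℝ, 0 < t → ‖expOp R t‖ ≤ C) ∧
      ∀ t : ℝ, 0 < t → ‖expOpDeriv R t‖ ≤ C / t := by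
  have hM := h.nonneg
  -- The scale-invariant bound `M / ‖ζ‖` for `(ζ - tB)⁻¹` makes the constant independent of `t`. The
  -- derivative needs `3 (M⁴ + M³)`, which also dominates the `M³` needed for `expOp`.
  refine ⟨‖laplaceConst‖ * (Real.exp 1 * Real.pi * (3 * (M ^ 4 + M ^ 3))), by positivity, ?_, ?_⟩
  · intro t ht
    rw [expOp, norm_smul]
    gcongr
    refine (norm_integral_exp_smul_le fun y =>
      h.norm_scaled_pow_le' ht y (n := 3) (by norm_num)).trans ?_
    gcongr
    nlinarith [pow_nonneg hM 3, pow_nonneg hM 4]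
  · intro t ht
    rw [expOpDeriv, norm_smul, mul_div_assoc]
    gcongr
    refine (norm_integral_exp_smul_le fun y => h.norm_deriv_integrand_le ht y).trans (le_of_eq ?_)
    field_simp

theorem commute_scaled (h : IsHalfPlaneResolvent R M) {t : ℝ} (ht : 0 < t) (y : ℝ) {z : ℂ}
    (hz : 0 < z.re) : Commute (R z) (scaledResolvent R t y) := by
  unfold scaledResolvent
  exact Commute.smul_right (h.commute hz (div_re_pos ht y)) _

theorem hasDerivAt_scaled_left (h : IsHalfPlaneResolvent R M) {t : ℝ} (ht : 0 < t) (y : ℝ) :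
    HasDerivAt (fun t => scaledResolvent R t y)
      ((t : ℂ)⁻¹ • (vline y • (scaledResolvent R t y * scaledResolvent R t y) -
        scaledResolvent R t y)) t := by
  have ht0 : (t : ℂ) ≠ 0 := by exact_mod_cast ht.ne'
  have h1 : HasDerivAt (fun t : ℂ => t⁻¹) (-((t : ℂ) ^ 2)⁻¹) (t : ℂ) := hasDerivAt_inv ht0
  have h2 : HasDerivAt (fun t : ℂ => vline y / t) (vline y * -((t : ℂ) ^ 2)⁻¹) (t : ℂ) := by
    simpa [div_eq_mul_inv] using h1.const_mul (vline y)
  have h3 := (h.hasDerivAt (div_re_pos ht y)).scomp (t : ℂ) h2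
  have h4 := HasDerivAt.scomp (𝕜 := ℝ) (𝕜' := ℂ) t (h1.smul h3)
    (Complex.ofRealCLM.hasDerivAt (x := t))
  refine h4.congr_deriv ?_
  simp only [scaledResolvent, Complex.ofRealCLM_apply, Complex.ofReal_one, one_smul, Function.comp_apply, smul_mul_assoc, mul_smul_comm, smul_smul,
    smul_neg, smul_sub, neg_smul]
  rw [← sub_eq_add_neg]
  congr 1
  · rw [← neg_smul]
    congr 1
    field_simp
  · rw [← mul_inv, sq]

theorem hasDerivAt_scaled_right (h : IsHalfPlaneResolvent R M) {t : ℝ} (ht : 0 < t) (y : ℝ) :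
    HasDerivAt (fun y => scaledResolvent R t y)
      (-Complex.I • (scaledResolvent R t y * scaledResolvent R t y)) y := by
  have h2 : HasDerivAt (fun y : ℝ => vline y / (t : ℂ)) (Complex.I / t) y :=
    (hasDerivAt_vline y).div_const _
  have h3 := HasDerivAt.scomp (𝕜 := ℝ) (𝕜' := ℂ) y (h.hasDerivAt (div_re_pos ht y)) h2
  have h4 := h3.const_smul ((t : ℂ)⁻¹)
  refine h4.congr_deriv ?_
  simp only [scaledResolvent, smul_mul_assoc, mul_smul_comm, smul_smul, smul_neg]
  rw [← neg_smul]
  congr 1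
  field_simp

end IsHalfPlaneResolvent

end HalfPlane

/-! ### Differentiability, generator identity and strong continuity of the exponential -/

section HalfPlane

variable {E : Type*} [NormedAddCommGroup E] [NormedSpace ℂ E]

theorem hasDerivAt_cube {𝔸 : Type*} [NormedRing 𝔸] [NormedAlgebra ℝ 𝔸] {f : ℝ → 𝔸} {f' : 𝔸}
    {x : ℝ} (hf : HasDerivAt f f' x) (hc : Commute (f x) f') :
    HasDerivAt (fun x => f x ^ 3) (3 • (f' * f x ^ 2)) x := by
  have h := (hf.fun_mul hf).fun_mul hf
  have e : (fun x => f x ^ 3) = fun x => f x * f x * f x := by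
    funext x
    rw [pow_succ, sq]
  rw [e]
  refine h.congr_deriv ?_
  rw [hc.eq, sq, mul_assoc (f x) (f x) f', hc.eq, ← mul_assoc (f x) f', hc.eq]
  simp only [add_mul, mul_assoc]
  abel

namespace IsHalfPlaneResolvent

variable {R : ℂ → E →L[ℂ] E} {M : ℝ}

theorem hasDerivAt_expOp [CompleteSpace E] (h : IsHalfPlaneResolvent R M) {t : ℝ} (ht : 0 < t) :
    HasDerivAt (expOp R) (expOpDeriv R t) t := by
  have hM := h.nonneg
  have hd : ∀ y : ℝ, ∀ s ∈ Ioi (t / 2), HasDerivAt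
      (fun s => Complex.exp (vline y) • scaledResolvent R s y ^ 3)
      (Complex.exp (vline y) • ((3 / s : ℂ) •
        (vline y • scaledResolvent R s y ^ 4 - scaledResolvent R s y ^ 3))) s := by
    intro y s hs
    have hs0 : 0 < s := (half_pos ht).trans hs
    have h1 := hasDerivAt_cube (h.hasDerivAt_scaled_left hs0 y) (by
      refine Commute.smul_right (Commute.sub_right (Commute.smul_right ?_ _) (Commute.refl _)) _
      exact (Commute.refl _).mul_right (Commute.refl _))
    refine (h1.const_smul (Complex.exp (vline y))).congr_deriv ?_
    congr 1
    rw [← Nat.cast_smul_eq_nsmul ℂ, smul_mul_assoc, smul_smul, sub_mul, smul_mul_assoc, ← sq,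
      ← pow_add, ← pow_succ']
    norm_num [div_eq_mul_inv]
  -- On `s > t / 2` the factor `3 / s` is at most `3 / (t / 2)`, so one integrable majorant serves a
  -- whole neighbourhood of `t`.
  have key := hasDerivAt_integral_of_dominated_loc_of_deriv_le (μ := volume) (𝕜 := ℝ)
    (F := fun s y => Complex.exp (vline y) • scaledResolvent R s y ^ 3)
    (F' := fun s y => Complex.exp (vline y) • ((3 / s : ℂ) •
        (vline y • scaledResolvent R s y ^ 4 - scaledResolvent R s y ^ 3)))
    (x₀ := t) (s := Ioi (t / 2))
    (bound := fun y => Real.exp 1 * (3 / (t / 2) * (M ^ 4 + M ^ 3)) * (1 + y ^ 2)⁻¹)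
    (Ioi_mem_nhds (half_lt_self ht))
    (by
      filter_upwards [Ioi_mem_nhds (half_lt_self ht)] with s hs
      exact (h.integrable_scaled_pow ((half_pos ht).trans hs) (n := 3)
        (by norm_num)).aestronglyMeasurable)
    (h.integrable_scaled_pow ht (by norm_num)) (h.integrable_deriv ht).aestronglyMeasurable
    (by
      refine ae_of_all _ fun y s hs => ?_
      have hs0 : 0 < s := (half_pos ht).trans hs
      rw [norm_smul, norm_exp_vline, mul_assoc]
      gcongr
      refine (h.norm_deriv_integrand_le hs0 y).trans ?_
      have : t / 2 ≤ s := le_of_lt hs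
      gcongr)
    (integrable_inv_one_add_sq.const_mul _)
    (ae_of_all _ hd)
  exact key.2.const_smul laplaceConst

/-- Integration by parts along the contour: the `ζ`-derivative of `(ζ - tB)⁻³` is `-3 (ζ - tB)⁻⁴`,
and `e^ζ` is its own derivative. -/
theorem integral_three_smul_scaled_pow_four [CompleteSpace E] (h : IsHalfPlaneResolvent R M)
    {t : ℝ} (ht : 0 < t) :
    ∫ y : ℝ, Complex.exp (vline y) • scaledResolvent R t y ^ 3 =
      ∫ y : ℝ, (3 : ℂ) • Complex.exp (vline y) • scaledResolvent R t y ^ 4 := by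
  have hd : ∀ y : ℝ, HasDerivAt (fun y => Complex.exp (vline y) • scaledResolvent R t y ^ 3)
      (Complex.I • (Complex.exp (vline y) • scaledResolvent R t y ^ 3 -
        (3 : ℂ) • Complex.exp (vline y) • scaledResolvent R t y ^ 4)) y := by
    intro y
    have h1 := hasDerivAt_cube (h.hasDerivAt_scaled_right ht y)
      (Commute.smul_right ((Commute.refl _).mul_right (Commute.refl _)) _)
    have h2 : HasDerivAt (fun y => Complex.exp (vline y)) (Complex.exp (vline y) * Complex.I) y :=
      (hasDerivAt_vline y).cexp
    refine (h2.smul h1).congr_deriv ?_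
    rw [← Nat.cast_smul_eq_nsmul ℂ, smul_mul_assoc, ← sq, ← pow_add]
    module
  have hi3 := h.integrable_scaled_pow ht (n := 3) (by norm_num)
  have hi4 : Integrable fun y => (3 : ℂ) • Complex.exp (vline y) • scaledResolvent R t y ^ 4 :=
    (h.integrable_scaled_pow ht (n := 4) (by norm_num)).smul (3 : ℂ)
  have h0 := integral_eq_zero_of_hasDerivAt_of_integrable hd
    ((hi3.sub hi4).smul Complex.I) hi3
  rw [integral_smul, smul_eq_zero_iff_right Complex.I_ne_zero, integral_sub hi3 hi4,
    sub_eq_zero] at h0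
  exact h0

theorem commute_expOp [CompleteSpace E] (h : IsHalfPlaneResolvent R M) {t : ℝ} (ht : 0 < t) {z : ℂ}
    (hz : 0 < z.re) : R z * expOp R t = expOp R t * R z := by
  have hi := h.integrable_scaled_pow ht (n := 3) (by norm_num)
  rw [expOp, mul_smul_comm, smul_mul_assoc, ← integral_const_mul_of_integrable hi,
    ← integral_mul_const_of_integrable hi]
  congr 2
  funext y
  rw [mul_smul_comm, smul_mul_assoc, ((h.commute_scaled ht y hz).pow_right 3).eq]

/-- This is `B exp(tB)` written without the unbounded `B`. With `r = (ζ - tB)⁻¹` one has `ζ r - 1 =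
t B r`, so the derivative integrand is `3 e^ζ B r⁴`; integration by parts turns the factor `3 r⁴`
back into `r³`. -/
theorem mul_expOpDeriv [CompleteSpace E] (h : IsHalfPlaneResolvent R M) {t : ℝ} (ht : 0 < t)
    {z : ℂ} (hz : 0 < z.re) : R z * expOpDeriv R t = expOp R t * (z • R z - 1) := by
  have ht0 : (t : ℂ) ≠ 0 := by exact_mod_cast ht.ne'
  have hi := h.integrable_deriv ht
  have hi4 : Integrable fun y => (3 : ℂ) • Complex.exp (vline y) • scaledResolvent R t y ^ 4 :=
    (h.integrable_scaled_pow ht (n := 4) (by norm_num)).smul (3 : ℂ)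
  -- The relation `ζ r - 1 = t B r`, premultiplied by `R z` and using `R z B = z R z - 1`.
  have hpt : ∀ y : ℝ, R z * (vline y • scaledResolvent R t y - 1) =
      (t : ℂ) • (scaledResolvent R t y * (z • R z - 1)) := by
    intro y
    have h1 := h.identity z (vline y / t) hz (div_re_pos ht y)
    have h2 := h.commute hz (div_re_pos ht y)
    simp only [scaledResolvent, mul_sub, mul_one, smul_mul_assoc, mul_smul_comm, smul_smul,
      smul_sub]
    have e1 : (t : ℂ) * (z * (t : ℂ)⁻¹) = z := by field_simp
    rw [mul_inv_cancel₀ ht0, one_smul, ← h2, e1, ← div_eq_mul_inv]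
    rw [sub_smul, sub_eq_sub_iff_add_eq_add] at h1
    rw [sub_eq_sub_iff_add_eq_add, ← h1, add_comm]
  rw [expOpDeriv, expOp, mul_smul_comm, smul_mul_assoc, ← integral_const_mul_of_integrable hi,
    h.integral_three_smul_scaled_pow_four ht, ← integral_mul_const_of_integrable hi4]
  congr 2
  funext y
  have hc := h.commute_scaled ht y hz
  have e : vline y • scaledResolvent R t y ^ 4 - scaledResolvent R t y ^ 3 =
      scaledResolvent R t y ^ 3 * (vline y • scaledResolvent R t y - 1) := by
    rw [mul_sub, mul_one, mul_smul_comm, ← pow_succ]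
  have e2 : R z * (vline y • scaledResolvent R t y ^ 4 - scaledResolvent R t y ^ 3) =
      (t : ℂ) • (scaledResolvent R t y ^ 4 * (z • R z - 1)) := by
    rw [e, ← mul_assoc, (hc.pow_right 3).eq, mul_assoc, hpt, mul_smul_comm, ← mul_assoc,
      ← pow_succ]
  simp only [mul_smul_comm, smul_mul_assoc]
  rw [e2]
  simp only [smul_smul]
  congr 1
  field_simp

/-- As `t → 0` the operators `ζ (ζ - tB)⁻¹` tend strongly to the identity with uniform bound `M`,
hence so do their cubes. Dominated convergence leaves the scalar integral that `laplaceConst`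
normalizes. -/
theorem tendsto_expOp [CompleteSpace E] (h : IsHalfPlaneResolvent R M) (x : E) :
    Tendsto (fun t => expOp R t x) (𝓝[>] 0) (𝓝 x) := by
  have hM := h.nonneg
  have hx : x = laplaceConst • ∫ y : ℝ, Complex.exp (vline y) • (vline y ^ 3)⁻¹ • x := by
    simp_rw [smul_smul]
    rw [integral_smul_const, smul_smul, laplaceConst,
      inv_mul_cancel₀ integral_exp_div_vline_cube_ne_zero, one_smul]
  have heq : ∀ t : ℝ, 0 < t → expOp R t x =
      laplaceConst • ∫ y : ℝ, Complex.exp (vline y) • (scaledResolvent R t y ^ 3) x := by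
    intro t ht
    rw [expOp, _root_.smul_apply, ContinuousLinearMap.integral_apply
      (h.integrable_scaled_pow ht (n := 3) (by norm_num))]
    rfl
  nth_rewrite 2 [hx]
  have hlim : Tendsto (fun t => laplaceConst • ∫ y : ℝ, Complex.exp (vline y) •
      (scaledResolvent R t y ^ 3) x) (𝓝[>] 0)
      (𝓝 (laplaceConst • ∫ y : ℝ, Complex.exp (vline y) • (vline y ^ 3)⁻¹ • x)) := by
    refine Tendsto.const_smul ?_ _
    refine tendsto_integral_filter_of_dominated_convergence
      (fun y => Real.exp 1 * (M ^ 3 * ‖x‖) * (1 + y ^ 2)⁻¹) ?_ ?_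
      (integrable_inv_one_add_sq.const_mul _) ?_
    · filter_upwards [self_mem_nhdsWithin] with t ht
      refine Continuous.aestronglyMeasurable ?_
      have h1 := h.continuous_scaled (mem_Ioi.1 ht)
      have h2 := Complex.continuous_exp.comp continuous_vline
      exact h2.smul ((h1.pow 3).clm_apply continuous_const)
    · filter_upwards [self_mem_nhdsWithin] with t ht
      refine ae_of_all _ fun y => ?_
      rw [norm_smul, norm_exp_vline, mul_assoc]
      gcongr
      refine (ContinuousLinearMap.le_of_opNorm_le _
        (h.norm_scaled_pow_le' (mem_Ioi.1 ht) y (n := 3) (by norm_num)) x).trans (le_of_eq ?_)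
      ring
    · refine ae_of_all _ fun y => Tendsto.const_smul ?_ _
      have hv := vline_ne_zero y
      set a : ℝ → E →L[ℂ] E := fun t => vline y • scaledResolvent R t y with ha
      have hre : ∀ᶠ t : ℝ in 𝓝[>] 0, 0 < (vline y / (t : ℂ)).re := by
        filter_upwards [self_mem_nhdsWithin] with t ht using div_re_pos ht y
      have hnorm : Tendsto (fun t : ℝ => ‖vline y / (t : ℂ)‖) (𝓝[>] 0) atTop := by
        have : Tendsto (fun t : ℝ => ‖vline y‖ * t⁻¹) (𝓝[>] 0) atTop :=
          tendsto_inv_nhdsGT_zero.const_mul_atTop (norm_pos_iff.2 hv)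
        refine this.congr' ?_
        filter_upwards [self_mem_nhdsWithin] with t ht
        rw [norm_div, Complex.norm_real, Real.norm_of_nonneg (le_of_lt ht), div_eq_mul_inv]
      have hstep : ∀ v : E, Tendsto (fun t => a t v) (𝓝[>] 0) (𝓝 v) := by
        intro v
        refine (h.tendsto_smul hre hnorm v).congr fun t => ?_
        simp only [ha, scaledResolvent, _root_.smul_apply, smul_smul, div_eq_mul_inv]
      have hbd : ∀ᶠ t : ℝ in 𝓝[>] 0, ‖a t‖ ≤ M := by
        filter_upwards [self_mem_nhdsWithin] with t ht
        have hv' := norm_pos_iff.2 hv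
        rw [ha, norm_smul]
        calc _ ≤ ‖vline y‖ * (M / ‖vline y‖) := by
              gcongr
              exact h.norm_scaled_le ht y
          _ = M := by field_simp
      have hcomp : ∀ f : ℝ → E, ∀ v, Tendsto f (𝓝[>] 0) (𝓝 v) →
          Tendsto (fun t => a t (f t)) (𝓝[>] 0) (𝓝 v) := by
        intro f v hf
        have h0 : Tendsto (fun t => a t (f t - v)) (𝓝[>] 0) (𝓝 0) := by
          rw [tendsto_zero_iff_norm_tendsto_zero]
          have h1 : Tendsto (fun t => M * ‖f t - v‖) (𝓝[>] 0) (𝓝 0) := by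
            simpa using (tendsto_iff_norm_sub_tendsto_zero.1 hf).const_mul M
          refine squeeze_zero' (Eventually.of_forall fun _ => norm_nonneg _) ?_ h1
          filter_upwards [hbd] with t ht using (a t).le_of_opNorm_le ht _
        have := h0.add (hstep v)
        rw [zero_add] at this
        exact this.congr fun t => by rw [map_sub, sub_add_cancel]
      have h3 := (hcomp _ _ (hcomp _ _ (hstep x))).const_smul ((vline y ^ 3)⁻¹)
      refine h3.congr fun t => ?_
      simp only [ha, _root_.smul_apply, map_smul, smul_smul]
      refine Eq.trans ?_ (one_smul ℂ _)
      congr 1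
      field_simp
  refine hlim.congr' ?_
  filter_upwards [self_mem_nhdsWithin] with t ht using (heq t ht).symm

end IsHalfPlaneResolvent

end HalfPlane

/-! ### The semigroup law -/

section HalfPlane

variable {E : Type*} [NormedAddCommGroup E] [NormedSpace ℂ E]

namespace IsHalfPlaneResolvent

variable {R : ℂ → E →L[ℂ] E} {M : ℝ}

/-- Identities involving the unbounded generator are checked after multiplication by the injective
`R z`. -/
theorem mul_left_cancel (h : IsHalfPlaneResolvent R M) {z : ℂ} (hz : 0 < z.re) {X Y : E →L[ℂ] E}
    (hXY : R z * X = R z * Y) : X = Y := by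
  ext x
  have h1 := congrArg (fun L : E →L[ℂ] E => L x) hXY
  rw [← sub_eq_zero]
  refine h.injective hz ?_
  rw [map_sub, sub_eq_zero]
  exact h1

variable [CompleteSpace E]

theorem commute_expOpDeriv (h : IsHalfPlaneResolvent R M) {t : ℝ} (ht : 0 < t)
    {z : ℂ} (hz : 0 < z.re) : R z * expOpDeriv R t = expOpDeriv R t * R z := by
  refine h.mul_left_cancel hz ?_
  rw [h.mul_expOpDeriv ht hz, ← mul_assoc, ← mul_assoc, h.mul_expOpDeriv ht hz,
    h.commute_expOp ht hz, mul_assoc, mul_assoc]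
  congr 1
  simp [mul_sub, sub_mul]

theorem expOp_mul_comm (h : IsHalfPlaneResolvent R M) {s t : ℝ} (hs : 0 < s) (ht : 0 < t) :
    expOpDeriv R t * expOp R s = expOp R t * expOpDeriv R s := by
  have hz : 0 < (1 : ℂ).re := by simp
  refine h.mul_left_cancel hz ?_
  rw [← mul_assoc, h.mul_expOpDeriv ht hz, ← mul_assoc, h.commute_expOp ht hz, mul_assoc,
    mul_assoc, h.mul_expOpDeriv hs hz]
  congr 1
  rw [mul_sub, sub_mul, mul_one, one_mul, one_smul, h.commute_expOp hs hz]

/-- The function `r ↦ exp((u - r)B) exp(rB)` has zero derivative on `(0, u)`. Its constant value is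
found at `r = t` and compared with its strong limit as `r → 0`. -/
theorem expOp_add (h : IsHalfPlaneResolvent R M) {s t : ℝ} (hs : 0 < s) (ht : 0 < t) :
    expOp R (s + t) = expOp R s * expOp R t := by
  set u := s + t with hu
  have hd : ∀ r ∈ Ioo 0 u, HasDerivAt (fun r => expOp R (u - r) * expOp R r) 0 r := by
    intro r hr
    have h1 : HasDerivAt (fun r => expOp R (u - r)) (-expOpDeriv R (u - r)) r := by
      have := (h.hasDerivAt_expOp (sub_pos.2 hr.2)).scomp r ((hasDerivAt_id r).const_sub u)
      simpa using! this
    refine (h1.fun_mul (h.hasDerivAt_expOp hr.1)).congr_deriv ?_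
    rw [neg_mul, h.expOp_mul_comm hr.1 (sub_pos.2 hr.2), neg_add_cancel]
  have hconst : ∀ r ∈ Ioo 0 u, expOp R (u - r) * expOp R r = expOp R s * expOp R t := by
    intro r hr
    have := isOpen_Ioo.is_const_of_deriv_eq_zero isPreconnected_Ioo
      (fun r hr => (hd r hr).differentiableAt.differentiableWithinAt)
      (fun r hr => (hd r hr).deriv) hr (show t ∈ Ioo 0 u from ⟨ht, by linarith⟩)
    simpa [hu] using this
  ext x
  have h1 : Tendsto (fun r => expOp R (u - r)) (𝓝[>] 0) (𝓝 (expOp R u)) := by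
    have hc : ContinuousAt (fun r => expOp R (u - r)) 0 := by
      refine ContinuousAt.comp (f := fun r : ℝ => u - r) (g := expOp R) ?_ (by fun_prop)
      rw [sub_zero]
      exact (h.hasDerivAt_expOp (by linarith)).continuousAt
    have := hc.tendsto
    rw [sub_zero] at this
    exact this.mono_left nhdsWithin_le_nhds
  have h2 : Tendsto (fun r => expOp R (u - r) (expOp R r x)) (𝓝[>] 0) (𝓝 (expOp R u x)) :=
    (isBoundedBilinearMap_apply.continuous.tendsto (expOp R u, x)).comp
      (h1.prodMk_nhds (h.tendsto_expOp x))
  refine tendsto_nhds_unique h2 (tendsto_const_nhds.congr' ?_)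
  filter_upwards [Ioo_mem_nhdsGT (show (0 : ℝ) < u by linarith)] with r hr
  rw [← hconst r hr]
  rfl

end IsHalfPlaneResolvent

end HalfPlane

/-! ### Analytic semigroups and the calculus of resolvents -/

section Generation

variable {E : Type*} [NormedAddCommGroup E] [NormedSpace ℂ E]

/-- `T` is a strongly continuous semigroup, differentiable in operator norm on `(0, ∞)` with
derivative `D`, and `‖T t‖ ≤ C`, `‖D t‖ ≤ C / t` on bounded intervals. -/
structure IsAnalyticSemigroup (T D : ℝ → E →L[ℂ] E) : Prop where
  zero : T 0 = 1
  add : ∀ s t : ℝ, 0 ≤ s → 0 ≤ t → T (s + t) = T s * T t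
  continuousOn : ∀ x : E, ContinuousOn (fun t => T t x) (Ici 0)
  hasDerivAt : ∀ t : ℝ, 0 < t → HasDerivAt T (D t) t
  bound : ∀ N : ℝ, ∃ C : ℝ, 0 ≤ C ∧ ∀ t ∈ Ioc 0 N, ‖T t‖ ≤ C ∧ ‖D t‖ ≤ C / t

namespace IsResolvent

variable {B : E →ₗ.[ℂ] E} {z z' : ℂ} {R R' : E →L[ℂ] E}

theorem mem (h : IsResolvent B z R) (x : E) : R x ∈ B.domain := (h.1 x).1

theorem apply_eq (h : IsResolvent B z R) (x : E) : B ⟨R x, h.mem x⟩ = z • R x - x := by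
  obtain ⟨_, h2⟩ := h.1 x
  rw [eq_sub_iff_add_eq', ← eq_sub_iff_add_eq, h2]

/-- Both sides say `(z - B) x = z x - y`. This replaces relations for the unbounded `B` by equations
between bounded operators. -/
theorem eq_iff (h : IsResolvent B z R) (x y : E) :
    (∃ hx : x ∈ B.domain, B ⟨x, hx⟩ = y) ↔ R (z • x - y) = x := by
  constructor
  · rintro ⟨hx, rfl⟩
    exact h.2 ⟨x, hx⟩
  · intro hx
    have hm : x ∈ B.domain := hx ▸ h.mem _
    refine ⟨hm, ?_⟩
    have h1 := h.apply_eq (z • x - y)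
    have h2 : (⟨R (z • x - y), h.mem _⟩ : B.domain) = ⟨x, hm⟩ := Subtype.ext hx
    rw [h2, hx] at h1
    rw [h1]
    abel

theorem identity (h : IsResolvent B z R) (h' : IsResolvent B z' R') :
    R - R' = (z' - z) • (R * R') := by
  ext x
  have h1 : R (z • R' x - (z' • R' x - x)) = R' x :=
    (h.eq_iff _ _).1 ⟨h'.mem x, h'.apply_eq x⟩
  have h2 : z • R' x - (z' • R' x - x) = x - (z' - z) • R' x := by module
  rw [h2, map_sub, map_smul] at h1
  change R x - R' x = (z' - z) • R (R' x)
  rw [sub_eq_iff_eq_add', add_comm, ← sub_eq_iff_eq_add']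
  rw [sub_eq_iff_eq_add] at h1
  rw [h1]
  abel

theorem unique (h : IsResolvent B z R) (h' : IsResolvent B z R') : R = R' := by
  have := h.identity h'
  rwa [sub_self, zero_smul, sub_eq_zero] at this

end IsResolvent

theorem isResolvent_resolvent {B : E →ₗ.[ℂ] E} {z : ℂ} (hz : z ∈ resolventSet B) :
    IsResolvent B z (resolvent B z) := by
  have hz' : ∃ R : E →L[ℂ] E, IsResolvent B z R := hz
  rw [resolvent, dif_pos hz']
  exact hz'.choose_spec

/-- The factor `e^{tw}` undoes a shift of the generator by `w`. The value at `t = 0`, where the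
contour integral is not meaningful, is set to `1`. -/
theorem IsHalfPlaneResolvent.isAnalyticSemigroup [CompleteSpace E] {R : ℂ → E →L[ℂ] E} {M : ℝ}
    (h : IsHalfPlaneResolvent R M) (w : ℝ) :
    IsAnalyticSemigroup
      (fun t => if 0 < t then Complex.exp (t * w) • expOp R t else 1)
      (fun t => Complex.exp (t * w) • (expOpDeriv R t + (w : ℂ) • expOp R t)) where
  zero := by simp
  add s t hs ht := by
    rcases hs.eq_or_lt with rfl | hs
    · simp
    rcases ht.eq_or_lt with rfl | ht
    · simp
    simp only [if_pos hs, if_pos ht, if_pos (add_pos hs ht)]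
    rw [h.expOp_add hs ht, smul_mul_smul_comm, ← Complex.exp_add]
    push_cast
    ring_nf
  continuousOn x t ht := by
    rcases (mem_Ici.1 ht).eq_or_lt with rfl | ht
    · rw [← continuousWithinAt_Ioi_iff_Ici]
      have h1 : Tendsto (fun t : ℝ => Complex.exp (t * w)) (𝓝[>] 0) (𝓝 1) := by
        have : Continuous fun t : ℝ => Complex.exp (t * w) := by fun_prop
        have := this.tendsto 0
        simp only [Complex.ofReal_zero, zero_mul, Complex.exp_zero] at this
        exact this.mono_left nhdsWithin_le_nhds
      have h2 := h1.smul (h.tendsto_expOp x)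
      rw [one_smul] at h2
      simp only [ContinuousWithinAt, lt_self_iff_false, if_false]
      refine h2.congr' ?_
      filter_upwards [self_mem_nhdsWithin] with t ht
      rw [if_pos (mem_Ioi.1 ht)]
      rfl
    · refine ContinuousAt.continuousWithinAt ?_
      have h1 : ContinuousAt (fun t : ℝ => Complex.exp (t * w) • expOp R t x) t :=
        (by fun_prop : Continuous fun t : ℝ => Complex.exp (t * w)).continuousAt.smul
          ((h.hasDerivAt_expOp ht).continuousAt.clm_apply continuousAt_const)
      refine h1.congr ?_
      filter_upwards [Ioi_mem_nhds ht] with t ht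
      rw [if_pos (mem_Ioi.1 ht)]
      rfl
  hasDerivAt t ht := by
    have h1 : HasDerivAt (fun t : ℝ => Complex.exp (t * w)) (Complex.exp (t * w) * w) t := by
      have := ((Complex.ofRealCLM.hasDerivAt (x := t)).mul_const (w : ℂ)).cexp
      simpa using! this
    have h2 := h1.smul (h.hasDerivAt_expOp ht)
    refine (h2.congr_of_eventuallyEq ?_).congr_deriv ?_
    · filter_upwards [Ioi_mem_nhds ht] with t ht
      rw [if_pos (mem_Ioi.1 ht)]
      rfl
    · module
  bound N := by
    obtain ⟨C, hC, hT, hD⟩ := h.exists_bound_expOp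
    refine ⟨Real.exp (N * |w|) * (C + |w| * C * |N|) + Real.exp (N * |w|) * C, by positivity, ?_⟩
    intro t ht
    have he : ‖Complex.exp (t * w)‖ ≤ Real.exp (N * |w|) := by
      rw [Complex.norm_exp]
      gcongr
      simp only [Complex.mul_re, Complex.ofReal_re, Complex.ofReal_im, mul_zero, sub_zero]
      have := ht.1
      exact (mul_le_mul_of_nonneg_left (le_abs_self w) ht.1.le).trans
        (mul_le_mul_of_nonneg_right ht.2 (abs_nonneg w))
    constructor
    · rw [if_pos ht.1, norm_smul]
      have : 0 ≤ Real.exp (N * |w|) * (C + |w| * C * |N|) := by positivity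
      calc _ ≤ Real.exp (N * |w|) * C := by
            gcongr
            exact hT t ht.1
        _ ≤ _ := by linarith
    · rw [norm_smul, add_div]
      have ht0 := ht.1
      have h3 : 0 ≤ Real.exp (N * |w|) * C / t := by positivity
      have h4 : ‖expOpDeriv R t + (w : ℂ) • expOp R t‖ ≤ (C + |w| * C * |N|) / t := by
        refine (norm_add_le _ _).trans ?_
        rw [add_div]
        gcongr
        · exact hD t ht0
        · rw [norm_smul, Complex.norm_real, Real.norm_eq_abs, le_div_iff₀ ht0]
          have : t ≤ |N| := ht.2.trans (le_abs_self N)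
          gcongr
          exact hT t ht0
      calc _ ≤ Real.exp (N * |w|) * ((C + |w| * C * |N|) / t) := by gcongr
        _ = Real.exp (N * |w|) * (C + |w| * C * |N|) / t := by ring
        _ ≤ _ := by linarith

end Generation

/-! ### Sectorial operators with dense domain are generators -/

section Generation

variable {E : Type*} [NormedAddCommGroup E] [NormedSpace ℂ E]

/-- The derivative `D` of the analytic semigroup `T` is `B T`, expressed through the resolvent
`R = (z - B)⁻¹`. -/
structure IsGeneratedThrough (T D : ℝ → E →L[ℂ] E) (z : ℂ) (R : E →L[ℂ] E) : Prop where
  commute : ∀ t : ℝ, 0 < t → R * T t = T t * R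
  deriv : ∀ t : ℝ, 0 < t → R * D t = T t * (z • R - 1)
  deriv' : ∀ t : ℝ, 0 < t → D t * R = T t * (z • R - 1)

/-- For `t > 0` the derivative of the orbit is `T t (z R u - u)`, which has a limit at `0`; a
continuous function whose derivative has a limit is one-sidedly differentiable at the endpoint. -/
theorem IsAnalyticSemigroup.hasDerivWithinAt_resolvent {T D : ℝ → E →L[ℂ] E} {z : ℂ}
    {R : E →L[ℂ] E} (hT : IsAnalyticSemigroup T D) (hR : IsGeneratedThrough T D z R) (u : E) :
    HasDerivWithinAt (fun t => T t (R u)) (z • R u - u) (Ici 0) 0 := by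
  have hd : ∀ t : ℝ, 0 < t → HasDerivAt (fun t => T t (R u)) (T t (z • R u - u)) t := by
    intro t ht
    have h1 := ((ContinuousLinearMap.apply ℂ E (R u)).restrictScalars ℝ).hasFDerivAt.comp_hasDerivAt
      t (hT.hasDerivAt t ht)
    have h2 := congrArg (fun L : E →L[ℂ] E => L u) (hR.deriv' t ht)
    exact h1.congr_deriv h2
  refine hasDerivWithinAt_Ici_of_tendsto_deriv (s := Ioi 0)
    (fun t ht => (hd t ht).differentiableAt.differentiableWithinAt)
    ((hT.continuousOn (R u) 0 (mem_Ici.2 le_rfl)).mono Ioi_subset_Ici_self) self_mem_nhdsWithin ?_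
  have h1 := (hT.continuousOn (z • R u - u) 0 (mem_Ici.2 le_rfl)).mono Ioi_subset_Ici_self
  rw [ContinuousWithinAt, hT.zero] at h1
  refine Tendsto.congr' ?_ h1
  filter_upwards [self_mem_nhdsWithin] with t ht using (hd t ht).deriv.symm

theorem IsAnalyticSemigroup.isC0SemigroupGeneratedBy {T D : ℝ → E →L[ℂ] E}
    (hT : IsAnalyticSemigroup T D) {B : E →ₗ.[ℂ] E} {z : ℂ} {R : E →L[ℂ] E}
    (hB : IsResolvent B z R) (hR : IsGeneratedThrough T D z R) :
    IsC0SemigroupGeneratedBy T B where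
  zero := hT.zero
  add := hT.add
  continuousOn := hT.continuousOn
  generator x y := by
    have hlim : ∀ u, Tendsto (fun h : ℝ => h⁻¹ • (T h (R u) - R u)) (𝓝[>] 0)
        (𝓝 (z • R u - u)) := by
      intro u
      have h1 := hasDerivWithinAt_iff_tendsto_slope.1 (hT.hasDerivWithinAt_resolvent hR u)
      rw [Ici_sdiff_left] at h1
      refine h1.congr fun h => ?_
      rw [slope_def_module, sub_zero, hT.zero]
      rfl
    rw [hB.eq_iff]
    constructor
    · intro hx
      have h1 := hlim (z • x - y)
      rw [hx, sub_sub_cancel] at h1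
      exact h1
    · intro hy
      -- Applying `R` to the difference quotients moves them to the orbit of `R x`, whose derivative
      -- at `0` is known. Comparing limits gives `R y = z R x - x`, the resolvent form of `B x = y`.
      have h1 := (R.continuous.tendsto y).comp hy
      have h2 := tendsto_nhds_unique (h1.congr' (by
        filter_upwards [self_mem_nhdsWithin] with h hh
        have := congrArg (fun L : E →L[ℂ] E => L x) (hR.commute h hh)
        change R (T h x) = T h (R x) at this
        rw [Function.comp_apply, R.map_smul_of_tower h⁻¹ (T h x - x), map_sub, this])) (hlim x)
      rw [map_sub, map_smul, h2]
      abel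

/-- A sectorial operator with dense domain generates an analytic semigroup. -/
theorem IsSectorial.exists_analyticSemigroup [CompleteSpace E] {B : E →ₗ.[ℂ] E}
    (hB : IsSectorial B) (hdense : Dense (B.domain : Set E)) :
    ∃ (T D : ℝ → E →L[ℂ] E) (w : ℝ), IsAnalyticSemigroup T D ∧ IsC0SemigroupGeneratedBy T B ∧
      (∀ z : ℂ, w < z.re → ∀ R, IsResolvent B z R → IsGeneratedThrough T D z R) ∧
      ∀ x, Tendsto (fun r : ℝ => (r : ℂ) • resolvent B r x) atTop (𝓝 x) := by
  obtain ⟨w, θ, M, hθ, -, hM, hB⟩ := hB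
  -- Because `θ > π/2`, the sector contains the half-plane `Re z > w`; shifting by `w` gives a
  -- family on `Re z > 0`.
  have hρ : ∀ z : ℂ, 0 < z.re → z + w ∈ resolventSet B ∧ ‖resolvent B (z + w)‖ ≤ M / ‖z‖ := by
    intro z hz
    have h1 := hB (z + w) (by
      intro h
      rw [add_eq_right] at h
      rw [h] at hz
      simp at hz) (by
      rw [add_sub_cancel_right]
      exact (Complex.abs_arg_lt_pi_div_two_iff.2 (Or.inl hz)).le.trans hθ.le)
    rwa [add_sub_cancel_right] at h1
  have hR : ∀ z : ℂ, 0 < z.re → IsResolvent B (z + w) (resolvent B (z + w)) := fun z hz =>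
    isResolvent_resolvent (hρ z hz).1
  have h : IsHalfPlaneResolvent (fun z => resolvent B (z + w)) M := by
    refine ⟨fun z z' hz hz' => ?_, fun z hz => (hρ z hz).2, ?_⟩
    · have := (hR z hz).identity (hR z' hz')
      rwa [add_sub_add_right_eq_sub] at this
    · refine hdense.mono ?_
      intro x hx
      exact ⟨_, (hR 1 (by simp)).2 ⟨x, hx⟩⟩
  have hT := h.isAnalyticSemigroup w
  have hgen : ∀ z : ℂ, w < z.re → ∀ R, IsResolvent B z R → IsGeneratedThrough
      (fun t : ℝ => if 0 < t then Complex.exp (t * w) • expOp (fun z => resolvent B (z + w)) t else 1)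
      (fun t : ℝ => Complex.exp (t * w) • (expOpDeriv (fun z => resolvent B (z + w)) t +
        (w : ℂ) • expOp (fun z => resolvent B (z + w)) t)) z R := by
    intro z hz R hzR
    have hz' : 0 < (z - w).re := by simpa using hz
    have hRz : R = (fun z => resolvent B (z + w)) (z - w) := by
      have := hR (z - w) hz'
      rw [sub_add_cancel] at this
      simp only [sub_add_cancel]
      exact hzR.unique this
    have hder : ∀ t : ℝ, 0 < t → R * (Complex.exp (t * w) •
        (expOpDeriv (fun z => resolvent B (z + w)) t +
        (w : ℂ) • expOp (fun z => resolvent B (z + w)) t)) =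
        (Complex.exp (t * w) • expOp (fun z => resolvent B (z + w)) t) * (z • R - 1) := by
      intro t ht
      rw [mul_smul_comm, smul_mul_assoc, mul_add, mul_smul_comm, hRz, h.mul_expOpDeriv ht hz',
        h.commute_expOp ht hz']
      simp only [mul_sub, mul_smul_comm, mul_one]
      module
    refine ⟨fun t ht => ?_, fun t ht => ?_, fun t ht => ?_⟩
    · simp only [if_pos ht]
      rw [hRz, mul_smul_comm, h.commute_expOp ht hz', smul_mul_assoc]
    · simp only [if_pos ht]
      exact hder t ht
    · simp only [if_pos ht]
      rw [← hder t ht, hRz, mul_smul_comm, smul_mul_assoc, mul_add, add_mul, mul_smul_comm,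
        smul_mul_assoc, h.commute_expOp ht hz', h.commute_expOpDeriv ht hz']
  refine ⟨_, _, w, hT, hT.isC0SemigroupGeneratedBy (hR 1 (by simp)) (hgen _ (by simp) _
    (hR 1 (by simp))), hgen, fun x => ?_⟩
  have hsub : Tendsto (fun r : ℝ => r - w) atTop atTop := tendsto_atTop_add_const_right _ _ tendsto_id
  have h1 := h.tendsto_smul (l := atTop) (f := fun r : ℝ => ((r - w : ℝ) : ℂ))
    (by filter_upwards [eventually_gt_atTop w] with r hr; simpa using hr)
    (by
      simp only [Complex.norm_real, Real.norm_eq_abs]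
      exact tendsto_abs_atTop_atTop.comp hsub) x
  -- The factor `1 + w / (r - w) = r / (r - w)` passes from `(r - w) R(r)` to `r R(r)`.
  have h2 : Tendsto (fun r : ℝ => (((1 + w * (r - w)⁻¹ : ℝ)) : ℂ)) atTop (𝓝 1) := by
    have h3 := ((tendsto_inv_atTop_zero.comp hsub).const_mul w).const_add 1
    rw [mul_zero, add_zero] at h3
    exact_mod_cast (Complex.continuous_ofReal.tendsto 1).comp h3
  have h4 := h2.smul h1
  rw [one_smul] at h4
  refine h4.congr' ?_
  filter_upwards [eventually_gt_atTop w] with r hr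
  have h5 : ((r : ℂ) - w) ≠ 0 := by
    rw [← Complex.ofReal_sub]
    exact_mod_cast (sub_pos.2 hr).ne'
  rw [smul_smul]
  push_cast
  rw [sub_add_cancel]
  congr 1
  field_simp
  ring

end Generation

/-! ### The part of `A` in the closure of its domain -/

section Part

variable {H : Type*} [NormedAddCommGroup H] [NormedSpace ℂ H] {A : H →ₗ.[ℂ] H}

/-- For `x` in `H₀` the vector `A R(z) x = z R(z) x - x` lies in `H₀` again, so `R(z) x` belongs to
the domain of the part. -/
theorem IsResolvent.part {z : ℂ} (hz : z ∈ resolventSet A) :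
    IsResolvent (part A) z ((resolventInto A z).comp (domClosure A).subtypeL) := by
  have h := isResolvent_resolvent hz
  have key : ∀ x : domClosure A,
      A ⟨resolvent A z x, h.mem x⟩ = z • resolvent A z x - x := fun x => h.apply_eq _
  refine ⟨fun x => ⟨⟨h.mem x, ?_⟩, ?_⟩, fun y => ?_⟩
  · have h1 : A ⟨resolvent A z x, h.mem x⟩ ∈ domClosure A := by
      rw [key]
      exact (domClosure A).sub_mem ((domClosure A).smul_mem z (resolvent_mem_domClosure A z x)) x.2
    exact h1
  · apply Subtype.ext
    change z • resolvent A z x - A ⟨resolvent A z x, _⟩ = (x : H)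
    rw [key]
    abel
  · apply Subtype.ext
    exact h.2 ⟨((y : domClosure A) : H), y.2.choose⟩

/-- For `y ∈ D(A)` one has `l R(l) y - y = R(l) A y → 0`, and `l R(l) y` lies in the domain of the
part. Vectors of `D(A)` are themselves dense in `H₀`. -/
theorem dense_domain_part {ωA : ℝ} (hρ : ∀ l : ℝ, ωA < l → (l : ℂ) ∈ resolventSet A)
    (hlim : Tendsto (fun l : ℝ => ‖resolvent A (l : ℂ)‖) atTop (𝓝 0)) :
    Dense ((part A).domain : Set (domClosure A)) := by
  rw [Metric.dense_iff]
  intro x ε hε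
  obtain ⟨y, hy, hxy⟩ := Metric.mem_closure_iff.1 x.2 (ε / 2) (by positivity)
  have hlim2 : Tendsto (fun l : ℝ => ‖resolvent A (l : ℂ)‖ * ‖A ⟨y, hy⟩‖) atTop (𝓝 0) := by
    simpa using hlim.mul_const ‖A ⟨y, hy⟩‖
  obtain ⟨l, hl, hl'⟩ := ((hlim2.eventually (gt_mem_nhds (half_pos hε))).and
    (eventually_gt_atTop ωA)).exists
  have hres := isResolvent_resolvent (hρ l hl')
  have hy' : y ∈ domClosure A := A.domain.le_topologicalClosure hy
  refine ⟨(l : ℂ) • (resolventInto A l) y, ?_, ?_⟩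
  · rw [Metric.mem_ball, Subtype.dist_eq]
    refine (dist_triangle_right _ _ y).trans_lt ?_
    have h1 : (l : ℂ) • resolvent A l y - y = resolvent A l (A ⟨y, hy⟩) := by
      have := hres.2 ⟨y, hy⟩
      rw [map_sub, map_smul, sub_eq_iff_eq_add] at this
      exact sub_eq_iff_eq_add'.2 this
    have h2 : dist ((((l : ℂ) • (resolventInto A l) y : domClosure A)) : H) y < ε / 2 := by
      change dist ((l : ℂ) • resolvent A l y) y < ε / 2
      rw [dist_eq_norm, h1]
      exact ((resolvent A l).le_opNorm _).trans_lt hl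
    linarith
  · exact (part A).domain.smul_mem _ ((IsResolvent.part (hρ l hl')).mem ⟨y, hy'⟩)

end Part

/-! ### Singular kernels: convolution, weighted norms and Gronwall -/

section Volterra

variable {H E : Type*} [NormedAddCommGroup H] [NormedSpace ℝ H] [NormedAddCommGroup E]
  [NormedSpace ℝ E]

/-- An operator kernel on `(0, ∞)` with a singularity of order at most `t ^ (a - 1)` at `0`. -/
structure IsSingularKernel (U : ℝ → H →L[ℝ] E) (a : ℝ) : Prop where
  pos : 0 < a
  continuousOn : ContinuousOn U (Ioi 0)
  bound : ∀ N : ℝ, ∃ C : ℝ, 0 ≤ C ∧ ∀ t ∈ Ioc 0 N, ‖U t‖ ≤ C * t ^ (a - 1)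

/-- The Volterra convolution `∫₀ᵗ U (t - s) f(s) ds`. -/
noncomputable def kconv (U : ℝ → H →L[ℝ] E) (f : ℝ → H) (t : ℝ) : E :=
  ∫ s in (0 : ℝ)..t, U (t - s) (f s)

theorem kconv_eq (U : ℝ → H →L[ℝ] E) (f : ℝ → H) (t : ℝ) :
    kconv U f t = ∫ r in (0 : ℝ)..t, U r (f (t - r)) := by
  have := intervalIntegral.integral_comp_sub_left (fun r => U r (f (t - r))) t (a := 0) (b := t)
  simpa [kconv] using this

theorem intervalIntegrable_rpow_sub {a : ℝ} (ha : 0 < a) (b c t : ℝ) :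
    IntervalIntegrable (fun s => (t - s) ^ (a - 1)) volume b c := by
  have h := (intervalIntegral.intervalIntegrable_rpow' (r := a - 1) (by linarith)
    (a := t - b) (b := t - c)).comp_sub_left t
  simpa using h

namespace IsSingularKernel

variable {U : ℝ → H →L[ℝ] E} {a : ℝ}

theorem integrableOn_kconv (hU : IsSingularKernel U a) {f : ℝ → H} {b t : ℝ}
    (hbt : b ≤ t) (hf : ContinuousOn f (Icc b t)) :
    IntervalIntegrable (fun s => U (t - s) (f s)) volume b t := by
  obtain ⟨C, hC, hUC⟩ := hU.bound (t - b)
  obtain ⟨F, hF⟩ := isCompact_Icc.exists_bound_of_continuousOn hf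
  refine IntervalIntegrable.mono_fun' (g := fun s => C * (t - s) ^ (a - 1) * F)
    (((intervalIntegrable_rpow_sub hU.pos b t t).const_mul C).mul_const F) ?_ ?_
  · rw [uIoc_of_le hbt, ← restrict_Ioo_eq_restrict_Ioc]
    refine ContinuousOn.aestronglyMeasurable (fun s hs => ?_) measurableSet_Ioo
    refine ContinuousWithinAt.clm_apply ?_ ((hf s ⟨hs.1.le, hs.2.le⟩).mono Ioo_subset_Icc_self)
    have h1 : ContinuousAt U (t - s) := hU.continuousOn.continuousAt (Ioi_mem_nhds (sub_pos.2 hs.2))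
    exact (ContinuousAt.comp (f := fun s => t - s) h1 (by fun_prop)).continuousWithinAt
  · rw [uIoc_of_le hbt, ← restrict_Ioo_eq_restrict_Ioc]
    filter_upwards [ae_restrict_mem measurableSet_Ioo] with s hs
    refine ContinuousLinearMap.le_of_opNorm_le_of_le _ (hUC _ ⟨sub_pos.2 hs.2, ?_⟩)
      (hF s ⟨hs.1.le, hs.2.le⟩)
    linarith [hs.1]

theorem norm_integral_kconv_le {f : ℝ → H} {b t : ℝ} (hbt : b ≤ t) (ha : 0 < a) {C F : ℝ}
    (hUC : ∀ r ∈ Ioc 0 (t - b), ‖U r‖ ≤ C * r ^ (a - 1))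
    (hF : ∀ s ∈ Icc b t, ‖f s‖ ≤ F) :
    ‖∫ s in b..t, U (t - s) (f s)‖ ≤ C * F * ((t - b) ^ a / a) := by
  have h1 : ‖∫ s in b..t, U (t - s) (f s)‖ ≤ ∫ s in b..t, C * F * (t - s) ^ (a - 1) := by
    refine intervalIntegral.norm_integral_le_of_norm_le hbt ?_
      ((intervalIntegrable_rpow_sub ha b t t).const_mul _)
    have : ∀ᵐ s : ℝ, s ≠ t := by
      rw [ae_iff]
      simp
    filter_upwards [this] with s hst hs
    have hst' : s < t := lt_of_le_of_ne hs.2 hst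
    refine (ContinuousLinearMap.le_of_opNorm_le_of_le _ (hUC _ ⟨sub_pos.2 hst', ?_⟩)
      (hF s ⟨hs.1.le, hs.2⟩)).trans (le_of_eq (by ring))
    linarith [hs.1]
  refine h1.trans (le_of_eq ?_)
  rw [intervalIntegral.integral_const_mul,
    intervalIntegral.integral_comp_sub_left (fun r => r ^ (a - 1)) t, sub_self,
    integral_rpow (Or.inl (by linarith)), sub_add_cancel, Real.zero_rpow ha.ne', sub_zero]

/-- In the variable `r = t - s` the singularity stays at `r = 0` for every `t`, so dominated
convergence applies with majorant `C r ^ (a - 1) F`; the moving endpoint is absorbed in an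
indicator. -/
theorem continuousOn_kconv (hU : IsSingularKernel U a) {f : ℝ → H}
    (hf : ContinuousOn f (Ici 0)) : ContinuousOn (kconv U f) (Ici 0) := by
  intro t₀ ht₀
  have ht₀' : 0 ≤ t₀ := ht₀
  set N := t₀ + 1 with hN
  obtain ⟨C, hC, hUC⟩ := hU.bound N
  obtain ⟨F, hF⟩ := isCompact_Icc.exists_bound_of_continuousOn
    (hf.mono (Icc_subset_Ici_self : Icc 0 N ⊆ Ici 0))
  set φ : ℝ → ℝ → E := fun t r => (Ioo 0 t).indicator (fun r => U r (f (t - r))) r with hφ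
  have hin : ∀ {t r : ℝ}, r ∈ Ioo 0 t → φ t r = U r (f (t - r)) := fun hr =>
    indicator_of_mem hr _
  have hout : ∀ {t r : ℝ}, r ∉ Ioo 0 t → φ t r = 0 := fun hr => indicator_of_notMem hr _
  have heq : ∀ t ∈ Ici (0 : ℝ), kconv U f t = ∫ r, φ t r := by
    intro t ht
    rw [kconv_eq, intervalIntegral.integral_of_le ht, integral_Ioc_eq_integral_Ioo, hφ,
      integral_indicator measurableSet_Ioo]
  refine ContinuousWithinAt.congr (f := fun t => ∫ r, φ t r) ?_ heq (heq t₀ ht₀)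
  have hnear : ∀ᶠ t in 𝓝[Ici 0] t₀, t ∈ Ico 0 N := by
    filter_upwards [self_mem_nhdsWithin, nhdsWithin_le_nhds (Iio_mem_nhds (lt_add_one t₀))]
      with t h1 h2 using ⟨h1, h2⟩
  refine continuousWithinAt_of_dominated
    (bound := (Ioc 0 N).indicator fun r => C * r ^ (a - 1) * F) ?_ ?_ ?_ ?_
  · filter_upwards [hnear] with t ht
    have h1 := hU.integrableOn_kconv ht.1 (hf.mono Icc_subset_Ici_self)
    have h2 : IntervalIntegrable (fun r => U r (f (t - r))) volume 0 t := by
      have := (h1.comp_sub_left t).symm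
      simpa using this
    rw [intervalIntegrable_iff_integrableOn_Ioo_of_le ht.1] at h2
    exact (h2.integrable_indicator measurableSet_Ioo).aestronglyMeasurable
  · filter_upwards [hnear] with t ht
    refine ae_of_all _ fun r => ?_
    by_cases hr : r ∈ Ioo 0 t
    · have hrN : r ∈ Ioc 0 N := ⟨hr.1, hr.2.le.trans ht.2.le⟩
      rw [hin hr, indicator_of_mem hrN]
      refine ContinuousLinearMap.le_of_opNorm_le_of_le _ (hUC r hrN) (hF _ ⟨?_, ?_⟩)
      · linarith [hr.2]
      · linarith [hr.1, ht.2]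
    · rw [hout hr, norm_zero]
      refine indicator_nonneg (fun r hr => ?_) r
      have := (norm_nonneg _).trans (hF 0 ⟨le_rfl, by linarith⟩)
      have := Real.rpow_nonneg hr.1.le (a - 1)
      positivity
  · have h1 := ((intervalIntegral.intervalIntegrable_rpow' (r := a - 1) (by linarith [hU.pos])
      (a := 0) (b := N)).const_mul C).mul_const F
    rw [intervalIntegrable_iff_integrableOn_Ioc_of_le (by linarith)] at h1
    exact h1.integrable_indicator measurableSet_Ioc
  · have hne : ∀ᵐ r : ℝ, r ≠ t₀ := by
      rw [ae_iff]
      simp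
    filter_upwards [hne] with r hr
    rcases lt_or_gt_of_ne hr with hlt | hgt
    · by_cases hr0 : 0 < r
      · have hc : ContinuousAt (fun t => U r (f (t - r))) t₀ := by
          refine (U r).continuous.continuousAt.comp ?_
          refine ContinuousAt.comp (f := fun t => t - r) (g := f) ?_ (by fun_prop)
          exact hf.continuousAt (Ici_mem_nhds (by linarith))
        refine (hc.congr ?_).continuousWithinAt
        filter_upwards [Ioi_mem_nhds hlt] with t ht
        rw [hin ⟨hr0, ht⟩]
      · have : (fun t => φ t r) = fun _ => 0 := by
          funext t
          exact hout fun h => hr0 h.1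
        rw [this]
        exact continuousWithinAt_const
    · refine ContinuousAt.continuousWithinAt (continuousAt_const.congr (f := fun _ => (0 : E)) ?_)
      filter_upwards [Iio_mem_nhds hgt] with t ht
      exact (hout fun h => lt_asymm h.2 ht).symm

/-- Convolution with a singular kernel is small in exponentially weighted sup norms. -/
theorem exists_weight (hU : IsSingularKernel U a) (N L : ℝ) (hL : 0 ≤ L) :
    ∃ κ : ℝ, 0 ≤ κ ∧ ∀ (f : ℝ → H) (m t : ℝ), 0 ≤ m → 0 ≤ t → t ≤ N →
      (∀ s ∈ Icc 0 t, ‖f s‖ ≤ L * (m * Real.exp (κ * s))) →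
      ‖kconv U f t‖ ≤ m / 2 * Real.exp (κ * t) := by
  obtain ⟨C, hC, hUC⟩ := hU.bound N
  -- Convolving `r ^ (a - 1)` with `e^{κs}` produces at most `κ ^ (-a) Γ(a) e^{κt}`. The weight `κ`
  -- is chosen so that this gain beats `C L` by a factor `2`.
  have hlim : Tendsto (fun κ : ℝ => C * L * ((1 / κ) ^ a * Real.Gamma a)) atTop (𝓝 0) := by
    have h1 : Tendsto (fun κ : ℝ => κ ^ (-a)) atTop (𝓝 0) := tendsto_rpow_neg_atTop hU.pos
    have h2 : Tendsto (fun κ : ℝ => C * L * (κ ^ (-a) * Real.Gamma a)) atTop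
      (𝓝 (C * L * (0 * Real.Gamma a))) := (h1.mul_const _).const_mul _
    rw [zero_mul, mul_zero] at h2
    refine h2.congr' ?_
    filter_upwards [eventually_gt_atTop 0] with κ hκ
    rw [one_div, Real.inv_rpow hκ.le, Real.rpow_neg hκ.le]
  obtain ⟨κ, hκ1, hκ⟩ := ((hlim.eventually (ge_mem_nhds (show (0 : ℝ) < 1 / 2 by norm_num))).and
    (eventually_gt_atTop 0)).exists
  refine ⟨κ, hκ.le, fun f m t hm ht htN hf => ?_⟩
  have hint : IntegrableOn (fun r : ℝ => r ^ (a - 1) * Real.exp (-(κ * r))) (Ioi 0) := by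
    have := integrableOn_rpow_mul_exp_neg_mul_rpow (p := 1) (s := a - 1) (b := κ)
      (by linarith [hU.pos]) one_pos hκ
    simpa using this
  have h1 : ‖kconv U f t‖ ≤ ∫ r in (0 : ℝ)..t,
      C * L * m * Real.exp (κ * t) * (r ^ (a - 1) * Real.exp (-(κ * r))) := by
    rw [kconv_eq]
    refine intervalIntegral.norm_integral_le_of_norm_le ht (ae_of_all _ fun r hr => ?_) ?_
    · refine (ContinuousLinearMap.le_of_opNorm_le_of_le _ (hUC r ⟨hr.1, hr.2.trans htN⟩)
        (hf (t - r) ⟨by linarith [hr.2], by linarith [hr.1]⟩)).trans (le_of_eq ?_)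
      rw [mul_sub, sub_eq_add_neg (κ * t), Real.exp_add]
      ring
    · refine IntervalIntegrable.const_mul ?_ _
      rw [intervalIntegrable_iff_integrableOn_Ioc_of_le ht]
      exact hint.mono_set Ioc_subset_Ioi_self
  refine h1.trans ?_
  rw [intervalIntegral.integral_const_mul, intervalIntegral.integral_of_le ht]
  have h2 : ∫ r in Ioc 0 t, r ^ (a - 1) * Real.exp (-(κ * r)) ≤ (1 / κ) ^ a * Real.Gamma a := by
    rw [← Real.integral_rpow_mul_exp_neg_mul_Ioi hU.pos hκ]
    refine setIntegral_mono_set hint ?_ Ioc_subset_Ioi_self.eventuallyLE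
    filter_upwards [ae_restrict_mem measurableSet_Ioi] with r hr
    have := Real.rpow_nonneg (le_of_lt (mem_Ioi.1 hr)) (a - 1)
    exact mul_nonneg this (Real.exp_pos _).le
  calc C * L * m * Real.exp (κ * t) * ∫ r in Ioc 0 t, r ^ (a - 1) * Real.exp (-(κ * r))
      ≤ C * L * m * Real.exp (κ * t) * ((1 / κ) ^ a * Real.Gamma a) := by gcongr
    _ = C * L * ((1 / κ) ^ a * Real.Gamma a) * (m * Real.exp (κ * t)) := by ring
    _ ≤ 1 / 2 * (m * Real.exp (κ * t)) := by gcongr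
    _ = m / 2 * Real.exp (κ * t) := by ring

/-- At a maximum of `e^{-κt} ‖d t‖`, with value `m`, the weighted estimate yields `m ≤ b + (m + c) /
2`, hence `m ≤ 2 b + c`. The constant `c` leaves room for a remainder in the integrand. -/
theorem gronwall (hU : IsSingularKernel U a) {N : ℝ} (hN : 0 ≤ N) (L : ℝ) (hL : 0 ≤ L) :
    ∃ K : ℝ, 0 ≤ K ∧ ∀ (d : ℝ → E) (f : ℝ → H) (b c : ℝ), 0 ≤ b → 0 ≤ c →
      ContinuousOn d (Icc 0 N) → (∀ t ∈ Icc 0 N, ‖d t‖ ≤ b + ‖kconv U f t‖) →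
      (∀ s ∈ Icc 0 N, ‖f s‖ ≤ L * (‖d s‖ + c)) → ∀ t ∈ Icc 0 N, ‖d t‖ ≤ K * (2 * b + c) := by
  obtain ⟨κ, hκ, hw⟩ := hU.exists_weight N L hL
  refine ⟨Real.exp (κ * N), (Real.exp_pos _).le, fun d f b c hb hc hd hdf hfd t ht => ?_⟩
  have hcont : ContinuousOn (fun s => Real.exp (-(κ * s)) * ‖d s‖) (Icc 0 N) := by
    have := hd.norm
    fun_prop
  obtain ⟨t₁, ht₁, hmax⟩ := isCompact_Icc.exists_isMaxOn (nonempty_Icc.2 hN) hcont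
  set m := Real.exp (-(κ * t₁)) * ‖d t₁‖ with hm
  have hm0 : 0 ≤ m := by positivity
  have hle : ∀ s ∈ Icc 0 N, ‖d s‖ ≤ m * Real.exp (κ * s) := by
    intro s hs
    have h1 : Real.exp (-(κ * s)) * ‖d s‖ ≤ m := hmax hs
    rw [Real.exp_neg, inv_mul_le_iff₀ (Real.exp_pos _)] at h1
    linarith
  have h1 : ‖kconv U f t₁‖ ≤ (m + c) / 2 * Real.exp (κ * t₁) := by
    refine hw f (m + c) t₁ (by positivity) ht₁.1 ht₁.2 fun s hs => ?_
    have hs' : s ∈ Icc 0 N := ⟨hs.1, hs.2.trans ht₁.2⟩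
    refine (hfd s hs').trans ?_
    gcongr
    rw [add_mul]
    refine add_le_add (hle s hs') ?_
    exact le_mul_of_one_le_right hc (Real.one_le_exp (mul_nonneg hκ hs.1))
  have h2 : m ≤ b + (m + c) / 2 := by
    have h3 := (hdf t₁ ht₁).trans (add_le_add_right h1 b)
    rw [hm, Real.exp_neg, inv_mul_le_iff₀ (Real.exp_pos _), mul_add, ← Real.exp_neg, ← hm]
    have h4 : 1 * b ≤ Real.exp (κ * t₁) * b := by
      gcongr
      exact Real.one_le_exp (mul_nonneg hκ ht₁.1)
    linarith
  have h5 : m ≤ 2 * b + c := by linarith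
  calc ‖d t‖ ≤ m * Real.exp (κ * t) := hle t ht
    _ ≤ (2 * b + c) * Real.exp (κ * N) := by
      gcongr
      exact ht.2
    _ = _ := mul_comm _ _

end IsSingularKernel

end Volterra

/-! ### Existence and uniqueness for Lipschitz Volterra equations -/

section Volterra

variable {H E : Type*} [NormedAddCommGroup H] [NormedSpace ℝ H] [NormedAddCommGroup E]
  [NormedSpace ℝ E]

theorem continuousOn_Ici_of_forall_Icc {X : Type*} [TopologicalSpace X] {f : ℝ → X}
    (hf : ∀ N : ℝ, 0 ≤ N → ContinuousOn f (Icc 0 N)) : ContinuousOn f (Ici 0) := by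
  intro t ht
  refine (hf (t + 1) (by linarith [mem_Ici.1 ht]) t ⟨ht, by linarith⟩).mono_of_mem_nhdsWithin ?_
  rw [← Ici_inter_Iic]
  exact inter_mem self_mem_nhdsWithin (nhdsWithin_le_nhds (Iic_mem_nhds (by linarith)))

namespace IsSingularKernel

variable {U : ℝ → H →L[ℝ] E} {a : ℝ}

theorem kconv_sub (hU : IsSingularKernel U a) {f g : ℝ → H} {t : ℝ} (ht : 0 ≤ t)
    (hf : ContinuousOn f (Icc 0 t)) (hg : ContinuousOn g (Icc 0 t)) :
    kconv U f t - kconv U g t = kconv U (fun s => f s - g s) t := by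
  simp only [kconv, map_sub]
  rw [intervalIntegral.integral_sub (hU.integrableOn_kconv ht hf) (hU.integrableOn_kconv ht hg)]

/-- Picard iteration. The weight `κ` depends on the time horizon, but the iterates do not; their
pointwise limit is therefore global, and on each `[0, N]` convergence is uniform with ratio `1/2` in
the weighted norm. -/
theorem exists_solution [CompleteSpace E] (hU : IsSingularKernel U a) {g : ℝ → E → H} {L : ℝ}
    (hL : 0 ≤ L)
    (hgc : ∀ X : ℝ → E, ContinuousOn X (Ici 0) → ContinuousOn (fun s => g s (X s)) (Ici 0))
    (hgl : ∀ s : ℝ, 0 ≤ s → ∀ x y, ‖g s x - g s y‖ ≤ L * ‖x - y‖) {x₀ : ℝ → E}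
    (hx₀ : ContinuousOn x₀ (Ici 0)) :
    ∃ X : ℝ → E, ContinuousOn X (Ici 0) ∧
      ∀ t : ℝ, 0 ≤ t → X t = x₀ t + kconv U (fun s => g s (X s)) t := by
  set Φ : (ℝ → E) → ℝ → E := fun X t => x₀ t + kconv U (fun s => g s (X s)) t with hΦ
  have hΦc : ∀ X, ContinuousOn X (Ici 0) → ContinuousOn (Φ X) (Ici 0) := fun X hX =>
    hx₀.add (hU.continuousOn_kconv (hgc X hX))
  have hΦd : ∀ X X', ContinuousOn X (Ici 0) → ContinuousOn X' (Ici 0) → ∀ t, 0 ≤ t →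
      Φ X t - Φ X' t = kconv U (fun s => g s (X s) - g s (X' s)) t := by
    intro X X' hX hX' t ht
    rw [hΦ, ← hU.kconv_sub ht ((hgc X hX).mono Icc_subset_Ici_self)
      ((hgc X' hX').mono Icc_subset_Ici_self)]
    simp
  set Z : ℕ → ℝ → E := fun n => Φ^[n] x₀ with hZ
  have hZs : ∀ n, Z (n + 1) = Φ (Z n) := fun n => Function.iterate_succ_apply' Φ n x₀
  have hZc : ∀ n, ContinuousOn (Z n) (Ici 0) := by
    intro n
    induction n with
    | zero => exact hx₀
    | succ n ih =>
      rw [hZs]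
      exact hΦc _ ih
  have hgeo : ∀ N : ℝ, 0 ≤ N → ∃ κ m : ℝ, 0 ≤ m ∧
      (∀ n : ℕ, ∀ t ∈ Icc 0 N, dist (Z n t) (Z (n + 1) t) ≤ m * Real.exp (κ * t) * (1 / 2) ^ n) ∧
      ∀ (f : ℝ → H) (m t : ℝ), 0 ≤ m → 0 ≤ t → t ≤ N →
      (∀ s ∈ Icc 0 t, ‖f s‖ ≤ L * (m * Real.exp (κ * s))) →
      ‖kconv U f t‖ ≤ m / 2 * Real.exp (κ * t) := by
    intro N hN
    obtain ⟨κ, hκ, hw⟩ := hU.exists_weight N L hL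
    obtain ⟨m, hm⟩ := isCompact_Icc.exists_bound_of_continuousOn
      (((hZc 1).sub (hZc 0)).mono (Icc_subset_Ici_self : Icc 0 N ⊆ Ici 0))
    have hm0 : 0 ≤ m := (norm_nonneg _).trans (hm 0 ⟨le_rfl, hN⟩)
    refine ⟨κ, m, hm0, fun n => ?_, hw⟩
    induction n with
    | zero =>
      intro t ht
      rw [dist_comm, dist_eq_norm, pow_zero, mul_one]
      exact (hm t ht).trans (le_mul_of_one_le_right hm0 (Real.one_le_exp (mul_nonneg hκ ht.1)))
    | succ n ih =>
      intro t ht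
      rw [hZs (n + 1), dist_comm, dist_eq_norm, show Z (n + 1) t = Φ (Z n) t by rw [hZs],
        hΦd _ _ (hZc _) (hZc _) t ht.1]
      refine (hw _ (m * (1 / 2) ^ n) t (by positivity) ht.1 ht.2 fun s hs => ?_).trans
        (le_of_eq (by ring))
      refine (hgl s hs.1 _ _).trans ?_
      gcongr
      have := ih s ⟨hs.1, hs.2.trans ht.2⟩
      rw [dist_comm, dist_eq_norm] at this
      linarith
  have hlim : ∀ t : ℝ, ∃ x, 0 ≤ t → Tendsto (fun n => Z n t) atTop (𝓝 x) := by
    intro t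
    by_cases ht : 0 ≤ t
    · obtain ⟨κ, m, -, hd, -⟩ := hgeo t ht
      obtain ⟨x, hx⟩ := cauchySeq_tendsto_of_complete
        (cauchySeq_of_le_geometric (1 / 2) _ (by norm_num) fun n => hd n t ⟨ht, le_rfl⟩)
      exact ⟨x, fun _ => hx⟩
    · exact ⟨0, fun h => absurd h ht⟩
  choose X hX using hlim
  have hdist : ∀ (N κ m : ℝ), (∀ n : ℕ, ∀ t ∈ Icc 0 N,
      dist (Z n t) (Z (n + 1) t) ≤ m * Real.exp (κ * t) * (1 / 2) ^ n) → ∀ n, ∀ t ∈ Icc 0 N,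
      dist (Z n t) (X t) ≤ 2 * m * (1 / 2) ^ n * Real.exp (κ * t) := by
    intro N κ m hd n t ht
    refine (dist_le_of_le_geometric_of_tendsto (1 / 2) _ (by norm_num) (fun n => hd n t ht)
      (hX t ht.1) n).trans (le_of_eq ?_)
    norm_num
    ring
  have hpow : Tendsto (fun n : ℕ => ((1 : ℝ) / 2) ^ n) atTop (𝓝 0) :=
    tendsto_pow_atTop_nhds_zero_of_lt_one (by norm_num) (by norm_num)
  have hXc : ContinuousOn X (Ici 0) := by
    refine continuousOn_Ici_of_forall_Icc fun N hN => ?_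
    obtain ⟨κ, m, hm, hd, -⟩ := hgeo N hN
    have hunif : TendstoUniformlyOn Z X atTop (Icc 0 N) := by
      rw [Metric.tendstoUniformlyOn_iff]
      intro ε hε
      have h1 : Tendsto (fun n : ℕ => 2 * m * (1 / 2) ^ n * Real.exp (|κ| * N)) atTop (𝓝 0) := by
        simpa using (hpow.const_mul (2 * m)).mul_const (Real.exp (|κ| * N))
      filter_upwards [h1.eventually (gt_mem_nhds hε)] with n hn t ht
      rw [dist_comm]
      refine (hdist N κ m hd n t ht).trans_lt (lt_of_le_of_lt ?_ hn)
      have h3 : κ * t ≤ |κ| * N := (mul_le_mul_of_nonneg_right (le_abs_self κ) ht.1).trans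
        (mul_le_mul_of_nonneg_left ht.2 (abs_nonneg κ))
      gcongr
    exact hunif.continuousOn (Frequently.of_forall fun n => (hZc n).mono Icc_subset_Ici_self)
  refine ⟨X, hXc, fun t ht => ?_⟩
  obtain ⟨κ, m, hm, hd, hw⟩ := hgeo t ht
  refine tendsto_nhds_unique ((hX t ht).comp (tendsto_add_atTop_nat 1)) ?_
  rw [tendsto_iff_norm_sub_tendsto_zero]
  have h1 : Tendsto (fun n : ℕ => (2 * m * (1 / 2) ^ n) / 2 * Real.exp (κ * t)) atTop (𝓝 0) := by
    simpa using ((hpow.const_mul (2 * m)).div_const 2).mul_const (Real.exp (κ * t))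
  refine squeeze_zero (fun _ => norm_nonneg _) (fun n => ?_) h1
  have h2 : (Z (n + 1)) t - (x₀ t + kconv U (fun s => g s (X s)) t) =
      kconv U (fun s => g s (Z n s) - g s (X s)) t := by
    rw [← hΦd _ _ (hZc n) hXc t ht, hZs]
  rw [Function.comp_apply, h2]
  refine hw _ _ t (by positivity) ht le_rfl fun s hs => (hgl s hs.1 _ _).trans ?_
  gcongr
  rw [← dist_eq_norm]
  exact hdist t κ m hd n s hs

theorem solution_unique (hU : IsSingularKernel U a) {g : ℝ → E → H} {L : ℝ} (hL : 0 ≤ L)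
    (hgc : ∀ X : ℝ → E, ContinuousOn X (Ici 0) → ContinuousOn (fun s => g s (X s)) (Ici 0))
    (hgl : ∀ s : ℝ, 0 ≤ s → ∀ x y, ‖g s x - g s y‖ ≤ L * ‖x - y‖) {x₀ X X' : ℝ → E}
    (hX : ContinuousOn X (Ici 0)) (hX' : ContinuousOn X' (Ici 0))
    (hXe : ∀ t : ℝ, 0 ≤ t → X t = x₀ t + kconv U (fun s => g s (X s)) t)
    (hXe' : ∀ t : ℝ, 0 ≤ t → X' t = x₀ t + kconv U (fun s => g s (X' s)) t) :
    EqOn X' X (Ici 0) := by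
  intro t ht
  obtain ⟨K, hK, hg⟩ := hU.gronwall ht L hL
  have h := hg (fun s => X' s - X s) (fun s => g s (X' s) - g s (X s)) 0 0 le_rfl le_rfl
    ((hX'.sub hX).mono Icc_subset_Ici_self) (fun s hs => ?_) (fun s hs => ?_) t ⟨ht, le_rfl⟩
  · rw [mul_zero, add_zero, mul_zero] at h
    exact sub_eq_zero.1 (norm_le_zero_iff.1 h)
  · rw [zero_add, ← hU.kconv_sub hs.1 ((hgc _ hX').mono Icc_subset_Ici_self)
      ((hgc _ hX).mono Icc_subset_Ici_self), hXe s hs.1, hXe' s hs.1, add_sub_add_left_eq_sub]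
  · rw [add_zero]
    exact hgl s hs.1 _ _

end IsSingularKernel

end Volterra

/-! ### Linearization: derivative of the flow and its compactness -/

section Volterra

variable {H E : Type*} [NormedAddCommGroup H] [NormedSpace ℝ H] [NormedAddCommGroup E]
  [NormedSpace ℝ E]

/-- A `C¹` map is uniformly differentiable along a compact set. -/
theorem exists_uniform_remainder {G : E → H} (hG : ContDiff ℝ 1 G) {K : Set E} (hK : IsCompact K)
    {ε : ℝ} (hε : 0 < ε) :
    ∃ δ > 0, ∀ x ∈ K, ∀ v : E, ‖v‖ < δ → ‖G (x + v) - G x - fderiv ℝ G x v‖ ≤ ε * ‖v‖ := by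
  have hc : Continuous (fderiv ℝ G) := hG.continuous_fderiv one_ne_zero
  -- The derivative is uniformly continuous at the points of `K`, even relative to nearby points
  -- outside `K`; the mean value inequality on balls centred in `K` then gives a common `δ`.
  have hu := hK.uniformContinuousAt_of_continuousAt (fderiv ℝ G) (fun _ _ => hc.continuousAt)
    (Metric.dist_mem_uniformity hε)
  obtain ⟨δ, hδ, hd⟩ := Metric.mem_uniformity_dist.1 hu
  refine ⟨δ, hδ, fun x hx v hv => ?_⟩
  have h := (convex_ball x δ).norm_image_sub_le_of_norm_hasFDerivWithin_le' (f := G)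
    (f' := fderiv ℝ G) (φ := fderiv ℝ G x) (C := ε) (x := x) (y := x + v)
    (fun y _ => (hG.differentiable one_ne_zero y).hasFDerivAt.hasFDerivWithinAt)
    (fun y hy => ?_) (Metric.mem_ball_self hδ) (by simpa using hv)
  · simpa using h
  · have h1 := hd (a := x) (b := y) (by rwa [dist_comm]) hx
    rw [← dist_eq_norm, dist_comm]
    exact le_of_lt h1

namespace IsSingularKernel

variable {U : ℝ → H →L[ℝ] E} {a : ℝ}

theorem kconv_add (hU : IsSingularKernel U a) {f g : ℝ → H} {t : ℝ} (ht : 0 ≤ t)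
    (hf : ContinuousOn f (Icc 0 t)) (hg : ContinuousOn g (Icc 0 t)) :
    kconv U (fun s => f s + g s) t = kconv U f t + kconv U g t := by
  simp only [kconv, map_add]
  rw [intervalIntegral.integral_add (hU.integrableOn_kconv ht hf) (hU.integrableOn_kconv ht hg)]

theorem kconv_smul (U : ℝ → H →L[ℝ] E) (c : ℝ) (f : ℝ → H) (t : ℝ) :
    kconv U (fun s => c • f s) t = c • kconv U f t := by
  simp only [kconv, map_smul]
  rw [intervalIntegral.integral_smul]

/-- The equation is solved for each `η` separately. Linearity in `η` follows from uniqueness,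
boundedness from Gronwall; for negative times the operator is set to `0`. -/
theorem exists_linear_flow [CompleteSpace E] (hU : IsSingularKernel U a) {T : ℝ → E →L[ℝ] E}
    (hT : ∀ N : ℝ, ∃ C : ℝ, 0 ≤ C ∧ ∀ t ∈ Icc 0 N, ‖T t‖ ≤ C)
    (hTc : ∀ η, ContinuousOn (fun t => T t η) (Ici 0)) {B : ℝ → E →L[ℝ] H} {L : ℝ} (hL : 0 ≤ L)
    (hB : ContinuousOn B (Ici 0)) (hBL : ∀ s : ℝ, 0 ≤ s → ‖B s‖ ≤ L) :
    ∃ V : ℝ → E →L[ℝ] E, (∀ η, ContinuousOn (fun t => V t η) (Ici 0)) ∧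
      (∀ N : ℝ, 0 ≤ N → ∃ C : ℝ, 0 ≤ C ∧ ∀ t ∈ Icc 0 N, ‖V t‖ ≤ C) ∧
      ∀ t : ℝ, 0 ≤ t → ∀ η, V t η = T t η + kconv U (fun s => B s (V s η)) t := by
  have hgc : ∀ X : ℝ → E, ContinuousOn X (Ici 0) →
      ContinuousOn (fun s => B s (X s)) (Ici 0) := fun X hX => hB.clm_apply hX
  have hgl : ∀ s : ℝ, 0 ≤ s → ∀ x y, ‖B s x - B s y‖ ≤ L * ‖x - y‖ := fun s hs x y => by
    rw [← map_sub]
    exact (B s).le_of_opNorm_le (hBL s hs) _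
  choose v hvc hv using fun η => hU.exists_solution hL hgc hgl (hTc η)
  have hadd : ∀ t : ℝ, 0 ≤ t → ∀ η η', v (η + η') t = v η t + v η' t := by
    intro t ht η η'
    refine hU.solution_unique hL hgc hgl (x₀ := fun t => T t (η + η')) (X := fun t => v η t + v η' t)
      (X' := v (η + η')) ((hvc η).add (hvc η')) (hvc _) (fun t ht => ?_) (hv _) ht
    simp only [map_add]
    rw [hU.kconv_add ht ((hgc _ (hvc η)).mono Icc_subset_Ici_self)
      ((hgc _ (hvc η')).mono Icc_subset_Ici_self), hv η t ht, hv η' t ht]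
    abel
  have hsmul : ∀ t : ℝ, 0 ≤ t → ∀ (c : ℝ) η, v (c • η) t = c • v η t := by
    intro t ht c η
    refine hU.solution_unique hL hgc hgl (x₀ := fun t => T t (c • η)) (X := fun t => c • v η t)
      (X' := v (c • η)) ((hvc η).const_smul c) (hvc _) (fun t ht => ?_) (hv _) ht
    simp only [map_smul]
    rw [kconv_smul, hv η t ht, smul_add]
  have hbound : ∀ N : ℝ, 0 ≤ N → ∃ C : ℝ, 0 ≤ C ∧ ∀ t ∈ Icc 0 N, ∀ η, ‖v η t‖ ≤ C * ‖η‖ := by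
    intro N hN
    obtain ⟨C, hC, hTC⟩ := hT N
    obtain ⟨K, hK, hg⟩ := hU.gronwall hN L hL
    refine ⟨K * (2 * C), by positivity, fun t ht η => ?_⟩
    have := hg (v η) (fun s => B s (v η s)) (C * ‖η‖) 0 (by positivity) le_rfl
      ((hvc η).mono Icc_subset_Ici_self) (fun s hs => ?_) (fun s hs => ?_) t ht
    · linarith
    · rw [hv η s hs.1]
      refine (norm_add_le _ _).trans ?_
      gcongr
      · exact (T s).le_of_opNorm_le (hTC s hs) η
    · rw [add_zero]
      exact (B s).le_of_opNorm_le (hBL s hs.1) _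
  choose C hC0 hC using hbound
  set V : ℝ → E →L[ℝ] E := fun t => if ht : 0 ≤ t then
    LinearMap.mkContinuous
      { toFun := fun η => v η t
        map_add' := hadd t ht
        map_smul' := hsmul t ht } (C t ht) (hC t ht t ⟨ht, le_rfl⟩) else 0 with hV
  have hVv : ∀ t : ℝ, 0 ≤ t → ∀ η, V t η = v η t := by
    intro t ht η
    simp only [hV, dif_pos ht]
    rfl
  refine ⟨V, fun η => (hvc η).congr fun t ht => hVv t ht η, fun N hN => ⟨C N hN, hC0 N hN,
    fun t ht => ?_⟩, fun t ht η => ?_⟩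
  · refine ContinuousLinearMap.opNorm_le_bound _ (hC0 N hN) fun η => ?_
    rw [hVv t ht.1]
    exact hC N hN t ht η
  · rw [hVv t ht, hv η t ht]
    congr 1
    refine intervalIntegral.integral_congr fun s hs => ?_
    rw [uIcc_of_le ht] at hs
    simp only [hVv s hs.1]

/-- Gronwall is used twice: first for Lipschitz dependence on `ξ`, then for the error `d = X(ξ + η)
- X(ξ) - V η`. The integrand for `d` is the Taylor remainder of `G` along the compact trajectory
plus `DG(X) d`, and the remainder is at most `ε' c₀ ‖η‖` for small `η`. -/
theorem hasFDerivAt_flow [CompleteSpace E] (hU : IsSingularKernel U a) {T : ℝ → E →L[ℝ] E}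
    (hT : ∀ N : ℝ, ∃ C : ℝ, 0 ≤ C ∧ ∀ t ∈ Icc 0 N, ‖T t‖ ≤ C)
    {G : E → H} (hG : ContDiff ℝ 1 G) {L : ℝ} (hL : 0 ≤ L)
    (hGL : ∀ x y, ‖G x - G y‖ ≤ L * ‖x - y‖) {Y : ℝ → E} {X : E → ℝ → E}
    (hXc : ∀ ξ, ContinuousOn (X ξ) (Ici 0))
    (hX : ∀ ξ, ∀ t : ℝ, 0 ≤ t → X ξ t = T t ξ + Y t + kconv U (fun s => G (X ξ s)) t)
    (ξ : E) {V : ℝ → E →L[ℝ] E} (hVc : ∀ η, ContinuousOn (fun t => V t η) (Ici 0))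
    (hV : ∀ t : ℝ, 0 ≤ t → ∀ η,
      V t η = T t η + kconv U (fun s => fderiv ℝ G (X ξ s) (V s η)) t) {t : ℝ} (ht : 0 ≤ t) :
    HasFDerivAt (fun ξ => X ξ t) (V t) ξ := by
  obtain ⟨C, hC, hTC⟩ := hT t
  obtain ⟨K, hK, hg⟩ := hU.gronwall ht L hL
  -- With `L + 1` in place of `L`, the bound `L ‖d‖ + c` fits the form `(L + 1) (‖d‖ + c)`, even
  -- when `L = 0`.
  obtain ⟨K', hK', hg'⟩ := hU.gronwall ht (L + 1) (by positivity)
  have hGc : ∀ ξ, ContinuousOn (fun s => G (X ξ s)) (Ici 0) := fun ξ =>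
    hG.continuous.comp_continuousOn (hXc ξ)
  have hDGc : Continuous (fderiv ℝ G) := hG.continuous_fderiv one_ne_zero
  have hDc : ∀ η, ContinuousOn (fun s => fderiv ℝ G (X ξ s) (V s η)) (Ici 0) := fun η =>
    (hDGc.comp_continuousOn (hXc ξ)).clm_apply (hVc η)
  have hDG : ∀ x, ‖fderiv ℝ G x‖ ≤ L := fun x =>
    norm_fderiv_le_of_lipschitz (C := ⟨L, hL⟩) ℝ (LipschitzWith.of_dist_le_mul fun x y => by
      rw [dist_eq_norm, dist_eq_norm]
      exact hGL x y)
  have hLip : ∀ η, ∀ s ∈ Icc 0 t, ‖X (ξ + η) s - X ξ s‖ ≤ K * (2 * C) * ‖η‖ := by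
    intro η s hs
    have := hg (fun s => X (ξ + η) s - X ξ s) (fun s => G (X (ξ + η) s) - G (X ξ s)) (C * ‖η‖) 0
      (by positivity) le_rfl (((hXc _).sub (hXc _)).mono Icc_subset_Ici_self) (fun s hs => ?_)
      (fun s hs => ?_) s hs
    · linarith
    · rw [← hU.kconv_sub hs.1 ((hGc _).mono Icc_subset_Ici_self)
        ((hGc _).mono Icc_subset_Ici_self), hX _ s hs.1, hX ξ s hs.1, map_add]
      have e : T s ξ + T s η + Y s + kconv U (fun s => G (X (ξ + η) s)) s -
          (T s ξ + Y s + kconv U (fun s => G (X ξ s)) s) = T s η +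
          (kconv U (fun s => G (X (ξ + η) s)) s - kconv U (fun s => G (X ξ s)) s) := by abel
      rw [e]
      refine (norm_add_le _ _).trans ?_
      gcongr
      exact (T s).le_of_opNorm_le (hTC s hs) η
    · rw [add_zero]
      exact hGL _ _
  set c₀ := K * (2 * C) with hc₀
  have hc₀0 : 0 ≤ c₀ := by positivity
  rw [hasFDerivAt_iff_isLittleO_nhds_zero, Asymptotics.isLittleO_iff]
  intro ε hε
  set ε' := ε / (K' * c₀ + 1) with hε'
  have hε'0 : 0 < ε' := by positivity
  obtain ⟨δ, hδ, hrem⟩ := exists_uniform_remainder hG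
    (isCompact_Icc.image_of_continuousOn ((hXc ξ).mono (Icc_subset_Ici_self : Icc 0 t ⊆ Ici 0)))
    hε'0
  have hnear : ∀ᶠ η : E in 𝓝 0, c₀ * ‖η‖ < δ := by
    have : Continuous fun η : E => c₀ * ‖η‖ := by fun_prop
    have h0 := this.tendsto 0
    rw [norm_zero, mul_zero] at h0
    exact h0.eventually (gt_mem_nhds hδ)
  filter_upwards [hnear] with η hη
  have h := hg' (fun s => X (ξ + η) s - X ξ s - V s η)
    (fun s => G (X (ξ + η) s) - G (X ξ s) - fderiv ℝ G (X ξ s) (V s η)) 0 (ε' * (c₀ * ‖η‖)) le_rfl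
    (by positivity) ((((hXc _).sub (hXc _)).sub (hVc η)).mono Icc_subset_Ici_self) (fun s hs => ?_)
    (fun s hs => ?_) t ⟨ht, le_rfl⟩
  · refine h.trans ?_
    have e1 : K' * (2 * 0 + ε' * (c₀ * ‖η‖)) = ε' * (K' * c₀) * ‖η‖ := by ring
    rw [e1]
    gcongr
    rw [hε', div_mul_eq_mul_div, div_le_iff₀ (by positivity)]
    gcongr
    linarith
  · rw [zero_add, ← hU.kconv_sub (f := fun s => G (X (ξ + η) s) - G (X ξ s)) hs.1
      (((hGc _).sub (hGc _)).mono Icc_subset_Ici_self)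
      ((hDc η).mono Icc_subset_Ici_self), ← hU.kconv_sub hs.1 ((hGc _).mono Icc_subset_Ici_self)
      ((hGc _).mono Icc_subset_Ici_self), hX _ s hs.1, hX ξ s hs.1, hV s hs.1, map_add]
    refine le_of_eq (congrArg _ ?_)
    abel
  · have h1 := hLip η s hs
    have h2 := hrem (X ξ s) (mem_image_of_mem _ hs) (X (ξ + η) s - X ξ s) (h1.trans_lt hη)
    rw [add_sub_cancel] at h2
    have e : G (X (ξ + η) s) - G (X ξ s) - fderiv ℝ G (X ξ s) (V s η) =
        (G (X (ξ + η) s) - G (X ξ s) - fderiv ℝ G (X ξ s) (X (ξ + η) s - X ξ s)) +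
        fderiv ℝ G (X ξ s) (X (ξ + η) s - X ξ s - V s η) := by
      rw [map_sub _ (X (ξ + η) s - X ξ s)]
      abel
    rw [e]
    refine (norm_add_le _ _).trans ?_
    have h3 := (fderiv ℝ G (X ξ s)).le_of_opNorm_le (hDG (X ξ s)) (X (ξ + η) s - X ξ s - V s η)
    have h4 : ε' * ‖X (ξ + η) s - X ξ s‖ ≤ ε' * (c₀ * ‖η‖) := by gcongr
    have h5 : 0 ≤ L * (ε' * (c₀ * ‖η‖)) := by positivity
    nlinarith [norm_nonneg (X (ξ + η) s - X ξ s - V s η)]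

/-- The laws for `T` and `U` factor `T e` out of everything in `V t` except the convolution over `[t
- e, t]`. That piece has norm `O(e ^ a)`, so `V t` is a norm limit of the compact operators `T e ∘L
V (t - e)`. -/
theorem isCompactOperator_flow [CompleteSpace E] (hU : IsSingularKernel U a) {T : ℝ → E →L[ℝ] E}
    (hTadd : ∀ s t : ℝ, 0 ≤ s → 0 ≤ t → ∀ x, T (s + t) x = T s (T t x))
    (hTU : ∀ s t : ℝ, 0 ≤ s → 0 < t → ∀ x, U (s + t) x = T s (U t x))
    (hTcomp : ∀ t : ℝ, 0 < t → IsCompactOperator (T t)) {B : ℝ → E →L[ℝ] H} {L : ℝ} (hL : 0 ≤ L)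
    (hB : ContinuousOn B (Ici 0)) (hBL : ∀ s : ℝ, 0 ≤ s → ‖B s‖ ≤ L)
    {V : ℝ → E →L[ℝ] E} (hVc : ∀ η, ContinuousOn (fun t => V t η) (Ici 0))
    (hVb : ∀ N : ℝ, 0 ≤ N → ∃ C : ℝ, 0 ≤ C ∧ ∀ t ∈ Icc 0 N, ‖V t‖ ≤ C)
    (hV : ∀ t : ℝ, 0 ≤ t → ∀ η, V t η = T t η + kconv U (fun s => B s (V s η)) t)
    {t : ℝ} (ht : 0 < t) : IsCompactOperator (V t) := by
  obtain ⟨C, hC, hVC⟩ := hVb t ht.le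
  obtain ⟨CU, hCU, hUC⟩ := hU.bound t
  have hdiff : ∀ e ∈ Ioo 0 t, ‖T e ∘L V (t - e) - V t‖ ≤ CU * (L * C) * (e ^ a / a) := by
    intro e he
    have hap := hU.pos
    refine ContinuousLinearMap.opNorm_le_bound _
      (mul_nonneg (by positivity) (div_nonneg (Real.rpow_nonneg he.1.le a) hap.le)) fun η => ?_
    have hfc : ContinuousOn (fun s => B s (V s η)) (Ici 0) := hB.clm_apply (hVc η)
    have hte : 0 ≤ t - e := by linarith [he.2]
    have hsplit : kconv U (fun s => B s (V s η)) t =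
        T e (kconv U (fun s => B s (V s η)) (t - e)) +
          ∫ s in (t - e)..t, U (t - s) (B s (V s η)) := by
      have hint := hU.integrableOn_kconv ht.le (hfc.mono Icc_subset_Ici_self)
      have hmem : t - e ∈ uIcc 0 t := by
        rw [uIcc_of_le ht.le]
        exact ⟨hte, by linarith [he.1]⟩
      rw [kconv, ← intervalIntegral.integral_add_adjacent_intervals
        (hint.mono_set (uIcc_subset_uIcc_left hmem)) (hint.mono_set (uIcc_subset_uIcc_right hmem))]
      congr 1
      rw [kconv, ← (T e).intervalIntegral_comp_comm
        (hU.integrableOn_kconv hte (hfc.mono Icc_subset_Ici_self))]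
      have hne : ∀ᵐ s : ℝ, s ≠ t - e := by
        rw [ae_iff]
        simp
      refine intervalIntegral.integral_congr_ae ?_
      filter_upwards [hne] with s hs1 hs2
      rw [uIoc_of_le hte] at hs2
      rw [← hTU e (t - e - s) he.1.le (sub_pos.2 (lt_of_le_of_ne hs2.2 hs1))]
      congr 2
      ring
    have hTt : T t η = T e (T (t - e) η) := by
      rw [← hTadd e (t - e) he.1.le hte, add_sub_cancel]
    have heq : (T e ∘L V (t - e) - V t) η = -∫ s in (t - e)..t, U (t - s) (B s (V s η)) := by
      rw [_root_.sub_apply, ContinuousLinearMap.comp_apply, hV t ht.le, hV (t - e) hte, hsplit,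
        map_add, hTt]
      abel
    rw [heq, norm_neg]
    have hb := norm_integral_kconv_le (U := U) (f := fun s => B s (V s η)) (b := t - e) (t := t)
      (by linarith [he.1]) hap (C := CU) (F := L * (C * ‖η‖)) (fun r hr => hUC r ⟨hr.1, by
        linarith [hr.2, he.2]⟩) (fun s hs => ?_)
    · rw [sub_sub_cancel] at hb
      refine hb.trans (le_of_eq (by ring))
    · have hs0 : 0 ≤ s := hte.trans hs.1
      refine ContinuousLinearMap.le_of_opNorm_le_of_le _ (hBL s hs0) ?_
      exact (V s).le_of_opNorm_le (hVC s ⟨hs0, hs.2⟩) η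
  refine isCompactOperator_of_tendsto (l := 𝓝[>] (0 : ℝ)) (F := fun e => T e ∘L V (t - e)) ?_ ?_
  · rw [tendsto_iff_norm_sub_tendsto_zero]
    have hlim : Tendsto (fun e : ℝ => CU * (L * C) * (e ^ a / a)) (𝓝[>] 0) (𝓝 0) := by
      have h1 : Continuous fun e : ℝ => CU * (L * C) * (e ^ a / a) := by
        have := Real.continuous_rpow_const hU.pos.le
        fun_prop
      have h2 := h1.tendsto 0
      rw [Real.zero_rpow hU.pos.ne', zero_div, mul_zero] at h2
      exact h2.mono_left nhdsWithin_le_nhds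
    refine squeeze_zero' (Eventually.of_forall fun _ => norm_nonneg _) ?_ hlim
    filter_upwards [Ioo_mem_nhdsGT ht] with e he using hdiff e he
  · filter_upwards [self_mem_nhdsWithin] with e he
    exact (hTcomp e he).comp_clm (V (t - e))

end IsSingularKernel

end Volterra

/-! ### The kernel through which forcing in `H` acts on `H₀` -/

section Linear

variable {H E : Type*} [NormedAddCommGroup H] [NormedSpace ℂ H] [NormedAddCommGroup E]
  [NormedSpace ℂ E] {T D : ℝ → E →L[ℂ] E}

namespace IsAnalyticSemigroup

theorem bound_Icc (hT : IsAnalyticSemigroup T D) (N : ℝ) :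
    ∃ C : ℝ, 0 ≤ C ∧ ∀ t ∈ Icc 0 N, ‖T t‖ ≤ C := by
  obtain ⟨C, hC, hb⟩ := hT.bound N
  refine ⟨C + 1, by positivity, fun t ht => ?_⟩
  rcases ht.1.eq_or_lt with rfl | h
  · rw [hT.zero]
    have : ‖(1 : E →L[ℂ] E)‖ ≤ 1 := ContinuousLinearMap.norm_id_le
    linarith
  · have := (hb t ⟨h, ht.2⟩).1
    linarith

/-- Joint continuity of `(t, x) ↦ T t x`. -/
theorem continuous_uncurry (hT : IsAnalyticSemigroup T D) :
    Continuous fun p : ℝ × E => T (max p.1 0) p.2 := by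
  rw [continuous_iff_continuousAt]
  rintro ⟨τ, x⟩
  obtain ⟨C, hC, hb⟩ := hT.bound_Icc (max τ 0 + 1)
  have h1 : Continuous fun s : ℝ => T (max s 0) x :=
    (hT.continuousOn x).comp_continuous (by fun_prop) fun s => mem_Ici.2 (le_max_right _ _)
  have h2 : Tendsto (fun p : ℝ × E => T (max p.1 0) x) (𝓝 (τ, x)) (𝓝 (T (max τ 0) x)) :=
    (h1.comp continuous_fst).tendsto (τ, x)
  have h3 : Tendsto (fun p : ℝ × E => T (max p.1 0) (p.2 - x)) (𝓝 (τ, x)) (𝓝 0) := by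
    rw [tendsto_zero_iff_norm_tendsto_zero]
    have h4 : Tendsto (fun p : ℝ × E => C * ‖p.2 - x‖) (𝓝 (τ, x)) (𝓝 0) := by
      have : Continuous fun p : ℝ × E => C * ‖p.2 - x‖ := by fun_prop
      simpa using this.tendsto (τ, x)
    refine squeeze_zero' (Eventually.of_forall fun _ => norm_nonneg _) ?_ h4
    have h5 : ∀ᶠ p : ℝ × E in 𝓝 (τ, x), max p.1 0 < max τ 0 + 1 := by
      have : Continuous fun p : ℝ × E => max p.1 0 := by fun_prop
      exact (this.tendsto (τ, x)).eventually (gt_mem_nhds (lt_add_one _))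
    filter_upwards [h5] with p hp
    exact (T _).le_of_opNorm_le (hb _ ⟨le_max_right _ _, hp.le⟩) _
  have h6 := h3.add h2
  rw [zero_add] at h6
  refine h6.congr fun p => ?_
  rw [map_sub, sub_add_cancel]

theorem hasDerivAt_restrictScalars (hT : IsAnalyticSemigroup T D) {t : ℝ} (ht : 0 < t) :
    HasDerivAt (fun t => (T t).restrictScalars ℝ) ((D t).restrictScalars ℝ) t :=
  (ContinuousLinearMap.restrictScalarsL ℂ E E ℝ ℝ).hasFDerivAt.comp_hasDerivAt t
    (hT.hasDerivAt t ht)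

theorem hasDerivAt_apply (hT : IsAnalyticSemigroup T D) {t : ℝ} (ht : 0 < t) (x : E) :
    HasDerivAt (fun t => T t x) (D t x) t := by
  have h := (hT.hasDerivAt_restrictScalars ht).clm_apply (hasDerivAt_const t x)
  simpa using! h

end IsAnalyticSemigroup

/-- The data of a linear problem `v' = A v + f` with an operator `A` in `H` whose part in `E`
generates the analytic semigroup `T` with derivative `D`; here `J = (l - A)⁻¹ : H → E` and
`ι : E → H` is the inclusion. -/
structure IsLinearProblem (T D : ℝ → E →L[ℂ] E) (ι : E →L[ℂ] H) (J : H →L[ℂ] E) (l : ℂ) :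
    Prop where
  semigroup : IsAnalyticSemigroup T D
  generated : IsGeneratedThrough T D l (J ∘L ι)
  injective : ∀ x, J (ι x) = 0 → x = 0

/-- The kernel `U t = (l - A₀) T(t) (l - A)⁻¹`, through which inhomogeneities act. -/
noncomputable def mildKernel (T D : ℝ → E →L[ℂ] E) (J : H →L[ℂ] E) (l : ℂ) (t : ℝ) : H →L[ℝ] E :=
  ((l • T t - D t) ∘L J).restrictScalars ℝ

namespace IsLinearProblem

variable {ι : E →L[ℂ] H} {J : H →L[ℂ] E} {l : ℂ}

theorem mildKernel_apply (t : ℝ) (x : H) : mildKernel T D J l t x = l • T t (J x) - D t (J x) :=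
  rfl

theorem commute_apply (h : IsLinearProblem T D ι J l) {t : ℝ} (ht : 0 ≤ t) (x : E) :
    J (ι (T t x)) = T t (J (ι x)) := by
  rcases ht.eq_or_lt with rfl | ht
  · rw [h.semigroup.zero]
    rfl
  · exact congrArg (fun L : E →L[ℂ] E => L x) (h.generated.commute t ht)

theorem deriv_apply (h : IsLinearProblem T D ι J l) {t : ℝ} (ht : 0 < t) (x : E) :
    J (ι (D t x)) = T t (l • J (ι x) - x) :=
  congrArg (fun L : E →L[ℂ] E => L x) (h.generated.deriv t ht)

theorem deriv_apply' (h : IsLinearProblem T D ι J l) {t : ℝ} (ht : 0 < t) (x : E) :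
    D t (J (ι x)) = T t (l • J (ι x) - x) :=
  congrArg (fun L : E →L[ℂ] E => L x) (h.generated.deriv' t ht)

theorem eq_of_resolvent_eq (h : IsLinearProblem T D ι J l) {x y : E} (hxy : J (ι x) = J (ι y)) :
    x = y := by
  rw [← sub_eq_zero]
  refine h.injective _ ?_
  rw [map_sub, map_sub, hxy, sub_self]

/-- After applying `(l - A)⁻¹` the singular kernel becomes the bounded operator `T t ∘L J`.
Identities for the kernel are proved in this form and then transferred by injectivity. -/
theorem resolvent_mildKernel (h : IsLinearProblem T D ι J l) {t : ℝ} (ht : 0 < t) (x : H) :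
    J (ι (mildKernel T D J l t x)) = T t (J x) := by
  rw [mildKernel_apply, map_sub, map_sub, map_smul, map_smul, h.deriv_apply ht,
    h.commute_apply ht.le, map_sub, map_smul]
  abel

theorem mildKernel_add (h : IsLinearProblem T D ι J l) {s t : ℝ} (hs : 0 ≤ s) (ht : 0 < t)
    (x : H) : mildKernel T D J l (s + t) x = T s (mildKernel T D J l t x) := by
  refine h.eq_of_resolvent_eq ?_
  rw [h.resolvent_mildKernel (by linarith), h.commute_apply hs, h.resolvent_mildKernel ht,
    h.semigroup.add s t hs ht.le]
  rfl

/-- Near `t` the kernel is `T(r - t/2)` composed with the fixed operator `U(t/2)`, so it inherits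
norm differentiability from `T`. -/
theorem hasDerivAt_mildKernel (h : IsLinearProblem T D ι J l) {t : ℝ} (ht : 0 < t) :
    HasDerivAt (mildKernel T D J l)
      ((D (t / 2)).restrictScalars ℝ ∘L mildKernel T D J l (t / 2)) t := by
  have h1 : HasDerivAt (fun r => (T (r - t / 2)).restrictScalars ℝ)
      ((D (t / 2)).restrictScalars ℝ) t := by
    have h2 := h.semigroup.hasDerivAt_restrictScalars (half_pos ht)
    have h3 : t / 2 = t - t / 2 := by ring
    rw [h3] at h2
    have h4 := HasDerivAt.comp_sub_const t (t / 2) h2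
    rwa [← h3] at h4
  have h5 := h1.clm_comp (hasDerivAt_const t (mildKernel T D J l (t / 2)))
  rw [ContinuousLinearMap.comp_zero, add_zero] at h5
  refine h5.congr_of_eventuallyEq ?_
  filter_upwards [Ioi_mem_nhds (half_lt_self ht)] with r hr
  ext x
  have := h.mildKernel_add (sub_nonneg.2 (le_of_lt hr)) (half_pos ht) x
  rwa [sub_add_cancel] at this

/-- The resolvent identity `hJ` makes the kernel independent of the spectral parameter. This freedom
allows `l` to vary with `t` in the singularity estimate and to tend to infinity in the variation
formula. -/
theorem mildKernel_eq {J' : H →L[ℂ] E} {l' : ℂ} (h' : IsLinearProblem T D ι J' l')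
    (hJ : ∀ x, J' x - J x = (l - l') • J' (ι (J x))) {t : ℝ} (ht : 0 < t) : mildKernel T D J l t = mildKernel T D J' l' t := by
  ext x
  refine h'.eq_of_resolvent_eq ?_
  rw [h'.resolvent_mildKernel ht, mildKernel_apply]
  have e : l • T t (J x) - D t (J x) = (l - l') • T t (J x) + (l' • T t (J x) - D t (J x)) := by
    module
  have hx := hJ x
  rw [sub_eq_iff_eq_add] at hx
  rw [e, map_add, map_add, map_sub, map_sub, map_smul, map_smul, map_smul, map_smul,
    h'.deriv_apply ht, h'.commute_apply ht.le, hx, map_add, map_sub, map_smul, map_smul]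
  abel

end IsLinearProblem

end Linear

/-! ### Mild solutions of the linear problem -/

section Linear

/-- Fubini's theorem on a triangle. -/
theorem integral_integral_triangle {E : Type*} [NormedAddCommGroup E] [NormedSpace ℝ E]
    {F : ℝ → ℝ → E} (hF : Continuous (Function.uncurry F)) {t : ℝ} (ht : 0 ≤ t) :
    ∫ r in (0 : ℝ)..t, ∫ s in (0 : ℝ)..r, F r s = ∫ s in (0 : ℝ)..t, ∫ r in s..t, F r s := by
  set S : Set (ℝ × ℝ) := {p | p.2 ≤ p.1} with hS
  have hSm : MeasurableSet S := measurableSet_le measurable_snd measurable_fst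
  have hint : Integrable (Function.uncurry fun r s => S.indicator (Function.uncurry F) (r, s))
      ((volume.restrict (Ioc 0 t)).prod (volume.restrict (Ioc 0 t))) := by
    refine Integrable.indicator (f := Function.uncurry F) ?_ hSm
    rw [Measure.prod_restrict]
    exact (hF.continuousOn.integrableOn_compact (isCompact_Icc.prod isCompact_Icc)).mono_set
      (prod_mono Ioc_subset_Icc_self Ioc_subset_Icc_self)
  have hswap := integral_integral_swap hint
  have h1 : ∀ r ∈ Ioc 0 t, ∫ s in Ioc 0 t, S.indicator (Function.uncurry F) (r, s) =
      ∫ s in (0 : ℝ)..r, F r s := by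
    intro r hr
    rw [intervalIntegral.integral_of_le hr.1.le, ← integral_indicator measurableSet_Ioc,
      ← integral_indicator measurableSet_Ioc]
    congr 1
    funext s
    by_cases hs : s ≤ r
    · have hm : (r, s) ∈ S := hs
      by_cases hs0 : 0 < s
      · rw [indicator_of_mem (show s ∈ Ioc 0 t from ⟨hs0, hs.trans hr.2⟩),
          indicator_of_mem (show s ∈ Ioc 0 r from ⟨hs0, hs⟩), indicator_of_mem hm]
        rfl
      · rw [indicator_of_notMem (fun h => hs0 h.1), indicator_of_notMem (fun h => hs0 h.1)]
    · have hm : (r, s) ∉ S := hs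
      rw [indicator_of_notMem (show s ∉ Ioc 0 r from fun h => hs h.2)]
      exact indicator_apply_eq_zero.2 fun _ => indicator_of_notMem hm _
  have h2 : ∀ s ∈ Ioc 0 t, ∫ r in Ioc 0 t, S.indicator (Function.uncurry F) (r, s) =
      ∫ r in s..t, F r s := by
    intro s hs
    rw [intervalIntegral.integral_of_le hs.2, ← integral_Icc_eq_integral_Ioc (f := fun r => F r s),
      ← integral_indicator measurableSet_Ioc, ← integral_indicator measurableSet_Icc]
    congr 1
    funext r
    by_cases hr : s ≤ r
    · have hm : (r, s) ∈ S := hr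
      by_cases hrt : r ≤ t
      · rw [indicator_of_mem (show r ∈ Ioc 0 t from ⟨hs.1.trans_le hr, hrt⟩),
          indicator_of_mem (show r ∈ Icc s t from ⟨hr, hrt⟩), indicator_of_mem hm]
        rfl
      · rw [indicator_of_notMem (fun h => hrt h.2), indicator_of_notMem (fun h => hrt h.2)]
    · have hm : (r, s) ∉ S := hr
      rw [indicator_of_notMem (show r ∉ Icc s t from fun h => hr h.1)]
      exact indicator_apply_eq_zero.2 fun _ => indicator_of_notMem hm _
  rw [intervalIntegral.integral_of_le ht, intervalIntegral.integral_of_le ht,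
    ← setIntegral_congr_fun measurableSet_Ioc h1, ← setIntegral_congr_fun measurableSet_Ioc h2]
  exact hswap

variable {H E : Type*} [NormedAddCommGroup H] [NormedSpace ℂ H] [NormedAddCommGroup E]
  [NormedSpace ℂ E]

/-- `v` is continuous on `[0, ∞)` and `v(t) = A ∫₀ᵗ v + F(t)`, expressed through
`J = (l - A)⁻¹`. -/
def IsMild (ι : E →L[ℂ] H) (J : H →L[ℂ] E) (l : ℂ) (v : ℝ → E) (F : ℝ → H) : Prop :=
  ContinuousOn v (Ici 0) ∧ ∀ t : ℝ, 0 ≤ t →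
    ∫ s in (0 : ℝ)..t, v s = J (l • ι (∫ s in (0 : ℝ)..t, v s) - (ι (v t) - F t))

theorem intervalIntegrable_of_continuousOn_Ici {X : Type*} [NormedAddCommGroup X] {v : ℝ → X}
    (hv : ContinuousOn v (Ici 0)) {t : ℝ} (ht : 0 ≤ t) : IntervalIntegrable v volume 0 t :=
  (hv.mono (by rw [uIcc_of_le ht]; exact Icc_subset_Ici_self)).intervalIntegrable

namespace IsMild

variable {ι : E →L[ℂ] H} {J : H →L[ℂ] E} {l : ℂ} {v v' : ℝ → E} {F F' : ℝ → H}

theorem add (h : IsMild ι J l v F) (h' : IsMild ι J l v' F') :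
    IsMild ι J l (fun t => v t + v' t) (fun t => F t + F' t) := by
  refine ⟨h.1.add h'.1, fun t ht => ?_⟩
  rw [intervalIntegral.integral_add (intervalIntegrable_of_continuousOn_Ici h.1 ht)
    (intervalIntegrable_of_continuousOn_Ici h'.1 ht)]
  have e : l • ι ((∫ s in (0 : ℝ)..t, v s) + ∫ s in (0 : ℝ)..t, v' s) -
      (ι (v t + v' t) - (F t + F' t)) =
      (l • ι (∫ s in (0 : ℝ)..t, v s) - (ι (v t) - F t)) +
      (l • ι (∫ s in (0 : ℝ)..t, v' s) - (ι (v' t) - F' t)) := by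
    rw [map_add, map_add]
    module
  rw [e, map_add, ← h.2 t ht, ← h'.2 t ht]

theorem sub (h : IsMild ι J l v F) (h' : IsMild ι J l v' F') :
    IsMild ι J l (fun t => v t - v' t) (fun t => F t - F' t) := by
  refine ⟨h.1.sub h'.1, fun t ht => ?_⟩
  rw [intervalIntegral.integral_sub (intervalIntegrable_of_continuousOn_Ici h.1 ht)
    (intervalIntegrable_of_continuousOn_Ici h'.1 ht)]
  have e : l • ι ((∫ s in (0 : ℝ)..t, v s) - ∫ s in (0 : ℝ)..t, v' s) -
      (ι (v t - v' t) - (F t - F' t)) =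
      (l • ι (∫ s in (0 : ℝ)..t, v s) - (ι (v t) - F t)) -
      (l • ι (∫ s in (0 : ℝ)..t, v' s) - (ι (v' t) - F' t)) := by
    rw [map_sub, map_sub]
    module
  rw [e, map_sub, ← h.2 t ht, ← h'.2 t ht]

theorem congr (h : IsMild ι J l v F) (hv : EqOn v' v (Ici 0)) (hF : EqOn F' F (Ici 0)) :
    IsMild ι J l v' F' := by
  refine ⟨h.1.congr hv, fun t ht => ?_⟩
  have e : ∫ s in (0 : ℝ)..t, v' s = ∫ s in (0 : ℝ)..t, v s := by
    refine intervalIntegral.integral_congr fun s hs => hv ?_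
    rw [uIcc_of_le ht] at hs
    exact hs.1
  rw [e, hv ht, hF ht]
  exact h.2 t ht

end IsMild

namespace IsLinearProblem

variable {T D : ℝ → E →L[ℂ] E} {ι : E →L[ℂ] H} {J : H →L[ℂ] E} {l : ℂ}

variable [CompleteSpace E]

/-- The integrand is `A₀ R(l, A₀) T(σ) x`, the derivative of `T(σ) R(l, A₀) x`; the resolvent makes
this orbit differentiable for every `x`. -/
theorem integral_orbit (h : IsLinearProblem T D ι J l) (x : E) {τ : ℝ} (hτ : 0 ≤ τ) :
    ∫ σ in (0 : ℝ)..τ, (l • J (ι (T σ x)) - T σ x) = J (ι (T τ x)) - J (ι x) := by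
  have hc : ContinuousOn (fun σ => T σ x) (Ici 0) := h.semigroup.continuousOn x
  have := intervalIntegral.integral_eq_sub_of_hasDerivAt_of_le hτ
    (f := fun σ => T σ (J (ι x))) (f' := fun σ => T σ (l • J (ι x) - x))
    ((h.semigroup.continuousOn _).mono Icc_subset_Ici_self)
    (fun σ hσ => (h.semigroup.hasDerivAt_apply hσ.1 _).congr_deriv (h.deriv_apply' hσ.1 x))
    (intervalIntegrable_of_continuousOn_Ici (h.semigroup.continuousOn _) hτ)
  rw [h.semigroup.zero] at this
  rw [h.commute_apply hτ]
  refine Eq.trans ?_ this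
  refine intervalIntegral.integral_congr fun σ hσ => ?_
  rw [uIcc_of_le hτ] at hσ
  rw [h.commute_apply hσ.1, map_sub, map_smul]

theorem isMild_orbit (h : IsLinearProblem T D ι J l) (x : E) :
    IsMild ι J l (fun t => T t x) (fun _ => ι x) := by
  refine ⟨h.semigroup.continuousOn x, fun t ht => ?_⟩
  have h1 := h.integral_orbit x ht
  have hint := intervalIntegrable_of_continuousOn_Ici (h.semigroup.continuousOn x) ht
  have h2 := (l • (J ∘L ι) - ContinuousLinearMap.id ℂ E).intervalIntegral_comp_comm hint
  have h3 := h1.symm.trans h2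
  change J (ι (T t x)) - J (ι x) = l • J (ι (∫ s in (0 : ℝ)..t, T s x)) - ∫ s in (0 : ℝ)..t, T s x
    at h3
  rw [map_sub, map_sub, map_smul, h3]
  abel

/-- With `y = ∫ v` the equation reads `v = A y`, in resolvent form. Then `s ↦ T(t - s) R y(s)` has
zero derivative, starts at `0` and ends at `R y(t)`. -/
theorem eq_zero_of_isMild (h : IsLinearProblem T D ι J l) {v : ℝ → E}
    (hv : IsMild ι J l v fun _ => 0) : EqOn v 0 (Ici 0) := by
  -- Freezing `v` at its value at `0` for negative times makes `y` differentiable on the whole line,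
  -- endpoint included.
  have hwc : Continuous fun s : ℝ => v (max s 0) :=
    hv.1.comp_continuous (by fun_prop) fun s => mem_Ici.2 (le_max_right _ _)
  set y : ℝ → E := fun t => ∫ s in (0 : ℝ)..t, v (max s 0) with hy
  have hyd : ∀ t, HasDerivAt y (v (max t 0)) t := fun t =>
    intervalIntegral.integral_hasDerivAt_right (hwc.intervalIntegrable _ _)
      (hwc.stronglyMeasurableAtFilter _ _) hwc.continuousAt
  have hyv : ∀ t : ℝ, 0 ≤ t → y t = ∫ s in (0 : ℝ)..t, v s := by
    intro t ht
    refine intervalIntegral.integral_congr fun s hs => ?_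
    rw [uIcc_of_le ht] at hs
    simp only [max_eq_left hs.1]
  have hyc : Continuous y := continuous_iff_continuousAt.2 fun t => (hyd t).continuousAt
  have heq : ∀ t : ℝ, 0 ≤ t → J (ι (v t)) = l • J (ι (y t)) - y t := by
    intro t ht
    have := hv.2 t ht
    rw [← hyv t ht, sub_zero, map_sub, map_smul] at this
    rw [eq_sub_iff_add_eq, add_comm, ← eq_sub_iff_add_eq]
    exact this
  have hy0 : ∀ t : ℝ, 0 ≤ t → y t = 0 := by
    intro t ht
    have hqc : Continuous fun s => T (max (t - s) 0) (J (ι (y s))) :=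
      h.semigroup.continuous_uncurry.comp
        ((continuous_const.sub continuous_id).prodMk (by fun_prop : Continuous fun s => J (ι (y s))))
    have hq : ∀ s ∈ Ico 0 t, HasDerivWithinAt (fun s => T (max (t - s) 0) (J (ι (y s)))) 0 (Ici s)
        s := by
      intro s hs
      have hts : 0 < t - s := sub_pos.2 hs.2
      have h1 : HasDerivAt (fun s => (T (t - s)).restrictScalars ℝ)
          (-(D (t - s)).restrictScalars ℝ) s :=
        (h.semigroup.hasDerivAt_restrictScalars hts).comp_const_sub t s
      have h2 : HasDerivAt (fun s => J (ι (y s))) (J (ι (v (max s 0)))) s :=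
        ((J ∘L ι).restrictScalars ℝ).hasFDerivAt.comp_hasDerivAt s (hyd s)
      have h3 := h1.clm_apply h2
      have h4 : (-(D (t - s)).restrictScalars ℝ) (J (ι (y s))) +
          ((T (t - s)).restrictScalars ℝ) (J (ι (v (max s 0)))) = 0 := by
        change -(D (t - s) (J (ι (y s)))) + T (t - s) (J (ι (v (max s 0)))) = 0
        rw [h.deriv_apply' hts, max_eq_left hs.1, heq s hs.1, neg_add_cancel]
      rw [h4] at h3
      refine (h3.congr_of_eventuallyEq ?_).hasDerivWithinAt
      filter_upwards [Iio_mem_nhds hs.2] with r hr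
      rw [max_eq_left (sub_nonneg.2 (le_of_lt hr))]
      rfl
    have hconst := constant_of_has_deriv_right_zero hqc.continuousOn hq t ⟨ht, le_rfl⟩
    have hy00 : y 0 = 0 := by simp [hy]
    rw [hy00, map_zero, map_zero, map_zero, sub_self, max_self, h.semigroup.zero] at hconst
    exact h.injective _ hconst
  intro t ht
  refine h.injective _ ?_
  rw [heq t ht, hy0 t ht]
  simp

/-- Under `J ∘ ι` the convolution becomes `∫₀ʳ T(r - s) J f(s) ds`, with a continuous integrand.
Fubini on the triangle and `integral_orbit` verify the equation there, and the extra resolvent is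
cancelled by injectivity. -/
theorem isMild_kconv {a : ℝ} (h : IsLinearProblem T D ι J l)
    (hU : IsSingularKernel (mildKernel T D J l) a) [CompleteSpace H] {f : ℝ → H}
    (hf : ContinuousOn f (Ici 0)) :
    IsMild ι J l (kconv (mildKernel T D J l) f) (fun t => ∫ s in (0 : ℝ)..t, f s) := by
  set v := kconv (mildKernel T D J l) f with hv
  have hvc : ContinuousOn v (Ici 0) := hU.continuousOn_kconv hf
  refine ⟨hvc, fun t ht => ?_⟩
  set g : ℝ → E := fun s => J (f (max s 0)) with hg
  have hgc : Continuous g := J.continuous.comp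
    (hf.comp_continuous (by fun_prop) fun s => mem_Ici.2 (le_max_right _ _))
  set F : ℝ → ℝ → E := fun r s => T (max (r - s) 0) (g s) with hF
  have hFc : Continuous (Function.uncurry F) :=
    h.semigroup.continuous_uncurry.comp
      ((continuous_fst.sub continuous_snd).prodMk (hgc.comp continuous_snd))
  have hm : ∀ r : ℝ, 0 ≤ r → J (ι (v r)) = ∫ s in (0 : ℝ)..r, F r s := by
    intro r hr
    have h1 := ((J ∘L ι).restrictScalars ℝ).intervalIntegral_comp_comm
      (hU.integrableOn_kconv hr (hf.mono Icc_subset_Ici_self))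
    refine h1.symm.trans (intervalIntegral.integral_congr_ae ?_)
    have hne : ∀ᵐ s : ℝ, s ≠ r := by
      rw [ae_iff]
      simp
    filter_upwards [hne] with s hs1 hs2
    rw [uIoc_of_le hr] at hs2
    have hrs : 0 < r - s := sub_pos.2 (lt_of_le_of_ne hs2.2 hs1)
    refine (h.resolvent_mildKernel hrs _).trans ?_
    rw [hF, hg]
    simp only [max_eq_left hrs.le, max_eq_left hs2.1.le]
  set Λ : E →L[ℂ] E := l • (J ∘L ι) - ContinuousLinearMap.id ℂ E with hΛ
  have hΛa : ∀ x, Λ x = l • J (ι x) - x := fun x => rfl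
  have hmc : ContinuousOn (fun r => J (ι (v r))) (Ici 0) :=
    (J ∘L ι).continuous.comp_continuousOn hvc
  have h1 : Λ (∫ r in (0 : ℝ)..t, J (ι (v r))) =
      ∫ r in (0 : ℝ)..t, ∫ s in (0 : ℝ)..r, Λ (F r s) := by
    rw [← Λ.intervalIntegral_comp_comm (intervalIntegrable_of_continuousOn_Ici hmc ht)]
    refine intervalIntegral.integral_congr fun r hr => ?_
    rw [uIcc_of_le ht] at hr
    rw [hm r hr.1, ← Λ.intervalIntegral_comp_comm]
    exact (hFc.comp (continuous_const.prodMk continuous_id)).intervalIntegrable 0 r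
  have h2 : ∀ s ∈ uIcc 0 t, ∫ r in s..t, Λ (F r s) = J (ι (F t s)) - J (ι (g s)) := by
    intro s hs
    rw [uIcc_of_le ht] at hs
    have h3 := h.integral_orbit (g s) (sub_nonneg.2 hs.2)
    have h4 := intervalIntegral.integral_comp_sub_right
      (fun σ => l • J (ι (T σ (g s))) - T σ (g s)) s (a := s) (b := t)
    rw [sub_self, h3] at h4
    rw [hF]
    simp only [max_eq_left (sub_nonneg.2 hs.2)]
    rw [← h4]
    refine intervalIntegral.integral_congr fun r hr => ?_
    rw [uIcc_of_le hs.2] at hr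
    simp only [max_eq_left (sub_nonneg.2 hr.1), hΛa]
  have hFt : Continuous fun s => F t s := hFc.comp (continuous_const.prodMk continuous_id)
  have h5 : Λ (∫ r in (0 : ℝ)..t, J (ι (v r))) =
      J (ι (J (ι (v t)))) - J (ι (J (∫ s in (0 : ℝ)..t, f s))) := by
    rw [h1, integral_integral_triangle (F := fun r s => Λ (F r s)) (Λ.continuous.comp hFc) ht,
      intervalIntegral.integral_congr h2, intervalIntegral.integral_sub, hm t ht]
    · congr 1
      · exact (J ∘L ι).intervalIntegral_comp_comm (hFt.intervalIntegrable 0 t)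
      · rw [← J.intervalIntegral_comp_comm (intervalIntegrable_of_continuousOn_Ici hf ht)]
        refine ((J ∘L ι).intervalIntegral_comp_comm (hgc.intervalIntegrable 0 t)).trans ?_
        change J (ι _) = J (ι _)
        congr 2
        refine intervalIntegral.integral_congr fun s hs => ?_
        rw [uIcc_of_le ht] at hs
        simp only [hg, max_eq_left hs.1]
    · exact ((J ∘L ι).continuous.comp hFt).intervalIntegrable 0 t
    · exact ((J ∘L ι).continuous.comp hgc).intervalIntegrable 0 t
  have h6 : ∫ r in (0 : ℝ)..t, J (ι (v r)) = J (ι (∫ r in (0 : ℝ)..t, v r)) :=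
    (J ∘L ι).intervalIntegral_comp_comm (intervalIntegrable_of_continuousOn_Ici hvc ht)
  rw [h6, hΛa, ← map_sub, ← map_sub, ← map_smul, ← map_smul, ← map_sub, ← map_sub] at h5
  have h7 := h.eq_of_resolvent_eq h5
  rw [map_sub, map_sub, map_smul]
  rw [sub_eq_iff_eq_add] at h7
  rw [h7]
  abel

end IsLinearProblem

end Linear

/-! ### Kernel singularity, compact semigroup and resolvent form of integrated solutions -/

section Operator

variable {H : Type*} [NormedAddCommGroup H] [NormedSpace ℂ H] {A : H →ₗ.[ℂ] H}

/-- The inclusion of the closure of the domain. -/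
noncomputable abbrev domIncl (A : H →ₗ.[ℂ] H) : domClosure A →L[ℂ] H := (domClosure A).subtypeL

theorem exists_resolvent_bound {p : ℝ}
    (hlimsup : limsup (fun l : ℝ => ENNReal.ofReal (l ^ (1 / p) * ‖resolvent A (l : ℂ)‖)) atTop < ⊤) :
    ∃ K : ℝ, 0 ≤ K ∧ ∀ᶠ l : ℝ in atTop, ‖resolvent A (l : ℂ)‖ ≤ K * l ^ (-(1 / p)) := by
  obtain ⟨b, hb1, hb2⟩ := exists_between hlimsup
  refine ⟨b.toReal, ENNReal.toReal_nonneg, ?_⟩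
  filter_upwards [eventually_lt_of_limsup_lt hb1, eventually_gt_atTop 0] with l hl hl0
  have h1 : l ^ (1 / p) * ‖resolvent A (l : ℂ)‖ ≤ b.toReal :=
    (ENNReal.ofReal_le_iff_le_toReal hb2.ne).1 hl.le
  have h2 : 0 < l ^ (1 / p) := Real.rpow_pos_of_pos hl0 _
  rw [Real.rpow_neg hl0.le, ← div_eq_mul_inv, le_div_iff₀ h2]
  linarith

theorem norm_resolventInto (A : H →ₗ.[ℂ] H) (z : ℂ) : ‖resolventInto A z‖ ≤ ‖resolvent A z‖ :=
  ContinuousLinearMap.opNorm_le_bound _ (norm_nonneg _) fun x => (resolvent A z).le_opNorm x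

theorem IsResolvent.injective {E : Type*} [NormedAddCommGroup E] [NormedSpace ℂ E]
    {B : E →ₗ.[ℂ] E} {z : ℂ} {R : E →L[ℂ] E} (h : IsResolvent B z R) {x : E} (hx : R x = 0) :
    x = 0 := by
  have h1 := h.apply_eq x
  have h2 : (⟨R x, h.mem x⟩ : B.domain) = 0 := Subtype.ext hx
  rw [h2, hx, smul_zero, zero_sub] at h1
  exact neg_eq_zero.1 (h1.symm.trans B.map_zero)

theorem isLinearProblem {z : ℂ} (hz : z ∈ resolventSet A)
    {T D : ℝ → domClosure A →L[ℂ] domClosure A} (hT : IsAnalyticSemigroup T D)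
    (hgen : IsGeneratedThrough T D z (resolventInto A z ∘L domIncl A)) :
    IsLinearProblem T D (domIncl A) (resolventInto A z) z :=
  ⟨hT, hgen, fun _ hx => (IsResolvent.part hz).injective hx⟩

theorem resolventInto_sub {z z' : ℂ} (hz : z ∈ resolventSet A) (hz' : z' ∈ resolventSet A) (x : H) :
    resolventInto A z' x - resolventInto A z x =
      (z - z') • resolventInto A z' (domIncl A (resolventInto A z x)) := by
  apply Subtype.ext
  exact congrArg (fun L : H →L[ℂ] H => L x)
    ((isResolvent_resolvent hz').identity (isResolvent_resolvent hz))

/-- With `m = c / t`, the operator `m T(t) - D(t)` has norm `O(1 / t)`, while `‖R(m, A)‖ = O(t ^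
q)`. The product is `O(t ^ (q - 1))`; the exponent may be lowered to any positive `a ≤ q` on bounded
intervals. -/
theorem isSingularKernel_mildKernel {T D : ℝ → domClosure A →L[ℂ] domClosure A}
    (hT : IsAnalyticSemigroup T D) {K q a : ℝ} (ha : 0 < a) (haq : a ≤ q) (hK : 0 ≤ K) {z : ℂ}
    (hz : z ∈ resolventSet A)
    (hgen : IsGeneratedThrough T D z (resolventInto A z ∘L domIncl A))
    (hev : ∀ᶠ l : ℝ in atTop, (l : ℂ) ∈ resolventSet A ∧
      IsGeneratedThrough T D l (resolventInto A l ∘L domIncl A) ∧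
      ‖resolvent A (l : ℂ)‖ ≤ K * l ^ (-q)) :
    IsSingularKernel (mildKernel T D (resolventInto A z) z) a := by
  have hP := isLinearProblem hz hT hgen
  refine ⟨ha, fun t ht => (hP.hasDerivAt_mildKernel ht).continuousAt.continuousWithinAt,
    fun N => ?_⟩
  obtain ⟨l₀, hl₀⟩ := eventually_atTop.1 hev
  obtain ⟨C, hC, hb⟩ := hT.bound (max N 1)
  set N' := max N 1 with hN'
  have hN1 : 1 ≤ N' := le_max_right _ _
  -- This choice guarantees `c / t ≥ l₀` for all `t ≤ N'`, so the resolvent decay is available at `m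
  -- = c / t`.
  set c := max l₀ 1 * N' with hc
  have hc0 : 0 < c := by positivity
  refine ⟨(c * C + C) * (K * c ^ (-q)) * N' ^ (q - a),
    mul_nonneg (mul_nonneg (by positivity) (mul_nonneg hK (Real.rpow_nonneg hc0.le _)))
      (Real.rpow_nonneg (by positivity) _), fun t ht => ?_⟩
  have ht0 := ht.1
  have htN : t ≤ N' := ht.2.trans (le_max_left _ _)
  set m := c / t with hm
  have hm0 : 0 < m := by positivity
  have hml : l₀ ≤ m := by
    rw [hm, le_div_iff₀ ht0]
    calc l₀ * t ≤ max l₀ 1 * t := by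
          gcongr
          exact le_max_left _ _
      _ ≤ c := by
        rw [hc]
        gcongr
  obtain ⟨hmρ, hmgen, hmb⟩ := hl₀ m hml
  rw [IsLinearProblem.mildKernel_eq (isLinearProblem hmρ hT hmgen)
    (fun x => resolventInto_sub hz hmρ x) ht0]
  obtain ⟨hb1, hb2⟩ := hb t ⟨ht0, htN⟩
  have h1 : ‖mildKernel T D (resolventInto A m) m t‖ ≤ (m * C + C / t) * (K * m ^ (-q)) := by
    rw [mildKernel, ContinuousLinearMap.norm_restrictScalars]
    refine (ContinuousLinearMap.opNorm_comp_le _ _).trans ?_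
    gcongr
    · refine (norm_sub_le _ _).trans ?_
      rw [norm_smul, Complex.norm_real, Real.norm_of_nonneg hm0.le]
      gcongr
    · exact (norm_resolventInto A m).trans hmb
  refine h1.trans ?_
  have e1 : m ^ (-q) = c ^ (-q) * t ^ q := by
    rw [hm, Real.div_rpow hc0.le ht0.le, Real.rpow_neg ht0.le, div_inv_eq_mul]
  have e2 : t ^ q = t * t ^ (a - 1) * t ^ (q - a) := by
    nth_rewrite 2 [← Real.rpow_one t]
    rw [← Real.rpow_add ht0, ← Real.rpow_add ht0]
    congr 1
    ring
  have e3 : (m * C + C / t) * (K * m ^ (-q)) =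
      (c * C + C) * (K * c ^ (-q)) * t ^ (q - a) * t ^ (a - 1) := by
    rw [e1, e2, hm]
    field_simp
  rw [e3]
  have h4 : 0 ≤ c ^ (-q) := Real.rpow_nonneg hc0.le _
  have h5 : 0 ≤ t ^ (a - 1) := Real.rpow_nonneg ht0.le _
  have h6 : 0 ≤ q - a := by linarith
  gcongr

/-- For `t > 0`, `T t = R(z, A) (z - A₀) T t`, and `(z - A₀) T t = z T t - D t` is bounded. -/
theorem isCompactOperator_semigroup [CompleteSpace H] {z : ℂ}
    {T D : ℝ → domClosure A →L[ℂ] domClosure A}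
    (hP : IsLinearProblem T D (domIncl A) (resolventInto A z) z)
    (hcomp : IsCompactOperator (resolvent A z)) {t : ℝ} (ht : 0 < t) :
    IsCompactOperator (T t) := by
  have h1 : IsCompactOperator (resolventInto A z) :=
    hcomp.codRestrict (resolvent_mem_domClosure A z) A.domain.isClosed_topologicalClosure
  have h2 := (h1.comp_clm (domIncl A)).comp_clm (z • T t - D t)
  convert! h2 using 1
  funext x
  change T t x = resolventInto A z (domIncl A (z • T t x - D t x))
  rw [map_sub, map_sub, map_smul, map_smul, hP.deriv_apply ht, hP.commute_apply ht.le, map_sub,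
    map_smul]
  abel

theorem isIntegratedSolution_iff [CompleteSpace H] {z : ℂ} (hz : z ∈ resolventSet A)
    {G : domClosure A → H} {w : ℝ → H} {ξ : domClosure A} {X : ℝ → domClosure A} :
    IsIntegratedSolution A G w ξ X ↔ IsMild (domIncl A) (resolventInto A z) z X
      (fun t => (ξ : H) + (∫ s in (0 : ℝ)..t, G (X s)) + w t) := by
  refine and_congr_right fun hX => forall₂_congr fun t ht => ?_
  have hint : ∫ s in (0 : ℝ)..t, (X s : H) = domIncl A (∫ s in (0 : ℝ)..t, X s) :=
    (domIncl A).intervalIntegral_comp_comm (intervalIntegrable_of_continuousOn_Ici hX ht)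
  have h1 := (isResolvent_resolvent hz).eq_iff (domIncl A (∫ s in (0 : ℝ)..t, X s))
    (domIncl A (X t) - ((ξ : H) + (∫ s in (0 : ℝ)..t, G (X s)) + w t))
  have h2 : (∫ s in (0 : ℝ)..t, X s = resolventInto A z (z • domIncl A (∫ s in (0 : ℝ)..t, X s) -
      (domIncl A (X t) - ((ξ : H) + (∫ s in (0 : ℝ)..t, G (X s)) + w t)))) ↔
      resolvent A z (z • domIncl A (∫ s in (0 : ℝ)..t, X s) -
      (domIncl A (X t) - ((ξ : H) + (∫ s in (0 : ℝ)..t, G (X s)) + w t))) =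
      domIncl A (∫ s in (0 : ℝ)..t, X s) :=
    ⟨fun h => (congrArg Subtype.val h).symm, fun h => Subtype.ext h.symm⟩
  rw [h2, ← h1]
  rw [hint]
  refine exists_congr fun h => ?_
  rw [eq_sub_iff_add_eq, eq_comm]
  have e : (ξ : H) + A ⟨domIncl A (∫ s in (0 : ℝ)..t, X s), h⟩ + (∫ s in (0 : ℝ)..t, G (X s)) + w t =
      A ⟨domIncl A (∫ s in (0 : ℝ)..t, X s), h⟩ + ((ξ : H) + (∫ s in (0 : ℝ)..t, G (X s)) + w t) := by
    abel
  rw [e]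
  rfl

end Operator

/-! ### The pathwise flow of the semilinear equation -/

section Flow

variable {H : Type*} [NormedAddCommGroup H] [NormedSpace ℂ H] [CompleteSpace H] {A : H →ₗ.[ℂ] H}
  {T D : ℝ → domClosure A →L[ℂ] domClosure A} {z : ℂ} {a : ℝ}

/-- The orbit of `ξ`, the path `Y` and the convolution are mild for the three forcing terms, so
their sum is mild for the full forcing. Uniqueness for the linear problem identifies it with `X`. -/
theorem isIntegratedSolution_iff_volterra (hz : z ∈ resolventSet A)
    (hP : IsLinearProblem T D (domIncl A) (resolventInto A z) z)
    (hU : IsSingularKernel (mildKernel T D (resolventInto A z) z) a) {w : ℝ → H}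
    {Y : ℝ → domClosure A} (hY : IsMild (domIncl A) (resolventInto A z) z Y w)
    {G : domClosure A → H} (hG : Continuous G) {ξ : domClosure A} {X : ℝ → domClosure A} :
    IsIntegratedSolution A G w ξ X ↔ ContinuousOn X (Ici 0) ∧ ∀ t : ℝ, 0 ≤ t →
      X t = T t ξ + Y t + kconv (mildKernel T D (resolventInto A z) z) (fun s => G (X s)) t := by
  rw [isIntegratedSolution_iff hz]
  have key : ∀ hX : ContinuousOn X (Ici 0), IsMild (domIncl A) (resolventInto A z) z
      (fun t => T t ξ + Y t +
        kconv (mildKernel T D (resolventInto A z) z) (fun s => G (X s)) t)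
      (fun t => domIncl A ξ + w t + ∫ s in (0 : ℝ)..t, G (X s)) := fun hX =>
    ((hP.isMild_orbit ξ).add hY).add (hP.isMild_kconv hU (hG.comp_continuousOn hX))
  constructor
  · intro h
    refine ⟨h.1, fun t ht => ?_⟩
    have h1 := (h.sub (key h.1)).congr (F' := fun _ => 0) (fun _ _ => rfl) (fun t _ => by
      simp only [Submodule.coe_subtypeL, Submodule.subtype_apply]
      abel)
    exact sub_eq_zero.1 (hP.eq_zero_of_isMild h1 ht)
  · rintro ⟨hX, h⟩
    refine (key hX).congr h fun t _ => ?_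
    simp only [Submodule.coe_subtypeL, Submodule.subtype_apply]
    abel

/-- The flow of an equation whose linear part is well posed: unique solvability, differentiability
in the initial value, the variation equation, and compactness of the derivative. -/
theorem flow_conclusion (hz : z ∈ resolventSet A)
    (hP : IsLinearProblem T D (domIncl A) (resolventInto A z) z)
    (hU : IsSingularKernel (mildKernel T D (resolventInto A z) z) a)
    (hcomp : IsCompactOperator (resolvent A z))
    (hev : ∀ᶠ l : ℝ in atTop, (l : ℂ) ∈ resolventSet A ∧
      IsGeneratedThrough T D l (resolventInto A l ∘L domIncl A))
    (hlim : ∀ x, Tendsto (fun r : ℝ => (r : ℂ) • resolvent (part A) r x) atTop (𝓝 x))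
    {w : ℝ → H} {Y : ℝ → domClosure A} (hY : IsMild (domIncl A) (resolventInto A z) z Y w)
    {G : domClosure A → H} {K : NNReal} (hGlip : LipschitzWith K G) (hG : ContDiff ℝ 1 G) :
    (∀ ξ, ExistsUniqueIntegratedSolution A G w ξ) ∧
      ∀ φ : ℝ → domClosure A → domClosure A, φ = solutionMap A G w →
        (∀ t : ℝ, 0 ≤ t → ∀ ξ, DifferentiableAt ℝ (φ t) ξ) ∧
        ∀ t : ℝ, 0 < t → ∀ ξ,
          (∀ η : domClosure A,
            (∀ l : ℝ, IntervalIntegrable (fun s =>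
              T (t - s) ((l : ℂ) • resolventInto A (l : ℂ)
                (fderiv ℝ G (φ s ξ) (fderiv ℝ (φ s) ξ η)))) volume 0 t) ∧
            Tendsto (fun l : ℝ => T t η + ∫ s in (0 : ℝ)..t,
              T (t - s) ((l : ℂ) • resolventInto A (l : ℂ)
                (fderiv ℝ G (φ s ξ) (fderiv ℝ (φ s) ξ η)))) atTop
              (𝓝 (fderiv ℝ (φ t) ξ η))) ∧
          IsCompactOperator (fderiv ℝ (φ t) ξ) := by
  have hT := hP.semigroup
  have hGc := hG.continuous
  have hGL : ∀ x y, ‖G x - G y‖ ≤ K * ‖x - y‖ := fun x y => hGlip.norm_sub_le x y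
  have hDG : ∀ x, ‖fderiv ℝ G x‖ ≤ K := fun x => norm_fderiv_le_of_lipschitz ℝ hGlip
  have hDGc : Continuous (fderiv ℝ G) := hG.continuous_fderiv one_ne_zero
  have hgc : ∀ X : ℝ → domClosure A, ContinuousOn X (Ici 0) →
      ContinuousOn (fun s => G (X s)) (Ici 0) := fun X hX => hGc.comp_continuousOn hX
  choose X hXc hX using fun ξ => hU.exists_solution (g := fun _ => G) K.2 hgc
    (fun _ _ => hGL) (x₀ := fun t => T t ξ + Y t) ((hT.continuousOn ξ).add hY.1)
  have hsol : ∀ ξ, IsIntegratedSolution A G w ξ (X ξ) := fun ξ =>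
    (isIntegratedSolution_iff_volterra hz hP hU hY hGc).2 ⟨hXc ξ, hX ξ⟩
  have huniq : ∀ ξ X', IsIntegratedSolution A G w ξ X' → EqOn X' (X ξ) (Ici 0) := by
    intro ξ X' h'
    obtain ⟨h1, h2⟩ := (isIntegratedSolution_iff_volterra hz hP hU hY hGc).1 h'
    exact hU.solution_unique (g := fun _ => G) K.2 hgc (fun _ _ => hGL) (hXc ξ) h1 (hX ξ) h2
  refine ⟨fun ξ => ⟨X ξ, hsol ξ, huniq ξ⟩, fun φ hφ => ?_⟩
  -- Whichever solution the choice operator picks, uniqueness fixes its values at nonnegative times.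
  have hφX : ∀ t : ℝ, 0 ≤ t → φ t = fun ξ => X ξ t := by
    intro t ht
    funext ξ
    rw [hφ]
    exact huniq ξ _ (Classical.epsilon_spec (p := fun X => IsIntegratedSolution A G w ξ X)
      ⟨X ξ, hsol ξ⟩) ht
  set Tr : ℝ → domClosure A →L[ℝ] domClosure A := fun t => (T t).restrictScalars ℝ with hTr
  have hTrb : ∀ N : ℝ, ∃ C : ℝ, 0 ≤ C ∧ ∀ t ∈ Icc 0 N, ‖Tr t‖ ≤ C := by
    intro N
    obtain ⟨C, hC, hb⟩ := hT.bound_Icc N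
    refine ⟨C, hC, fun t ht => ?_⟩
    rw [hTr, ContinuousLinearMap.norm_restrictScalars]
    exact hb t ht
  have hBc : ∀ ξ, ContinuousOn (fun s => fderiv ℝ G (X ξ s)) (Ici 0) := fun ξ =>
    hDGc.comp_continuousOn (hXc ξ)
  choose V hVc hVb hV using fun ξ => hU.exists_linear_flow (T := Tr) hTrb hT.continuousOn
    (B := fun s => fderiv ℝ G (X ξ s)) K.2 (hBc ξ) (fun s _ => hDG _)
  have hder : ∀ t : ℝ, 0 ≤ t → ∀ ξ, HasFDerivAt (φ t) (V ξ t) ξ := by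
    intro t ht ξ
    rw [hφX t ht]
    exact hU.hasFDerivAt_flow hTrb hG K.2 hGL hXc hX ξ (hVc ξ) (hV ξ) ht
  refine ⟨fun t ht ξ => (hder t ht ξ).differentiableAt, fun t ht ξ => ⟨fun η => ?_, ?_⟩⟩
  · set f : ℝ → H := fun s => fderiv ℝ G (X ξ s) (V ξ s η) with hf
    have hfc : ContinuousOn f (Ici 0) := (hBc ξ).clm_apply (hVc ξ η)
    have hφf : ∀ s : ℝ, 0 ≤ s → fderiv ℝ G (φ s ξ) (fderiv ℝ (φ s) ξ η) = f s := by
      intro s hs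
      rw [(hder s hs ξ).fderiv, hφX s hs]
    have hcongr : ∀ l : ℝ, EqOn (fun s => T (t - s) ((l : ℂ) • resolventInto A (l : ℂ)
          (fderiv ℝ G (φ s ξ) (fderiv ℝ (φ s) ξ η))))
        (fun s => T (t - s) ((l : ℂ) • resolventInto A (l : ℂ) (f s))) (uIcc 0 t) := by
      intro l s hs
      rw [uIcc_of_le ht.le] at hs
      simp only [hφf s hs.1]
    constructor
    · intro l
      refine IntervalIntegrable.congr (f := fun s => T (max (t - s) 0) ((l : ℂ) •
        resolventInto A (l : ℂ) (f s))) (fun s hs => ?_) (ContinuousOn.intervalIntegrable ?_)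
      · have hs' := uIoc_subset_uIcc hs
        refine Eq.trans ?_ (hcongr l hs').symm
        rw [uIcc_of_le ht.le] at hs'
        simp only [max_eq_left (sub_nonneg.2 hs'.2)]
      · rw [uIcc_of_le ht.le]
        refine hT.continuous_uncurry.comp_continuousOn (ContinuousOn.prodMk (by fun_prop) ?_)
        have hc := ((resolventInto A (l : ℂ)).continuous.comp_continuousOn hfc).mono
          (Icc_subset_Ici_self : Icc 0 t ⊆ Ici 0)
        exact ContinuousOn.const_smul hc (l : ℂ)
    · have hfd : fderiv ℝ (φ t) ξ η = T t η +
          kconv (mildKernel T D (resolventInto A z) z) f t := by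
        rw [(hder t ht.le ξ).fderiv, hV ξ t ht.le]
        rfl
      rw [hfd]
      refine Tendsto.const_add _ ?_
      -- The approximants are `l R(l, A₀)` applied to the fixed convolution: passing to the kernel
      -- with parameter `l`, `R(l, A₀) U(t - s) = T(t - s) R(l, A)` under the integral.
      refine (hlim (kconv (mildKernel T D (resolventInto A z) z) f t)).congr' ?_
      filter_upwards [hev] with l hl
      have hPl := isLinearProblem hl.1 hT hl.2
      rw [intervalIntegral.integral_congr (hcongr l),
        (isResolvent_resolvent ⟨_, IsResolvent.part hl.1⟩).unique (IsResolvent.part hl.1)]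
      have h1 := (((l : ℂ) • (resolventInto A (l : ℂ) ∘L domIncl A)).restrictScalars
        ℝ).intervalIntegral_comp_comm (hU.integrableOn_kconv ht.le
          (hfc.mono Icc_subset_Ici_self))
      refine h1.symm.trans (intervalIntegral.integral_congr_ae ?_)
      have hne : ∀ᵐ s : ℝ, s ≠ t := by
        rw [ae_iff]
        simp
      filter_upwards [hne] with s hs1 hs2
      rw [uIoc_of_le ht.le] at hs2
      have hts : 0 < t - s := sub_pos.2 (lt_of_le_of_ne hs2.2 hs1)
      rw [IsLinearProblem.mildKernel_eq hPl (fun x => resolventInto_sub hz hl.1 x) hts, map_smul]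
      exact congrArg ((l : ℂ) • ·) (hPl.resolvent_mildKernel hts (f s))
  · rw [(hder t ht.le ξ).fderiv]
    refine hU.isCompactOperator_flow (T := Tr) (fun s t hs ht x => ?_) (fun s t hs ht x => ?_)
      (fun t ht => isCompactOperator_semigroup hP hcomp ht) K.2 (hBc ξ) (fun s _ => hDG _) (hVc ξ)
      (hVb ξ) (hV ξ) ht
    · exact congrArg (fun L : domClosure A →L[ℂ] domClosure A => L x) (hT.add s t hs ht)
    · exact hP.mildKernel_add hs ht x

end Flow

/-! ### Kernel derivative and the interpolation estimate -/

section HolderPath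

variable {H E : Type*} [NormedAddCommGroup H] [NormedSpace ℂ H] [NormedAddCommGroup E]
  [NormedSpace ℂ E] {T D : ℝ → E →L[ℂ] E} {ι : E →L[ℂ] H} {J : H →L[ℂ] E} {l : ℂ}

theorem IsMild.of_tendsto [CompleteSpace E] {v : ℕ → ℝ → E} {F : ℕ → ℝ → H} {v' : ℝ → E}
    {F' : ℝ → H} (h : ∀ n, IsMild ι J l (v n) (F n))
    (hv : ∀ N : ℝ, 0 ≤ N → TendstoUniformlyOn v v' atTop (Icc 0 N))
    (hF : ∀ t : ℝ, 0 ≤ t → Tendsto (fun n => F n t) atTop (𝓝 (F' t))) : IsMild ι J l v' F' := by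
  have hc : ContinuousOn v' (Ici 0) := continuousOn_Ici_of_forall_Icc fun N hN =>
    (hv N hN).continuousOn (Frequently.of_forall fun n => (h n).1.mono Icc_subset_Ici_self)
  refine ⟨hc, fun t ht => ?_⟩
  have hint : Tendsto (fun n => ∫ s in (0 : ℝ)..t, v n s) atTop (𝓝 (∫ s in (0 : ℝ)..t, v' s)) := by
    rw [Metric.tendsto_nhds]
    intro ε hε
    have hε' : 0 < ε / (t + 1) := by positivity
    filter_upwards [Metric.tendstoUniformlyOn_iff.1 (hv t ht) _ hε'] with n hn
    rw [dist_eq_norm, ← intervalIntegral.integral_sub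
      (intervalIntegrable_of_continuousOn_Ici (h n).1 ht)
      (intervalIntegrable_of_continuousOn_Ici hc ht)]
    have hb := intervalIntegral.norm_integral_le_of_norm_le_const (a := 0) (b := t)
      (f := fun s => v n s - v' s) (C := ε / (t + 1)) (fun s hs => by
        rw [uIoc_of_le ht] at hs
        have := hn s ⟨hs.1.le, hs.2⟩
        rw [dist_comm, dist_eq_norm] at this
        exact this.le)
    rw [sub_zero, abs_of_nonneg ht] at hb
    refine hb.trans_lt ?_
    rw [div_mul_eq_mul_div, div_lt_iff₀ (by positivity)]
    nlinarith
  have hvt : Tendsto (fun n => v n t) atTop (𝓝 (v' t)) := (hv t ht).tendsto_at ⟨ht, le_rfl⟩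
  refine tendsto_nhds_unique hint ?_
  have hlim := (J.continuous.tendsto _).comp
    ((((ι.continuous.tendsto _).comp hint).const_smul l).sub
      (((ι.continuous.tendsto _).comp hvt).sub (hF t ht)))
  exact hlim.congr fun n => ((h n).2 t ht).symm

namespace IsLinearProblem

theorem deriv_add (h : IsLinearProblem T D ι J l) {s t : ℝ} (hs : 0 ≤ s) (ht : 0 < t) :
    D (s + t) = T s ∘L D t := by
  ext x
  refine h.eq_of_resolvent_eq ?_
  rw [h.deriv_apply (by linarith), ContinuousLinearMap.comp_apply, h.commute_apply hs,
    h.deriv_apply ht, h.semigroup.add s t hs ht.le]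
  rfl

theorem continuousAt_deriv (h : IsLinearProblem T D ι J l) {t : ℝ} (ht : 0 < t) :
    ContinuousAt D t := by
  have h1 : ContinuousAt (fun r => T (r - t / 2) ∘L D (t / 2)) t := by
    refine ContinuousAt.clm_comp ?_ continuousAt_const
    refine ContinuousAt.comp (f := fun r => r - t / 2) (g := T) ?_ (by fun_prop)
    have : t - t / 2 = t / 2 := by ring
    rw [this]
    exact (h.semigroup.hasDerivAt _ (half_pos ht)).continuousAt
  refine h1.congr ?_
  filter_upwards [Ioi_mem_nhds (half_lt_self ht)] with r hr
  rw [← h.deriv_add (sub_nonneg.2 (le_of_lt hr)) (half_pos ht), sub_add_cancel]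

/-- The derivative of the kernel. -/
noncomputable def kernelDeriv (T D : ℝ → E →L[ℂ] E) (J : H →L[ℂ] E) (l : ℂ) (t : ℝ) : H →L[ℝ] E :=
  (D (t / 2)).restrictScalars ℝ ∘L mildKernel T D J l (t / 2)

theorem continuousAt_kernelDeriv (h : IsLinearProblem T D ι J l) {t : ℝ} (ht : 0 < t) :
    ContinuousAt (kernelDeriv T D J l) t := by
  have h1 : ContinuousAt (fun t => D (t / 2)) t :=
    ContinuousAt.comp (f := fun t => t / 2) (h.continuousAt_deriv (half_pos ht)) (by fun_prop)
  have h2 : ContinuousAt (fun t => (D (t / 2)).restrictScalars ℝ) t :=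
    (ContinuousLinearMap.restrictScalarsL ℂ E E ℝ ℝ).continuous.continuousAt.comp h1
  refine h2.clm_comp ?_
  exact ContinuousAt.comp (f := fun t => t / 2)
    (h.hasDerivAt_mildKernel (half_pos ht)).continuousAt (by fun_prop)

/-- Splitting the time in half, `D(t/2)` contributes `1 / t` and `U(t/2)` contributes `t ^ (a - 1)`.
-/
theorem exists_kernelDeriv_bound (h : IsLinearProblem T D ι J l) {a : ℝ}
    (hU : IsSingularKernel (mildKernel T D J l) a) (N : ℝ) :
    ∃ C : ℝ, 0 ≤ C ∧ ∀ t ∈ Ioc 0 N, ‖kernelDeriv T D J l t‖ ≤ C * t ^ (a - 2) := by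
  obtain ⟨C₁, hC₁, hb₁⟩ := h.semigroup.bound N
  obtain ⟨C₂, hC₂, hb₂⟩ := hU.bound N
  refine ⟨C₁ * C₂ * (1 / 2) ^ (a - 2), by positivity, fun t ht => ?_⟩
  have ht0 := ht.1
  have ht2 : t / 2 ∈ Ioc 0 N := ⟨half_pos ht.1, (half_le_self ht.1.le).trans ht.2⟩
  have h1 : ‖kernelDeriv T D J l t‖ ≤ C₁ / (t / 2) * (C₂ * (t / 2) ^ (a - 1)) := by
    refine (ContinuousLinearMap.opNorm_comp_le _ _).trans ?_
    rw [ContinuousLinearMap.norm_restrictScalars]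
    gcongr
    · exact (hb₁ _ ht2).2
    · exact hb₂ _ ht2
  refine h1.trans (le_of_eq ?_)
  have e1 : (1 / 2 : ℝ) ^ (a - 2) * t ^ (a - 2) = (t / 2) ^ (a - 2) := by
    rw [← Real.mul_rpow (by norm_num) ht0.le]
    congr 1
    ring
  have e2 : (t / 2) ^ (a - 1) = (t / 2) ^ (a - 2) * (t / 2) := by
    have : a - 1 = (a - 2) + 1 := by ring
    rw [this, Real.rpow_add (half_pos ht0), Real.rpow_one]
  rw [mul_assoc (C₁ * C₂), e1, e2]
  field_simp

/-- The convolution is cut at `t - δ`. Near `t` the size `M₁` of `d` costs `δ ^ a`. Away from `t`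
integration by parts moves the derivative to the kernel, and the primitive, of size `M₀`, costs `δ ^
(a - 1)`; the integral of `r ^ (a - 2)` is controlled at `δ` because `a < 1`. -/
theorem exists_interpolation_bound [CompleteSpace E] [CompleteSpace H]
    (h : IsLinearProblem T D ι J l) {a : ℝ}
    (ha : a < 1) (hU : IsSingularKernel (mildKernel T D J l) a) (N : ℝ) :
    ∃ C : ℝ, 0 ≤ C ∧ ∀ (d : ℝ → H) (M₀ M₁ δ : ℝ), Continuous d → 0 < δ → 0 ≤ M₀ → 0 ≤ M₁ →
      (∀ t ∈ Icc 0 N, ‖d t‖ ≤ M₁) → (∀ t ∈ Icc 0 N, ‖∫ s in (0 : ℝ)..t, d s‖ ≤ M₀) →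
      ∀ t ∈ Icc 0 N, ‖kconv (mildKernel T D J l) d t‖ ≤ C * (δ ^ a * M₁ + δ ^ (a - 1) * M₀) := by
  obtain ⟨C₁, hC₁, hb₁⟩ := hU.bound N
  obtain ⟨C₂, hC₂, hb₂⟩ := h.exists_kernelDeriv_bound hU N
  have ha0 := hU.pos
  have ha1 : 0 < 1 - a := by linarith
  refine ⟨C₁ / a + C₁ + C₂ / (1 - a), by positivity, fun d M₀ M₁ δ hd hδ hM₀ hM₁ hdM hPM t ht => ?_⟩
  have hδa : 0 < δ ^ a := Real.rpow_pos_of_pos hδ _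
  have hδa' : 0 < δ ^ (a - 1) := Real.rpow_pos_of_pos hδ _
  have hb₁' : ∀ r ∈ Ioc 0 t, ‖mildKernel T D J l r‖ ≤ C₁ * r ^ (a - 1) := fun r hr =>
    hb₁ r ⟨hr.1, hr.2.trans ht.2⟩
  have hX : 0 ≤ δ ^ a * M₁ := by positivity
  have hY : 0 ≤ δ ^ (a - 1) * M₀ := by positivity
  have hfin : ∀ x : ℝ, x ≤ C₁ / a * (δ ^ a * M₁) + (C₁ + C₂ / (1 - a)) * (δ ^ (a - 1) * M₀) →
      x ≤ (C₁ / a + C₁ + C₂ / (1 - a)) * (δ ^ a * M₁ + δ ^ (a - 1) * M₀) := by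
    intro x hx
    have h1 : 0 ≤ (C₁ + C₂ / (1 - a)) * (δ ^ a * M₁) := by positivity
    have h2 : 0 ≤ C₁ / a * (δ ^ (a - 1) * M₀) := by positivity
    nlinarith
  refine hfin _ ?_
  have hY' : 0 ≤ (C₁ + C₂ / (1 - a)) * (δ ^ (a - 1) * M₀) := by positivity
  -- If `t ≤ δ` there is no far part and the direct estimate suffices.
  rcases le_or_gt t δ with htδ | htδ
  · have h1 := IsSingularKernel.norm_integral_kconv_le (U := mildKernel T D J l) (f := d) (b := 0) (t := t) ht.1 ha0
      (C := C₁) (F := M₁) (by rwa [sub_zero]) (fun s hs => hdM s ⟨hs.1, hs.2.trans ht.2⟩)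
    rw [sub_zero] at h1
    refine h1.trans (le_trans ?_ (le_add_of_nonneg_right hY'))
    have h2 : t ^ a ≤ δ ^ a := Real.rpow_le_rpow ht.1 htδ ha0.le
    calc C₁ * M₁ * (t ^ a / a) ≤ C₁ * M₁ * (δ ^ a / a) := by gcongr
      _ = C₁ / a * (δ ^ a * M₁) := by ring
  set P : ℝ → H := fun t => ∫ s in (0 : ℝ)..t, d s with hP
  have hPd : ∀ s, HasDerivAt P (d s) s := fun s =>
    intervalIntegral.integral_hasDerivAt_right (hd.intervalIntegrable _ _)
      (hd.stronglyMeasurableAtFilter _ _) hd.continuousAt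
  have hPc : Continuous P := continuous_iff_continuousAt.2 fun s => (hPd s).continuousAt
  have htd : 0 ≤ t - δ := by linarith
  have hint := hU.integrableOn_kconv ht.1 (hd.continuousOn (s := Icc 0 t))
  have hmem : t - δ ∈ uIcc 0 t := by
    rw [uIcc_of_le ht.1]
    exact ⟨htd, by linarith⟩
  have hpos : ∀ s ∈ Icc 0 (t - δ), 0 < t - s := fun s hs => by linarith [hs.2]
  have hder : ∀ s ∈ Icc 0 (t - δ), HasDerivAt (fun s => mildKernel T D J l (t - s) (P s))
      (-kernelDeriv T D J l (t - s) (P s) + mildKernel T D J l (t - s) (d s)) s := by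
    intro s hs
    have h1 : HasDerivAt (fun s => mildKernel T D J l (t - s)) (-kernelDeriv T D J l (t - s)) s :=
      HasDerivAt.comp_const_sub t s (h.hasDerivAt_mildKernel (hpos s hs))
    exact h1.clm_apply (hPd s)
  have hKc : ContinuousOn (fun s => kernelDeriv T D J l (t - s) (P s)) (Icc 0 (t - δ)) := by
    intro s hs
    refine ContinuousAt.continuousWithinAt (ContinuousAt.clm_apply ?_ hPc.continuousAt)
    exact ContinuousAt.comp (f := fun s => t - s) (h.continuousAt_kernelDeriv (hpos s hs))
      (by fun_prop)
  have hKi : IntervalIntegrable (fun s => kernelDeriv T D J l (t - s) (P s)) volume 0 (t - δ) :=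
    (hKc.mono (by rw [uIcc_of_le htd])).intervalIntegrable
  have hUi := hint.mono_set (uIcc_subset_uIcc_left hmem)
  have hftc := intervalIntegral.integral_eq_sub_of_hasDerivAt
    (f := fun s => mildKernel T D J l (t - s) (P s)) (a := 0) (b := t - δ)
    (fun s hs => hder s (by rwa [uIcc_of_le htd] at hs)) (hKi.neg.add hUi)
  have hP0 : P 0 = 0 := by simp [hP]
  have hsplit : kconv (mildKernel T D J l) d t = mildKernel T D J l δ (P (t - δ)) +
      (∫ s in (0 : ℝ)..(t - δ), kernelDeriv T D J l (t - s) (P s)) +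
      ∫ s in (t - δ)..t, mildKernel T D J l (t - s) (d s) := by
    rw [kconv, ← intervalIntegral.integral_add_adjacent_intervals hUi
      (hint.mono_set (uIcc_subset_uIcc_right hmem))]
    congr 1
    rw [intervalIntegral.integral_add (f := fun s => -kernelDeriv T D J l (t - s) (P s)) hKi.neg hUi,
      intervalIntegral.integral_neg, sub_sub_cancel, hP0, map_zero, sub_zero] at hftc
    rw [← hftc]
    abel
  have hA : ‖mildKernel T D J l δ (P (t - δ))‖ ≤ C₁ * (δ ^ (a - 1) * M₀) := by
    rw [← mul_assoc]
    exact ContinuousLinearMap.le_of_opNorm_le_of_le _ (hb₁' δ ⟨hδ, htδ.le⟩)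
      (hPM _ ⟨htd, by linarith [ht.2]⟩)
  have hB : ‖∫ s in (0 : ℝ)..(t - δ), kernelDeriv T D J l (t - s) (P s)‖ ≤
      C₂ / (1 - a) * (δ ^ (a - 1) * M₀) := by
    have hzero : (0 : ℝ) ∉ uIcc δ t := by
      rw [uIcc_of_le htδ.le]
      exact fun h => absurd h.1 (not_le.2 hδ)
    have hri : IntervalIntegrable (fun s => (t - s) ^ (a - 2)) volume 0 (t - δ) := by
      have := (intervalIntegral.intervalIntegrable_rpow (μ := volume) (r := a - 2)
        (Or.inr hzero)).comp_sub_left t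
      rw [sub_self] at this
      exact this.symm
    have h1 : ‖∫ s in (0 : ℝ)..(t - δ), kernelDeriv T D J l (t - s) (P s)‖ ≤
        ∫ s in (0 : ℝ)..(t - δ), C₂ * M₀ * (t - s) ^ (a - 2) := by
      refine intervalIntegral.norm_integral_le_of_norm_le htd (ae_of_all _ fun s hs => ?_)
        (hri.const_mul _)
      refine (ContinuousLinearMap.le_of_opNorm_le_of_le _ (hb₂ (t - s) ⟨?_, ?_⟩)
        (hPM s ⟨hs.1.le, ?_⟩)).trans (le_of_eq (by ring))
      · linarith [hs.2]
      · linarith [hs.1, ht.2]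
      · linarith [hs.2, ht.2]
    refine h1.trans ?_
    rw [intervalIntegral.integral_const_mul,
      intervalIntegral.integral_comp_sub_left (fun r => r ^ (a - 2)) t, sub_sub_cancel, sub_zero,
      integral_rpow (Or.inr ⟨by linarith, hzero⟩)]
    have e : a - 2 + 1 = a - 1 := by ring
    rw [e]
    have h2 : (t ^ (a - 1) - δ ^ (a - 1)) / (a - 1) ≤ δ ^ (a - 1) / (1 - a) := by
      have h3 : (t ^ (a - 1) - δ ^ (a - 1)) / (a - 1) = (δ ^ (a - 1) - t ^ (a - 1)) / (1 - a) := by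
        rw [← neg_sub (1 : ℝ) a, div_neg, ← neg_div, neg_sub]
      rw [h3]
      gcongr
      linarith [Real.rpow_nonneg ht.1 (a - 1)]
    calc C₂ * M₀ * ((t ^ (a - 1) - δ ^ (a - 1)) / (a - 1)) ≤ C₂ * M₀ * (δ ^ (a - 1) / (1 - a)) := by
          gcongr
      _ = C₂ / (1 - a) * (δ ^ (a - 1) * M₀) := by ring
  have hC : ‖∫ s in (t - δ)..t, mildKernel T D J l (t - s) (d s)‖ ≤ C₁ / a * (δ ^ a * M₁) := by
    have h1 := IsSingularKernel.norm_integral_kconv_le (U := mildKernel T D J l) (f := d) (b := t - δ) (t := t)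
      (by linarith) ha0 (C := C₁) (F := M₁) (fun r hr => hb₁' r ⟨hr.1, by linarith [hr.2]⟩)
      (fun s hs => hdM s ⟨htd.trans hs.1, hs.2.trans ht.2⟩)
    rw [sub_sub_cancel] at h1
    exact h1.trans (le_of_eq (by ring))
  rw [hsplit]
  refine (norm_add_le _ _).trans ((add_le_add ((norm_add_le _ _).trans (add_le_add hA hB)) hC).trans
    (le_of_eq (by ring)))

end IsLinearProblem

end HolderPath

/-! ### Linear problem driven by a Hölder path -/

section ForcingByPath

variable {H E : Type*} [NormedAddCommGroup H] [NormedSpace ℂ H] [NormedAddCommGroup E]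
  [NormedSpace ℂ E]

/-- `W` has modulus of continuity `C ρ ^ n` at the scale `2 ^ (-n)` on bounded intervals. -/
def HasDyadicModulus (W : ℝ → H) (ρ : ℝ) : Prop :=
  ∀ N : ℝ, ∃ C : ℝ, 0 ≤ C ∧ ∀ (n : ℕ) (s t : ℝ), 0 ≤ s → s ≤ t → t ≤ N → t - s ≤ (1 / 2) ^ n →
    ‖W t - W s‖ ≤ C * ρ ^ n

/-- The difference quotient of `W` at the scale `2 ^ (-n)`. -/
noncomputable def diffQuot (W : ℝ → H) (n : ℕ) (t : ℝ) : H :=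
  (2 : ℝ) ^ n • (W (t + (1 / 2) ^ n) - W t)

theorem continuous_diffQuot {W : ℝ → H} (hW : Continuous W) (n : ℕ) : Continuous (diffQuot W n) := by
  unfold diffQuot
  fun_prop

theorem two_pow_mul_half_pow (n : ℕ) : (2 : ℝ) ^ n * (1 / 2) ^ n = 1 := by
  rw [← mul_pow]
  norm_num

theorem norm_smul_integral_sub_le [CompleteSpace H] {W : ℝ → H} (hW : Continuous W) {ρ C N : ℝ}
    (hC : ∀ (n : ℕ) (s t : ℝ), 0 ≤ s → s ≤ t → t ≤ N → t - s ≤ (1 / 2) ^ n →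
      ‖W t - W s‖ ≤ C * ρ ^ n) (n : ℕ) {t : ℝ} (ht : 0 ≤ t) (htN : t + (1 / 2) ^ n ≤ N) :
    ‖(2 : ℝ) ^ n • (∫ s in t..(t + (1 / 2) ^ n), W s) - W t‖ ≤ C * ρ ^ n := by
  have hh : (0 : ℝ) < (1 / 2) ^ n := by positivity
  have h1 : (2 : ℝ) ^ n • (∫ s in t..(t + (1 / 2) ^ n), W s) - W t =
      (2 : ℝ) ^ n • ∫ s in t..(t + (1 / 2) ^ n), (W s - W t) := by
    rw [intervalIntegral.integral_sub (hW.intervalIntegrable _ _) (by simp),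
      intervalIntegral.integral_const, add_sub_cancel_left, smul_sub, smul_smul,
      two_pow_mul_half_pow, one_smul]
  have h2 := intervalIntegral.norm_integral_le_of_norm_le_const (a := t) (b := t + (1 / 2) ^ n)
    (f := fun s => W s - W t) (C := C * ρ ^ n) (fun s hs => by
      rw [uIoc_of_le (by linarith)] at hs
      exact hC n t s ht hs.1.le (hs.2.trans htN) (by linarith [hs.2]))
  rw [add_sub_cancel_left, abs_of_pos hh] at h2
  rw [h1, norm_smul, Real.norm_of_nonneg (by positivity)]
  calc (2 : ℝ) ^ n * ‖∫ s in t..(t + (1 / 2) ^ n), (W s - W t)‖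
      ≤ (2 : ℝ) ^ n * (C * ρ ^ n * (1 / 2) ^ n) := by gcongr
    _ = C * ρ ^ n * (2 ^ n * (1 / 2) ^ n) := by ring
    _ = C * ρ ^ n := by rw [two_pow_mul_half_pow, mul_one]

/-- The integral is the mean of `W` over `[t, t + 2⁻ⁿ]` minus its mean over `[0, 2⁻ⁿ]`; these are
within the modulus of `W t` and of `W 0 = 0`. -/
theorem norm_integral_diffQuot_sub_le [CompleteSpace H] {W : ℝ → H} (hW : Continuous W)
    (hW0 : W 0 = 0) {ρ C N : ℝ}
    (hC : ∀ (n : ℕ) (s t : ℝ), 0 ≤ s → s ≤ t → t ≤ N → t - s ≤ (1 / 2) ^ n →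
      ‖W t - W s‖ ≤ C * ρ ^ n) (n : ℕ) {t : ℝ} (ht : 0 ≤ t) (htN : t + (1 / 2) ^ n ≤ N) :
    ‖(∫ s in (0 : ℝ)..t, diffQuot W n s) - W t‖ ≤ 2 * C * ρ ^ n := by
  have hi : ∀ a b, IntervalIntegrable W volume a b := fun a b => hW.intervalIntegrable a b
  have h1 := norm_smul_integral_sub_le hW hC n ht htN
  have h2 := norm_smul_integral_sub_le hW hC n le_rfl (by linarith : (0 : ℝ) + (1 / 2) ^ n ≤ N)
  have h3 : (∫ s in (0 : ℝ)..t, diffQuot W n s) =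
      (2 : ℝ) ^ n • (∫ s in t..(t + (1 / 2) ^ n), W s) -
        (2 : ℝ) ^ n • ∫ s in (0 : ℝ)..(0 + (1 / 2) ^ n), W s := by
    have hsh : Continuous fun s => W (s + (1 / 2) ^ n) := by fun_prop
    unfold diffQuot
    rw [intervalIntegral.integral_smul, intervalIntegral.integral_sub (hsh.intervalIntegrable _ _)
      (hi _ _), intervalIntegral.integral_comp_add_right (fun s => W s), ← smul_sub,
      intervalIntegral.integral_interval_sub_interval_comm (hi _ _) (hi _ _) (hi _ _),
      intervalIntegral.integral_symm 0 (0 + (1 / 2) ^ n),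
      intervalIntegral.integral_symm t (t + (1 / 2) ^ n)]
    congr 1
    abel
  rw [h3, sub_right_comm]
  rw [hW0, sub_zero] at h2
  exact (norm_sub_le _ _).trans ((add_le_add h1 h2).trans (le_of_eq (by ring)))

theorem norm_diffQuot_le {W : ℝ → H} {ρ C N : ℝ}
    (hC : ∀ (n : ℕ) (s t : ℝ), 0 ≤ s → s ≤ t → t ≤ N → t - s ≤ (1 / 2) ^ n →
      ‖W t - W s‖ ≤ C * ρ ^ n) (n : ℕ) {t : ℝ} (ht : 0 ≤ t) (htN : t + (1 / 2) ^ n ≤ N) :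
    ‖diffQuot W n t‖ ≤ 2 ^ n * (C * ρ ^ n) := by
  have hh : (0 : ℝ) < (1 / 2) ^ n := by positivity
  rw [diffQuot, norm_smul, Real.norm_of_nonneg (by positivity)]
  gcongr
  exact hC n t _ ht (by linarith) htN (by linarith)

variable {T D : ℝ → E →L[ℂ] E} {ι : E →L[ℂ] H} {J : H →L[ℂ] E} {l : ℂ}

/-- The path is replaced by primitives of its difference quotients, for which the convolution is a
mild solution. At `δ = 2⁻ⁿ`, interpolation bounds consecutive differences by a multiple of `(2 ^ (1
- a) ρ) ^ n`. If `ρ = 2 ^ (-α)`, the hypothesis says `α > 1 - a`, and mildness survives the locally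
uniform limit. -/
theorem IsLinearProblem.exists_isMild [CompleteSpace E] [CompleteSpace H]
    (h : IsLinearProblem T D ι J l) {a ρ : ℝ} (ha : a < 1)
    (hU : IsSingularKernel (mildKernel T D J l) a) (hρ0 : 0 ≤ ρ) (hρ : (1 / 2) ^ (a - 1) * ρ < 1)
    {W : ℝ → H} (hW : Continuous W) (hW0 : W 0 = 0) (hWρ : HasDyadicModulus W ρ) :
    ∃ Y : ℝ → E, IsMild ι J l Y W := by
  set κ : ℝ := (1 / 2) ^ (a - 1) * ρ with hκ
  have hκ0 : 0 ≤ κ := by positivity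
  have hρ1 : ρ < 1 := by
    refine lt_of_le_of_lt (le_mul_of_one_le_left hρ0 ?_) hρ
    exact Real.one_le_rpow_of_pos_of_le_one_of_nonpos (by norm_num) (by norm_num) (by linarith)
  set Z : ℕ → ℝ → E := fun n => kconv (mildKernel T D J l) (diffQuot W n) with hZ
  have hZm : ∀ n, IsMild ι J l (Z n) (fun t => ∫ s in (0 : ℝ)..t, diffQuot W n s) := fun n =>
    h.isMild_kconv hU (continuous_diffQuot hW n).continuousOn
  have hle1 : ∀ n : ℕ, ((1 : ℝ) / 2) ^ n ≤ 1 := fun n => pow_le_one₀ (by norm_num) (by norm_num)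
  have hgeo : ∀ N : ℝ, ∃ m : ℝ, 0 ≤ m ∧ ∀ n : ℕ, ∀ t ∈ Icc 0 N,
      dist (Z n t) (Z (n + 1) t) ≤ m * κ ^ n := by
    intro N
    -- The horizon grows by `1` because difference quotients look ahead by `2⁻ⁿ ≤ 1`.
    obtain ⟨C, hC, hb⟩ := hWρ (N + 1)
    obtain ⟨B, hB, hi⟩ := h.exists_interpolation_bound ha hU N
    refine ⟨B * (7 * C), by positivity, fun n t ht => ?_⟩
    have hN : ∀ (n : ℕ), ∀ t ∈ Icc 0 N, t + (1 / 2) ^ n ≤ N + 1 := fun n t ht =>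
      add_le_add ht.2 (hle1 n)
    have hρn : ρ ^ (n + 1) ≤ ρ ^ n := pow_le_pow_of_le_one hρ0 hρ1.le (Nat.le_succ n)
    have hd := hi (fun s => diffQuot W (n + 1) s - diffQuot W n s) (4 * C * ρ ^ n)
      (3 * (2 ^ n * (C * ρ ^ n))) ((1 / 2) ^ n)
      ((continuous_diffQuot hW _).sub (continuous_diffQuot hW _)) (by positivity) (by positivity)
      (by positivity) (fun t ht => by
        refine (norm_sub_le _ _).trans ((add_le_add (norm_diffQuot_le hb (n + 1) ht.1 (hN _ t ht))
          (norm_diffQuot_le hb n ht.1 (hN _ t ht))).trans ?_)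
        have : (2 : ℝ) ^ (n + 1) * (C * ρ ^ (n + 1)) ≤ 2 ^ (n + 1) * (C * ρ ^ n) := by gcongr
        rw [pow_succ 2 n] at this ⊢
        linarith) (fun t ht => by
        rw [intervalIntegral.integral_sub ((continuous_diffQuot hW _).intervalIntegrable _ _)
          ((continuous_diffQuot hW _).intervalIntegrable _ _), ← sub_sub_sub_cancel_right _ _ (W t)]
        refine (norm_sub_le _ _).trans ((add_le_add
          (norm_integral_diffQuot_sub_le hW hW0 hb (n + 1) ht.1 (hN _ t ht))
          (norm_integral_diffQuot_sub_le hW hW0 hb n ht.1 (hN _ t ht))).trans ?_)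
        have : 2 * C * ρ ^ (n + 1) ≤ 2 * C * ρ ^ n := by gcongr
        linarith) t ht
    rw [dist_comm, dist_eq_norm, hU.kconv_sub ht.1 (continuous_diffQuot hW _).continuousOn
      (continuous_diffQuot hW _).continuousOn]
    refine hd.trans (le_of_eq ?_)
    have e1 : (((1 : ℝ) / 2) ^ n) ^ (a - 1) = ((1 / 2) ^ (a - 1)) ^ n := by
      rw [← Real.rpow_natCast, ← Real.rpow_mul (by norm_num), mul_comm, Real.rpow_mul (by norm_num),
        Real.rpow_natCast]
    have e2 : (((1 : ℝ) / 2) ^ n) ^ a * 2 ^ n = ((1 / 2) ^ (a - 1)) ^ n := by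
      rw [← e1, Real.rpow_sub_one (by positivity), eq_div_iff (by positivity), mul_assoc,
        two_pow_mul_half_pow, mul_one]
    rw [hκ, mul_pow, e1, ← e2]
    ring
  have hlim : ∀ t : ℝ, ∃ x, 0 ≤ t → Tendsto (fun n => Z n t) atTop (𝓝 x) := by
    intro t
    by_cases ht : 0 ≤ t
    · obtain ⟨m, -, hd⟩ := hgeo t
      obtain ⟨x, hx⟩ := cauchySeq_tendsto_of_complete
        (cauchySeq_of_le_geometric κ _ hρ fun n => hd n t ⟨ht, le_rfl⟩)
      exact ⟨x, fun _ => hx⟩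
    · exact ⟨0, fun h => absurd h ht⟩
  choose Y hY using hlim
  refine ⟨Y, IsMild.of_tendsto hZm (fun N hN => ?_) (fun t ht => ?_)⟩
  · obtain ⟨m, hm, hd⟩ := hgeo N
    rw [Metric.tendstoUniformlyOn_iff]
    intro ε hε
    have h0 : Tendsto (fun n : ℕ => m * κ ^ n / (1 - κ)) atTop (𝓝 0) := by
      simpa using ((tendsto_pow_atTop_nhds_zero_of_lt_one hκ0 hρ).const_mul m).div_const (1 - κ)
    filter_upwards [h0.eventually (gt_mem_nhds hε)] with n hn t ht
    rw [dist_comm]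
    exact (dist_le_of_le_geometric_of_tendsto κ _ hρ (fun n => hd n t ht) (hY t ht.1) n).trans_lt hn
  · obtain ⟨C, hC, hb⟩ := hWρ (t + 1)
    rw [tendsto_iff_norm_sub_tendsto_zero]
    refine squeeze_zero (fun _ => norm_nonneg _) (fun n =>
      norm_integral_diffQuot_sub_le hW hW0 hb n ht (by linarith [hle1 n])) ?_
    simpa using (tendsto_pow_atTop_nhds_zero_of_lt_one hρ0 hρ1).const_mul (2 * C)

end ForcingByPath

/-! ### Dyadic chaining -/

section Chaining

variable {H : Type*} [NormedAddCommGroup H]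

/-- Chaining: bounds on dyadic increments give a modulus of continuity. -/
theorem HasDyadicModulus.of_dyadic {W : ℝ → H} (hW : Continuous W) {ρ : ℝ} (hρ0 : 0 ≤ ρ)
    (hρ1 : ρ < 1)
    (h : ∀ N : ℕ, ∃ C : ℝ, 0 ≤ C ∧ ∀ n k : ℕ, k < N * 2 ^ n →
      ‖W ((k + 1 : ℕ) / 2 ^ n) - W (k / 2 ^ n)‖ ≤ C * ρ ^ n) :
    HasDyadicModulus W ρ := by
  intro N'
  obtain ⟨N, hN⟩ := exists_nat_ge N'
  obtain ⟨C, hC, hb⟩ := h N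
  -- `q t j / 2 ^ j` is the dyadic point of level `j` just below `t`. Passing to level `j + 1`
  -- either keeps the point or moves it by one step, so the increments along the chain are
  -- geometric.
  set q : ℝ → ℕ → ℕ := fun t j => ⌊t * 2 ^ j⌋₊ with hq
  have hqle : ∀ t : ℝ, 0 ≤ t → ∀ j, (q t j : ℝ) ≤ t * 2 ^ j := fun t ht j =>
    Nat.floor_le (by positivity)
  have hqlt : ∀ t : ℝ, ∀ j, t * 2 ^ j < q t j + 1 := fun t j => Nat.lt_floor_add_one _
  have hstep : ∀ t : ℝ, 0 ≤ t → t ≤ N → ∀ j,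
      dist (W (q t j / 2 ^ j)) (W (q t (j + 1) / 2 ^ (j + 1))) ≤ C * ρ * ρ ^ j := by
    intro t ht htN j
    have hle := hqle t ht j
    have hlt := hqlt t j
    have hle' := hqle t ht (j + 1)
    have hlt' := hqlt t (j + 1)
    rw [pow_succ] at hle' hlt'
    have h1 : 2 * q t j ≤ q t (j + 1) := by
      have : (2 * q t j : ℝ) < q t (j + 1) + 1 := by linarith
      exact_mod_cast Nat.lt_succ_iff.1 (by exact_mod_cast this)
    have h2 : q t (j + 1) ≤ 2 * q t j + 1 := by
      have : (q t (j + 1) : ℝ) < 2 * q t j + 1 + 1 := by linarith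
      exact_mod_cast Nat.lt_succ_iff.1 (by exact_mod_cast this)
    have e1 : (q t j : ℝ) / 2 ^ j = ((2 * q t j : ℕ) : ℝ) / 2 ^ (j + 1) := by
      push_cast
      rw [pow_succ]
      field_simp
    rw [e1]
    rcases h1.eq_or_lt with h1 | h1
    · rw [h1, dist_self]
      positivity
    · have h3 : q t (j + 1) = 2 * q t j + 1 := by omega
      rw [h3, dist_comm, dist_eq_norm]
      refine (hb (j + 1) (2 * q t j) ?_).trans (le_of_eq (by ring))
      have h4 : (q t (j + 1) : ℝ) ≤ N * 2 ^ (j + 1) := by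
        rw [pow_succ]
        refine hle'.trans ?_
        gcongr
      have h5 : q t (j + 1) ≤ N * 2 ^ (j + 1) := by exact_mod_cast h4
      omega
  have htend : ∀ t : ℝ, 0 ≤ t → Tendsto (fun j => W (q t j / 2 ^ j)) atTop (𝓝 (W t)) := by
    intro t ht
    refine (hW.tendsto t).comp ?_
    rw [tendsto_iff_norm_sub_tendsto_zero]
    refine squeeze_zero (fun _ => norm_nonneg _) (g := fun j : ℕ => ((1 : ℝ) / 2) ^ j) (fun j => ?_)
      (tendsto_pow_atTop_nhds_zero_of_lt_one (by norm_num) (by norm_num))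
    have h2 : (0 : ℝ) < 2 ^ j := by positivity
    have e : (q t j : ℝ) / 2 ^ j - t = (q t j - t * 2 ^ j) / 2 ^ j := by field_simp
    rw [e, norm_div, Real.norm_of_nonneg h2.le, one_div, inv_pow, ← one_div]
    gcongr
    rw [Real.norm_eq_abs, abs_le]
    constructor <;> linarith [hqle t ht j, hqlt t j]
  have hnear : ∀ t : ℝ, 0 ≤ t → t ≤ N → ∀ n,
      ‖W (q t n / 2 ^ n) - W t‖ ≤ C * ρ * ρ ^ n / (1 - ρ) := by
    intro t ht htN n
    rw [← dist_eq_norm]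
    exact dist_le_of_le_geometric_of_tendsto ρ _ hρ1 (hstep t ht htN) (htend t ht) n
  have h1ρ : 0 < 1 - ρ := by linarith
  refine ⟨2 * (C * ρ / (1 - ρ)) + C, by positivity, fun n s t hs hst ht hts => ?_⟩
  have htN := ht.trans hN
  -- If `t - s ≤ 2⁻ⁿ`, the level-`n` approximants of `s` and `t` coincide or are neighbours.
  have hmid : ‖W (q t n / 2 ^ n) - W (q s n / 2 ^ n)‖ ≤ C * ρ ^ n := by
    have h2 : (0 : ℝ) < 2 ^ n := by positivity
    have h1 : q s n ≤ q t n := Nat.floor_le_floor (by gcongr)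
    have h3 : (t - s) * 2 ^ n ≤ 1 := by
      calc (t - s) * 2 ^ n ≤ (1 / 2) ^ n * 2 ^ n := by gcongr
        _ = 1 := by rw [mul_comm, two_pow_mul_half_pow]
    have h4 : q t n ≤ q s n + 1 := by
      have : (q t n : ℝ) < q s n + 1 + 1 := by linarith [hqle t (hs.trans hst) n, hqlt s n]
      exact_mod_cast Nat.lt_succ_iff.1 (by exact_mod_cast this)
    rcases h1.eq_or_lt with h1 | h1
    · rw [h1, sub_self, norm_zero]
      positivity
    · have h5 : q t n = q s n + 1 := by omega
      rw [h5]
      refine hb n (q s n) ?_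
      have h6 : (q t n : ℝ) ≤ N * 2 ^ n := (hqle t (hs.trans hst) n).trans (by gcongr)
      have h7 : q t n ≤ N * 2 ^ n := by exact_mod_cast h6
      omega
  have e : W t - W s = -(W (q t n / 2 ^ n) - W t) + (W (q t n / 2 ^ n) - W (q s n / 2 ^ n)) +
      (W (q s n / 2 ^ n) - W s) := by abel
  rw [e]
  refine (norm_add_le _ _).trans ((add_le_add ((norm_add_le _ _).trans (add_le_add
    ((norm_neg _).le.trans (hnear t (hs.trans hst) htN n)) hmid))
    (hnear s hs (hst.trans htN) n)).trans (le_of_eq ?_))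
  ring

end Chaining

/-! ### Hölder regularity of Wiener paths -/

section WienerPaths

variable {H : Type*} [NormedAddCommGroup H] [InnerProductSpace ℂ H]

theorem exists_eq_re_inner [CompleteSpace H] (L : StrongDual ℝ H) : ∃ h : H, ∀ x, L x = (inner ℂ h x).re := by
  let _ : InnerProductSpace ℝ H := InnerProductSpace.complexToReal
  obtain ⟨h, hh⟩ := (InnerProductSpace.toDual ℝ H).surjective L
  refine ⟨h, fun x => ?_⟩
  rw [← hh, InnerProductSpace.toDual_apply_apply]
  rfl

variable [MeasurableSpace H] [BorelSpace H] [SecondCountableTopology H] {Ω : Type*}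
  [MeasurableSpace Ω] {P : Measure Ω} {Q : H →L[ℝ] H} {W : ℝ → Ω → H}

namespace IsTwoSidedWiener

theorem measurable_increment (hW : IsTwoSidedWiener P Q W) (s t : ℝ) :
    Measurable fun ω => W t ω - W s ω :=
  (hW.measurable t).sub (hW.measurable s)

theorem map_increment_dual (hW : IsTwoSidedWiener P Q W) {s t : ℝ} (hst : s ≤ t)
    (L : StrongDual ℝ H) {h : H} (hL : ∀ x, L x = (inner ℂ h x).re) :
    (P.map fun ω => W t ω - W s ω).map L =
      gaussianReal 0 (Real.toNNReal ((t - s) * (inner ℂ h (Q h)).re)) := by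
  rw [Measure.map_map L.continuous.measurable (hW.measurable_increment s t),
    ← hW.gaussian s t hst h]
  congr 1
  funext ω
  exact hL _

variable [CompleteSpace H]

theorem isGaussian_increment (hW : IsTwoSidedWiener P Q W) {s t : ℝ} (hst : s ≤ t) :
    IsGaussian (P.map fun ω => W t ω - W s ω) :=
  isGaussian_of_map_eq_gaussianReal fun L => by
    obtain ⟨h, hh⟩ := exists_eq_re_inner L
    exact ⟨_, _, hW.map_increment_dual hst L hh⟩

variable [IsProbabilityMeasure P]

/-- Every continuous real functional has the same centred Gaussian law under both measures, so the
characteristic functionals agree. This scaling reduces all increment moments to those of `W 1 - W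
0`. -/
theorem map_increment_eq (hW : IsTwoSidedWiener P Q W) {s t : ℝ} (hst : s ≤ t) :
    (P.map fun ω => W t ω - W s ω) =
      (P.map fun ω => W 1 ω - W 0 ω).map (fun x => Real.sqrt (t - s) • x) := by
  have hsm : Measurable fun x : H => Real.sqrt (t - s) • x :=
    (continuous_const_smul _).measurable
  have := Measure.isProbabilityMeasure_map (μ := P) (hW.measurable_increment s t).aemeasurable
  have := Measure.isProbabilityMeasure_map (μ := P) (hW.measurable_increment 0 1).aemeasurable
  have := Measure.isProbabilityMeasure_map (μ := P.map fun ω => W 1 ω - W 0 ω) hsm.aemeasurable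
  refine Measure.ext_of_charFunDual ?_
  ext L
  obtain ⟨h, hh⟩ := exists_eq_re_inner L
  rw [charFunDual_eq_charFun_map_one, charFunDual_eq_charFun_map_one,
    hW.map_increment_dual hst L hh, Measure.map_map L.continuous.measurable hsm]
  have e : (L ∘ fun x : H => Real.sqrt (t - s) • x) = (fun r => Real.sqrt (t - s) * r) ∘ L := by
    funext x
    simp
  have hsq : NNReal.mk (Real.sqrt (t - s) ^ 2) (sq_nonneg _) = Real.toNNReal (t - s) := by
    ext
    simp [Real.sq_sqrt (sub_nonneg.2 hst), sub_nonneg.2 hst]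
  rw [e, ← Measure.map_map (measurable_const_mul _) L.continuous.measurable,
    hW.map_increment_dual zero_le_one L hh, gaussianReal_map_const_mul, mul_zero, sub_zero, one_mul]
  rw [hsq, Real.toNNReal_mul (sub_nonneg.2 hst)]

theorem lintegral_increment (hW : IsTwoSidedWiener P Q W) (m : ℕ) {s t : ℝ} (hst : s ≤ t) :
    ∫⁻ ω, ENNReal.ofReal (‖W t ω - W s ω‖ ^ (2 * m)) ∂P =
      ENNReal.ofReal ((t - s) ^ m) *
        ∫⁻ ω, ENNReal.ofReal (‖W 1 ω - W 0 ω‖ ^ (2 * m)) ∂P := by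
  have hn : Measurable fun x : H => ENNReal.ofReal (‖x‖ ^ (2 * m)) := by fun_prop
  have hsm : Measurable fun x : H => Real.sqrt (t - s) • x :=
    (continuous_const_smul _).measurable
  have h1 := lintegral_map (μ := P) hn (hW.measurable_increment s t)
  have h2 := lintegral_map (μ := P) hn (hW.measurable_increment 0 1)
  rw [← h1, ← h2, hW.map_increment_eq hst, lintegral_map hn hsm, ← lintegral_const_mul _ hn]
  refine lintegral_congr fun x => ?_
  rw [← ENNReal.ofReal_mul (pow_nonneg (sub_nonneg.2 hst) _), norm_smul, mul_pow, pow_mul _ 2 m,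
    Real.norm_of_nonneg (Real.sqrt_nonneg _), Real.sq_sqrt (sub_nonneg.2 hst)]

theorem lintegral_increment_ne_top (hW : IsTwoSidedWiener P Q W) (m : ℕ) :
    ∫⁻ ω, ENNReal.ofReal (‖W 1 ω - W 0 ω‖ ^ (2 * m)) ∂P ≠ ⊤ := by
  have hn : Measurable fun x : H => ENNReal.ofReal (‖x‖ ^ (2 * m)) := by fun_prop
  have h2 := lintegral_map (μ := P) hn (hW.measurable_increment 0 1)
  rw [← h2]
  have := hW.isGaussian_increment zero_le_one
  have h3 := (IsGaussian.memLp_id (P.map fun ω => W 1 ω - W 0 ω) ((2 * m : ℕ) : ENNReal)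
    (ENNReal.natCast_ne_top _)).integrable_norm_pow'
  have h4 := h3.hasFiniteIntegral
  rw [hasFiniteIntegral_iff_ofReal (ae_of_all _ fun x => by positivity)] at h4
  exact h4.ne

/-- Kolmogorov's argument: sum `ρ ^ (-2mn) ‖ΔW‖ ^ (2m)` over all dyadic increments. The expectation
at level `n` is a constant times `(2 r ^ m) ^ n` with `r = 1 / (2 ρ²) < 1`, so for large `m` the sum
is almost surely finite. -/
theorem ae_dyadic_bound (hW : IsTwoSidedWiener P Q W) {ρ : ℝ} (hρ0 : 0 < ρ)
    (hρ : 1 / 2 < ρ ^ 2) (N : ℕ) :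
    ∀ᵐ ω ∂P, ∃ C : ℝ, 0 ≤ C ∧ ∀ n k : ℕ, k < N * 2 ^ n →
      ‖W ((k + 1 : ℕ) / 2 ^ n) ω - W (k / 2 ^ n) ω‖ ≤ C * ρ ^ n := by
  set r : ℝ := 1 / (2 * ρ ^ 2) with hr
  have hr0 : 0 < r := by positivity
  have hr1 : r < 1 := by
    rw [hr, div_lt_one (by positivity)]
    linarith
  obtain ⟨m, hm⟩ := exists_pow_lt_of_lt_one (show (0 : ℝ) < 1 / 2 by norm_num) hr1
  have hm0 : m ≠ 0 := by
    rintro rfl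
    norm_num at hm
  set g : ℕ → ℕ → Ω → ENNReal := fun n k ω => ENNReal.ofReal (((ρ ^ n)⁻¹) ^ (2 * m)) *
    ENNReal.ofReal (‖W ((k + 1 : ℕ) / 2 ^ n) ω - W (k / 2 ^ n) ω‖ ^ (2 * m)) with hg
  have hgm : ∀ n k, Measurable (g n k) := fun n k => by
    have := hW.measurable_increment (k / 2 ^ n) ((k + 1 : ℕ) / 2 ^ n)
    exact ((this.norm.pow_const _).ennreal_ofReal).const_mul _
  set M := ∫⁻ ω, ENNReal.ofReal (‖W 1 ω - W 0 ω‖ ^ (2 * m)) ∂P with hM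
  have hgi : ∀ n k, ∫⁻ ω, g n k ω ∂P = ENNReal.ofReal ((r ^ m) ^ n) * M := by
    intro n k
    have h2 : (0 : ℝ) < 2 ^ n := by positivity
    have hm' : Measurable fun ω => ENNReal.ofReal
        (‖W ((k + 1 : ℕ) / 2 ^ n) ω - W (k / 2 ^ n) ω‖ ^ (2 * m)) :=
      ((hW.measurable_increment _ _).norm.pow_const _).ennreal_ofReal
    have hle : (k : ℝ) / 2 ^ n ≤ (k + 1 : ℕ) / 2 ^ n := by
      gcongr
      exact Nat.le_succ k
    rw [hg, lintegral_const_mul _ hm', hW.lintegral_increment m hle, ← mul_assoc,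
      ← ENNReal.ofReal_mul (by positivity)]
    congr 2
    rw [← sub_div]
    push_cast
    rw [add_sub_cancel_left, hr, pow_mul, ← mul_pow, ← pow_mul, mul_comm m n, pow_mul]
    congr 1
    rw [div_pow, mul_pow]
    field_simp
    ring
  have hfin : ∫⁻ ω, ∑' n, ∑ k ∈ Finset.range (N * 2 ^ n), g n k ω ∂P ≠ ⊤ := by
    rw [lintegral_tsum fun n => (Finset.measurable_fun_sum _ fun k _ => hgm n k).aemeasurable]
    have h1 : ∀ n, ∫⁻ ω, ∑ k ∈ Finset.range (N * 2 ^ n), g n k ω ∂P =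
        ENNReal.ofReal (N * (2 * r ^ m) ^ n) * M := by
      intro n
      rw [lintegral_finsetSum _ fun k _ => hgm n k, Finset.sum_congr rfl fun k _ => hgi n k,
        Finset.sum_const, Finset.card_range, nsmul_eq_mul, ← mul_assoc, ← ENNReal.ofReal_natCast,
        ← ENNReal.ofReal_mul (by positivity)]
      push_cast
      rw [mul_pow, mul_assoc]
    have hs : Summable fun n : ℕ => (N : ℝ) * (2 * r ^ m) ^ n :=
      (summable_geometric_of_lt_one (by positivity) (by linarith)).mul_left _
    rw [tsum_congr h1, ENNReal.tsum_mul_right]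
    exact ENNReal.mul_ne_top hs.tsum_ofReal_ne_top (hW.lintegral_increment_ne_top m)
  filter_upwards [ae_lt_top (Measurable.tsum fun n =>
    Finset.measurable_fun_sum _ fun k _ => hgm n k) hfin] with ω hω
  set f := ∑' n, ∑ k ∈ Finset.range (N * 2 ^ n), g n k ω with hf
  refine ⟨f.toReal + 1, by positivity, fun n k hk => ?_⟩
  have h1 : g n k ω ≤ f := (Finset.single_le_sum (f := fun k => g n k ω) (fun _ _ => zero_le)
    (Finset.mem_range.2 hk)).trans (ENNReal.le_tsum n)
  rw [hg] at h1
  beta_reduce at h1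
  rw [← ENNReal.ofReal_mul (by positivity), ENNReal.ofReal_le_iff_le_toReal hω.ne, ← mul_pow] at h1
  -- Adding `1` makes the base at least `1`, so the root of order `2m` can be taken without
  -- distinguishing small sums.
  have h2 : f.toReal ≤ (f.toReal + 1) ^ (2 * m) :=
    (le_add_of_nonneg_right zero_le_one).trans
      (le_self_pow₀ (le_add_of_nonneg_left ENNReal.toReal_nonneg) (by omega))
  have h3 := le_of_pow_le_pow_left₀ (by omega) (by positivity) (h1.trans h2)
  rwa [inv_mul_le_iff₀ (by positivity), mul_comm] at h3

theorem ae_hasDyadicModulus (hW : IsTwoSidedWiener P Q W) {ρ : ℝ} (hρ0 : 0 < ρ) (hρ1 : ρ < 1)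
    (hρ : 1 / 2 < ρ ^ 2) : ∀ᵐ ω ∂P, HasDyadicModulus (fun t => W t ω) ρ := by
  filter_upwards [hW.continuous, ae_all_iff.2 fun N => hW.ae_dyadic_bound hρ0 hρ N] with ω hc hb
  exact HasDyadicModulus.of_dyadic hc hρ0.le hρ1 hb

end IsTwoSidedWiener

end WienerPaths

/-- The cap `3/4` keeps `a` below `1` even for `p = 1`, and lies above `1/2` as the Wiener case
requires. -/
theorem exists_kernel_exponent {p : ℝ} (hp : 1 ≤ p) :
    ∃ a : ℝ, 0 < a ∧ a < 1 ∧ a ≤ 1 / p ∧ (p < 2 → 1 / 2 < a) := by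
  have hp0 : 0 < p := by linarith
  refine ⟨min (1 / p) (3 / 4), lt_min (by positivity) (by norm_num),
    (min_le_right _ _).trans_lt (by norm_num), min_le_left _ _, fun h => lt_min ?_ (by norm_num)⟩
  exact one_div_lt_one_div_of_lt hp0 h

/-- For `ρ = 2 ^ (-α)` the conditions read `1 - a < α < 1/2`; the midpoint is chosen. -/
theorem exists_modulus_ratio {a : ℝ} (ha : 1 / 2 < a) (ha1 : a < 1) :
    ∃ ρ : ℝ, 0 < ρ ∧ ρ < 1 ∧ 1 / 2 < ρ ^ 2 ∧ (1 / 2) ^ (a - 1) * ρ < 1 := by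
  refine ⟨(1 / 2) ^ ((3 / 2 - a) / 2), by positivity, ?_, ?_, ?_⟩
  · exact Real.rpow_lt_one (by norm_num) (by norm_num) (by linarith)
  · rw [← Real.rpow_mul_natCast (by norm_num)]
    calc (1 / 2 : ℝ) = (1 / 2) ^ (1 : ℝ) := (Real.rpow_one _).symm
      _ < _ := Real.rpow_lt_rpow_of_exponent_gt (by norm_num) (by norm_num) (by
        push_cast
        linarith)
  · rw [← Real.rpow_add (by norm_num)]
    exact Real.rpow_lt_one (by norm_num) (by norm_num) (by linarith)

end NonDenseSEE

/-! ### Assembly of the theorem -/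

theorem proposition4p7
    {H : Type*} [NormedAddCommGroup H] [InnerProductSpace ℂ H] [CompleteSpace H]
    [TopologicalSpace.SeparableSpace H] [MeasurableSpace H] [BorelSpace H]
    {Ω : Type*} [MeasurableSpace Ω] (P : Measure Ω) [IsProbabilityMeasure P]
    -- the operator
    (A : H →ₗ.[ℂ] H)
    (hsect : NonDenseSEE.IsSectorial (NonDenseSEE.part A))
    (ωA p : ℝ) (hωA : ωA < 0) (hp : 1 ≤ p)
    (hρ : ∀ l : ℝ, ωA < l → (l : ℂ) ∈ NonDenseSEE.resolventSet A)
    (hlimsup : limsup (fun l : ℝ =>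
      ENNReal.ofReal (l ^ (1 / p) * ‖NonDenseSEE.resolvent A (l : ℂ)‖)) atTop < ⊤)
    (hcompact : ∀ z ∈ NonDenseSEE.resolventSet A,
      IsCompactOperator (NonDenseSEE.resolvent A z))
    -- the noise
    (θ : ℝ → Ω → Ω) (hθ : NonDenseSEE.IsErgodicMetricDS P θ)
    (Q : H →L[ℝ] H) (W : ℝ → Ω → H) (hW : NonDenseSEE.IsTwoSidedWiener P Q W)
    (hWθ : ∀ (s t : ℝ) (ω : Ω), W t (θ s ω) = W (t + s) ω - W s ω)
    -- the stochastic convolution has continuous paths in the closure of the domain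
    (hconv : p < 2 ∨ ∀ᵐ ω ∂P, ∃ Y : ℝ → NonDenseSEE.domClosure A,
      NonDenseSEE.IsIntegratedSolution A (fun _ => 0) (fun t => W t ω) 0 Y)
    -- the nonlinearity
    (G : NonDenseSEE.domClosure A → H) (hGlip : ∃ K, LipschitzWith K G)
    (hG : ContDiff ℝ 1 G) :
    ∃ T : ℝ → NonDenseSEE.domClosure A →L[ℂ] NonDenseSEE.domClosure A,
      NonDenseSEE.IsC0SemigroupGeneratedBy T (NonDenseSEE.part A) ∧
      ∀ᵐ ω ∂P,
        (∀ ξ, NonDenseSEE.ExistsUniqueIntegratedSolution A G (fun t => W t ω) ξ) ∧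
        ∀ φ : ℝ → NonDenseSEE.domClosure A → NonDenseSEE.domClosure A,
          φ = NonDenseSEE.solutionMap A G (fun t => W t ω) →
          (∀ t : ℝ, 0 ≤ t → ∀ ξ, DifferentiableAt ℝ (φ t) ξ) ∧
          ∀ t : ℝ, 0 < t → ∀ ξ,
            (∀ η : NonDenseSEE.domClosure A,
              (∀ l : ℝ, IntervalIntegrable (fun s =>
                T (t - s) ((l : ℂ) • NonDenseSEE.resolventInto A (l : ℂ)
                  (fderiv ℝ G (φ s ξ) (fderiv ℝ (φ s) ξ η)))) volume 0 t) ∧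
              Tendsto (fun l : ℝ => T t η + ∫ s in (0 : ℝ)..t,
                T (t - s) ((l : ℂ) • NonDenseSEE.resolventInto A (l : ℂ)
                  (fderiv ℝ G (φ s ξ) (fderiv ℝ (φ s) ξ η)))) atTop
                (𝓝 (fderiv ℝ (φ t) ξ η))) ∧
            IsCompactOperator (fderiv ℝ (φ t) ξ) := by

  obtain ⟨K, hK, hbound⟩ := NonDenseSEE.exists_resolvent_bound hlimsup
  obtain ⟨G', hG'⟩ := hGlip
  have hlim0 : Tendsto (fun l : ℝ => ‖NonDenseSEE.resolvent A (l : ℂ)‖) atTop (𝓝 0) := by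
    refine squeeze_zero' (Eventually.of_forall fun _ => norm_nonneg _) hbound ?_
    simpa using (tendsto_rpow_neg_atTop (show 0 < 1 / p by positivity)).const_mul K
  obtain ⟨T, D, w, hT, hTA, hgen, hlim⟩ := hsect.exists_analyticSemigroup
    (NonDenseSEE.dense_domain_part hρ hlim0)
  have hev : ∀ᶠ l : ℝ in atTop, (l : ℂ) ∈ NonDenseSEE.resolventSet A ∧
      NonDenseSEE.IsGeneratedThrough T D l
        (NonDenseSEE.resolventInto A l ∘L NonDenseSEE.domIncl A) := by
    filter_upwards [eventually_gt_atTop w, eventually_gt_atTop ωA] with l hl hl'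
    exact ⟨hρ l hl', hgen l (by simpa using hl) _ (NonDenseSEE.IsResolvent.part (hρ l hl'))⟩
  obtain ⟨a, ha0, ha1, hap, hap2⟩ := NonDenseSEE.exists_kernel_exponent hp
  obtain ⟨l, hl, hgl⟩ := hev.exists
  have hP := NonDenseSEE.isLinearProblem hl hT hgl
  have hU := NonDenseSEE.isSingularKernel_mildKernel hT ha0 hap hK hl hgl
    ((hev.and hbound).mono fun l hl => ⟨hl.1.1, hl.1.2, hl.2⟩)
  refine ⟨T, hTA, ?_⟩
  -- Randomness enters only through a mild solution of the linear problem for almost every path; the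
  -- rest is the deterministic `flow_conclusion`.
  suffices hY : ∀ᵐ ω ∂P, ∃ Y : ℝ → NonDenseSEE.domClosure A,
      NonDenseSEE.IsMild (NonDenseSEE.domIncl A) (NonDenseSEE.resolventInto A l) l Y
        (fun t => W t ω) by
    filter_upwards [hY] with ω ⟨Y, hY⟩
    exact NonDenseSEE.flow_conclusion hl hP hU (hcompact _ hl) hev hlim hY hG' hG
  rcases hconv with hp2 | hconv
  · obtain ⟨ρ, hρ0, hρ1, hρ2, hρa⟩ := NonDenseSEE.exists_modulus_ratio (hap2 hp2) ha1
    have := UniformSpace.secondCountable_of_separable H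
    filter_upwards [hW.ae_hasDyadicModulus hρ0 hρ1 hρ2, hW.continuous, hW.zero] with ω h1 h2 h3
    exact hP.exists_isMild ha1 hU hρ0.le hρa h2 h3 h1
  · filter_upwards [hconv] with ω ⟨Y, hY⟩
    refine ⟨Y, ((NonDenseSEE.isIntegratedSolution_iff hl).1 hY).congr (fun _ _ => rfl)
      fun t _ => ?_⟩
    simp
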